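/- Let $M$ be a closed smooth $3$-manifold (not assumed connected), with a fixed orientation, and equipped with a Seifert fibration: a partition of $M$ into fibers such that every point $p$ has an open neighbourhood that is a union of fibers and is diffeomorphic, by a diffeomorphism taking fibers to fibers and the fiber through $p$ to the central one, to a fibered solid torus, i.e. to $D^2\times S^1$ (with $D^2\subset\mathbb C$ the open unit disc) fibered by the orbits of the action $c\cdot(z,w)=(c^{b}z,c^{a}w)$ of $S^1$, for some coprime integers $a\ge 1$ and $b$. Let $X$ be a nowhere vanishing smooth vector field on $M$ tangent to the fibers, and let $\alpha$ be a smooth contact form on $M$ (that is, a $1$-form such that $\alpha\wedge d\alpha$ vanishes nowhere) which is invariant under $X$: $\mathcal L_X\alpha=0$. Call a smooth Riemannian metric $g$ on $M$ \emph{adapted} to $\alpha$ if $\ast\,d\alpha=\mu\,\alpha$ for some nowhere vanishing $\mu\in C^\infty(M)$, where $\ast$ is the Hodge star of $g$. Then: (1) There exists a metric $g$ adapted to $\alpha$ for which $X$ is a Killing vector field, i.e. $\mathcal L_X g=0$. (2) For every metric $g$ adapted to $\alpha$ for which $X$ is Killing, there is a metric $g'$ adapted to $\alpha$ and conformal to $g$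 (that is, $g'=f g$ with $f$ a positive smooth function) for which $X$ is a unit Killing vector field, i.e. $\mathcal L_X g'=0$ and $g'(X,X)=1$. -/

import Mathlib

open Bundle Set Topology
open scoped Manifold ContDiff

noncomputable section

/-- The model space of 3-manifolds. -/
abbrev E3 : Type := EuclideanSpace ℝ (Fin 3)

section VectorFieldsAndForms

variable (M : Type*) [TopologicalSpace M] [ChartedSpace E3 M] [IsManifold (𝓡 3) ∞ M]

/-- Smooth vector fields on `M`. -/
abbrev SmoothVectorField : Type _ :=
  Cₛ^∞⟮𝓡 3; E3, fun p : M ↦ TangentSpace (𝓡 3) p⟯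

/-- Smooth 1-forms on `M`, i.e. smooth sections of the cotangent bundle. -/
abbrev SmoothOneForm : Type _ :=
  Cₛ^∞⟮𝓡 3; E3 →L[ℝ] ℝ, fun p : M ↦ TangentSpace (𝓡 3) p →L[ℝ] ℝ⟯

/-- Smooth Riemannian metrics on `M`. -/
abbrev SmoothMetric : Type _ :=
  ContMDiffRiemannianMetric (𝓡 3) ∞ E3 (fun p : M ↦ TangentSpace (𝓡 3) p)

variable {M}

/-- The expression of a 1-form in the preferred chart at `p`: its pullback to (an open subset of)
`ℝ³` under the inverse of the chart. -/
def oneFormInChart (α : SmoothOneForm M) (p : M) (y : E3) : E3 →L[ℝ] ℝ :=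
  (α ((extChartAt (𝓡 3) p).symm y)).comp
    (mfderiv 𝓘(ℝ, E3) (𝓡 3) (extChartAt (𝓡 3) p).symm y)

/-- The exterior derivative `dα` of a 1-form at `p`, as an alternating bilinear function on
`T_p M`: in the preferred chart at `p`, `dα(u, v) = ∂_u (α(v)) - ∂_v (α(u))` for constant
`u`, `v`. The differential of the preferred chart identifies `T_p M` with `ℝ³`. -/
def oneFormExtDeriv (α : SmoothOneForm M) (p : M) (u v : TangentSpace (𝓡 3) p) : ℝ :=
  let u' : E3 := mfderiv (𝓡 3) 𝓘(ℝ, E3) (extChartAt (𝓡 3) p) p u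
  let v' : E3 := mfderiv (𝓡 3) 𝓘(ℝ, E3) (extChartAt (𝓡 3) p) p v
  fderiv ℝ (oneFormInChart α p) (extChartAt (𝓡 3) p p) u' v'
    - fderiv ℝ (oneFormInChart α p) (extChartAt (𝓡 3) p p) v' u'

/-- `α` is a contact form: the 3-form `α ∧ dα` vanishes nowhere. -/
def IsContactForm (α : SmoothOneForm M) : Prop :=
  ∀ p : M, ∃ u v w : TangentSpace (𝓡 3) p,
    α p u * oneFormExtDeriv α p v w + α p v * oneFormExtDeriv α p w u
      + α p w * oneFormExtDeriv α p u v ≠ 0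

/-- `L_X α = 0`, where `(L_X α)(Y) = X(α(Y)) - α([X, Y])` for `Y` smooth near the point. -/
def PreservesForm (X : SmoothVectorField M) (α : SmoothOneForm M) : Prop :=
  ∀ (p : M) (Y : ∀ q : M, TangentSpace (𝓡 3) q),
    ContMDiffAt (𝓡 3) ((𝓡 3).prod 𝓘(ℝ, E3)) ∞ (fun q ↦ TotalSpace.mk' E3 q (Y q)) p →
    (mfderiv (𝓡 3) 𝓘(ℝ, ℝ) (fun q ↦ α q (Y q)) p (X p) : ℝ)
      = α p (VectorField.mlieBracket (𝓡 3) (fun q ↦ X q) Y p)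

/-- `X` is a Killing vector field of `g`: `L_X g = 0`, where
`(L_X g)(Y, Z) = X(g(Y, Z)) - g([X, Y], Z) - g(Y, [X, Z])` for `Y`, `Z` smooth near the point. -/
def IsKilling (g : SmoothMetric M) (X : SmoothVectorField M) : Prop :=
  ∀ (p : M) (Y Z : ∀ q : M, TangentSpace (𝓡 3) q),
    ContMDiffAt (𝓡 3) ((𝓡 3).prod 𝓘(ℝ, E3)) ∞ (fun q ↦ TotalSpace.mk' E3 q (Y q)) p →
    ContMDiffAt (𝓡 3) ((𝓡 3).prod 𝓘(ℝ, E3)) ∞ (fun q ↦ TotalSpace.mk' E3 q (Z q)) p →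
    (mfderiv (𝓡 3) 𝓘(ℝ, ℝ) (fun q ↦ g.inner q (Y q) (Z q)) p (X p) : ℝ)
      = g.inner p (VectorField.mlieBracket (𝓡 3) (fun q ↦ X q) Y p) (Z p)
        + g.inner p (Y p) (VectorField.mlieBracket (𝓡 3) (fun q ↦ X q) Z p)

/-- `g'` is (pointwise) conformal to `g`. -/
def IsConformalTo (g' g : SmoothMetric M) : Prop :=
  ∃ f : M → ℝ, ContMDiff (𝓡 3) 𝓘(ℝ, ℝ) ∞ f ∧ (∀ p, 0 < f p) ∧
    ∀ (p : M) (u v : TangentSpace (𝓡 3) p), g'.inner p u v = f p * g.inner p u v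

end VectorFieldsAndForms

section HodgeStar

variable (M : Type*) [TopologicalSpace M] [ChartedSpace E3 M] [IsManifold (𝓡 3) ∞ M]

/-- An orientation of the manifold `M`: a choice of an orientation of every tangent space such
that near every point there is a continuous, positively oriented local frame. -/
structure ManifoldOrientation where
  /-- the orientation of the tangent space at a point -/
  orientationAt : ∀ p : M, Orientation ℝ (TangentSpace (𝓡 3) p) (Fin 3)
  exists_frame : ∀ p : M, ∃ U : Set M, IsOpen U ∧ p ∈ U ∧
    ∃ s : Fin 3 → ∀ q : M, TangentSpace (𝓡 3) q,
      (∀ i, ContinuousOn (fun q ↦ TotalSpace.mk' E3 q (s i q) : M → TangentBundle (𝓡 3) M) U) ∧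
      ∀ q ∈ U, ∃ b : Module.Basis (Fin 3) ℝ (TangentSpace (𝓡 3) q),
        (∀ i, b i = s i q) ∧ b.orientation = orientationAt q

variable {M}

/-- `η = ∗θ` at the point `p`, for a 2-form `θ` and a 1-form `η`, where `∗` is the Hodge star of
the metric `g` and the orientation `o`: one has `∗(e² ∧ e³) = e¹`, cyclically, i.e.
`η(e₁) = θ(e₂, e₃)`, in every positively oriented orthonormal basis `e₁, e₂, e₃` of `T_p M`
(whose cyclic permutations are again such bases). -/
def IsHodgeStarAt (o : ManifoldOrientation M) (g : SmoothMetric M) (p : M)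
    (θ : TangentSpace (𝓡 3) p → TangentSpace (𝓡 3) p → ℝ)
    (η : TangentSpace (𝓡 3) p →L[ℝ] ℝ) : Prop :=
  ∀ e : Module.Basis (Fin 3) ℝ (TangentSpace (𝓡 3) p),
    (∀ i j, g.inner p (e i) (e j) = if i = j then 1 else 0) → e.orientation = o.orientationAt p →
      η (e 0) = θ (e 1) (e 2)

/-- The metric `g` is adapted to `α`: `∗dα = μ α` for a nowhere vanishing smooth function `μ`. -/
def IsAdapted (o : ManifoldOrientation M) (g : SmoothMetric M) (α : SmoothOneForm M) : Prop :=
  ∃ μ : M → ℝ, ContMDiff (𝓡 3) 𝓘(ℝ, ℝ) ∞ μ ∧ (∀ p, μ p ≠ 0) ∧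
    ∀ p, IsHodgeStarAt o g p (oneFormExtDeriv α p) (μ p • α p)

end HodgeStar

section Seifert

variable (M : Type*) [TopologicalSpace M] [ChartedSpace E3 M] [IsManifold (𝓡 3) ∞ M]

/-- A Seifert fibration of `M`: a partition into fibers such that every point `p` has an open
neighbourhood, a union of fibers, which is diffeomorphic, by a diffeomorphism carrying fibers onto
fibers and the fiber through `p` onto the central one, to a fibered solid torus of some type
`(a, b)`, `a ≥ 1`, `gcd (a, b) = 1`. That is the open solid torus `D² × S¹`, fibered by the orbits
of the circle action `c • (z, w) = (c ^ b z, c ^ a w)`. -/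
structure SeifertFibration where
  /-- the relation "to lie on the same fiber" -/
  sameFiber : Setoid M
  exists_fiberedTorus : ∀ p : M, ∃ (a : ℕ) (b : ℤ) (φ : OpenPartialHomeomorph M (ℂ × Circle)),
    0 < a ∧ IsCoprime (a : ℤ) b ∧ p ∈ φ.source ∧ (φ p).1 = 0 ∧
    φ.target = Metric.ball (0 : ℂ) 1 ×ˢ univ ∧
    ContMDiffOn (𝓡 3) (𝓘(ℝ, ℂ).prod (𝓡 1)) ∞ φ φ.source ∧
    ContMDiffOn (𝓘(ℝ, ℂ).prod (𝓡 1)) (𝓡 3) ∞ φ.symm φ.target ∧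
    ∀ x ∈ φ.source, ∀ y : M, sameFiber x y ↔
      y ∈ φ.source ∧ ∃ c : Circle, φ y = (((c ^ b : Circle) : ℂ) * (φ x).1, c ^ a * (φ x).2)

variable {M}

/-- The vector field `X` is tangent to the fibers of `S`: each `X p` is the velocity of a smooth
curve in the fiber through `p`. -/
def TangentToFibers (S : SeifertFibration M) (X : SmoothVectorField M) : Prop :=
  ∀ p : M, ∃ γ : ℝ → M, ContMDiff 𝓘(ℝ, ℝ) (𝓡 3) ∞ γ ∧ (∀ t, S.sameFiber p (γ t)) ∧
    γ 0 = p ∧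
    HasMFDerivAt 𝓘(ℝ, ℝ) (𝓡 3) γ 0 ((1 : ℝ →L[ℝ] ℝ).smulRight (X (γ 0)))

end Seifert

end

set_option linter.unusedSectionVars false

open VectorField

noncomputable section

/-! ### Forms, fields, brackets and Cartan's formula in preferred charts -/

section ChartCalculus

variable {M : Type*} [TopologicalSpace M] [ChartedSpace E3 M] [IsManifold (𝓡 3) ∞ M]

/-! Part (1). Let $R$ be the Reeb field: $\alpha(R)=1$, $\iota_R d\alpha=0$. If a metric satisfies
$g(R,\cdot)=\alpha$, then in an oriented orthonormal basis $\alpha$ has coefficients of square sum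
$1$, and $\iota_R d\alpha=0$ forces $\ast d\alpha=\mu\alpha$ with $\mu$ the ratio of $\alpha\wedge
d\alpha$ to the Riemannian volume (`isAdapted_of_reeb`). So it suffices to find an $X$-invariant
metric with $g(R,\cdot)=\alpha$. No averaging over the flow is used. Instead, finitely many
functions $F=a+ib$ with $XF=i\lambda F$, $\lambda$ real, are constructed so that their differentials
jointly separate tangent vectors (`exists_eigenfunctions`). The metric is the sum of $\alpha^2$ and
the squares of the horizontal parts $da-da(R)\alpha$, $db-db(R)\alpha$. It is invariant because
$[X,R]=0$ (`PreservesForm.mlieBracket_reeb_eq_zero`) and because $X$ rotates each pair $(a,b)$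
(`lieDerivative_squaresForm`).

The main point is that the flow of $X$ has constant period along the fibers of a fibered solid
torus. Unwrap the torus by $\sigma(z,t)$, where $t$ is the time of the model circle action, so that
$\partial_t\sigma=K X$ with $K$ a nowhere zero density. Invariance of $\alpha$ gives
$\partial_t(\alpha(\partial_e\sigma))=(\partial_e K)\,\alpha(X)$, and $\alpha(X)$ is constant on
fibers. Integration over a period $2\pi$ gives $\partial_e P\cdot\alpha(X)=0$ for
$P(z)=\int_0^{2\pi}K\,dt$. If $dP\ne0$ somewhere, then $\alpha(X)$ vanishes near a point, so
$\iota_X d\alpha=-d(\alpha(X))$ vanishes there too, and the contact condition forces $X=0$, a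
contradiction. Hence $P=2\pi c$ (`exists_period_eq`).

With constant period, the equation $\partial_t u=K-c$ has a smooth solution $u$ on the torus, given
by a first moment of $K$ over the orbit. If $V$ has weight $m$ under the model action, then
$Ve^{i(m/c)u}$ has constant frequency $m/c$ under $X$. This is applied to the circle coordinate
(weight $a$) and the disc coordinate (weight $b$), both cut off by a function of $|z|$; compactness
then yields a finite family.

Part (2). The factor $f=1/g(X,X)$ is constant along $X$ since $[X,X]=0$, so $fg$ is still invariant.
Being adapted is a conformal condition in dimension three: rescaling by $f$ only replaces $\mu$ by
$\mu/\sqrt f$. -/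

instance isManifold_two_of_smooth : IsManifold (𝓡 3) 2 M :=
  IsManifold.of_le (n := ∞) (WithTop.coe_le_coe.2 le_top)

instance isManifold_three_of_smooth : IsManifold (𝓡 3) 3 M :=
  IsManifold.of_le (n := ∞) (WithTop.coe_le_coe.2 le_top)

/-- The vector field `Y` is smooth at `p`. -/
abbrev SmoothFieldAt (Y : ∀ q : M, TangentSpace (𝓡 3) q) (p : M) : Prop :=
  ContMDiffAt (𝓡 3) ((𝓡 3).prod 𝓘(ℝ, E3)) ∞ (fun q ↦ TotalSpace.mk' E3 q (Y q)) p

/-- The field of linear forms `β` is smooth at `p`. -/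
abbrev SmoothFormAt (β : ∀ q : M, TangentSpace (𝓡 3) q →L[ℝ] ℝ) (p : M) : Prop :=
  ContMDiffAt (𝓡 3) ((𝓡 3).prod 𝓘(ℝ, E3 →L[ℝ] ℝ)) ∞
    (fun q ↦ TotalSpace.mk' (E3 →L[ℝ] ℝ) (E := fun q : M ↦ TangentSpace (𝓡 3) q →L[ℝ] ℝ) q (β q)) p

/-- The differential of a real function, as a field of linear forms. -/
def dForm (f : M → ℝ) (q : M) : TangentSpace (𝓡 3) q →L[ℝ] ℝ :=
  mfderiv (𝓡 3) 𝓘(ℝ, ℝ) f q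

/-- The expression of a field of linear forms in the preferred chart at `p`. -/
def formInChart (β : ∀ q : M, TangentSpace (𝓡 3) q →L[ℝ] ℝ) (p : M) (y : E3) : E3 →L[ℝ] ℝ :=
  (β ((extChartAt (𝓡 3) p).symm y)).comp
    (mfderiv 𝓘(ℝ, E3) (𝓡 3) (extChartAt (𝓡 3) p).symm y)

/-- The expression of a vector field in the preferred chart at `p`. -/
def fieldInChart (Y : ∀ q : M, TangentSpace (𝓡 3) q) (p : M) (y : E3) : E3 :=
  (mfderiv 𝓘(ℝ, E3) (𝓡 3) (extChartAt (𝓡 3) p).symm y).inverse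
    (Y ((extChartAt (𝓡 3) p).symm y))

lemma isInvertible_mfderiv_extChartAt_symm {p : M} {y : E3}
    (hy : y ∈ (extChartAt (𝓡 3) p).target) :
    (mfderiv 𝓘(ℝ, E3) (𝓡 3) (extChartAt (𝓡 3) p).symm y).IsInvertible := by
  have := isInvertible_mfderivWithin_extChartAt_symm (I := 𝓡 3) hy
  simpa only [ModelWithCorners.range_eq_univ, mfderivWithin_univ] using this

lemma formInChart_fieldInChart (β : ∀ q : M, TangentSpace (𝓡 3) q →L[ℝ] ℝ)
    (Y : ∀ q : M, TangentSpace (𝓡 3) q) {p : M} {y : E3}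
    (hy : y ∈ (extChartAt (𝓡 3) p).target) :
    formInChart β p y (fieldInChart Y p y)
      = β ((extChartAt (𝓡 3) p).symm y) (Y ((extChartAt (𝓡 3) p).symm y)) := by
  simp only [formInChart, fieldInChart]
  refine congrArg (β ((extChartAt (𝓡 3) p).symm y)) ?_
  exact (isInvertible_mfderiv_extChartAt_symm hy).self_apply_inverse _

lemma mfderiv_symm_comp_mfderiv_extChartAt {p q : M} (hq : q ∈ (extChartAt (𝓡 3) p).source)
    (v : TangentSpace (𝓡 3) q) :
    mfderiv 𝓘(ℝ, E3) (𝓡 3) (extChartAt (𝓡 3) p).symm (extChartAt (𝓡 3) p q)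
      (mfderiv (𝓡 3) 𝓘(ℝ, E3) (extChartAt (𝓡 3) p) q v) = v := by
  have := mfderivWithin_extChartAt_symm_comp_mfderiv_extChartAt' (I := 𝓡 3) hq
  simp only [ModelWithCorners.range_eq_univ, mfderivWithin_univ] at this
  exact DFunLike.congr_fun this v

lemma formInChart_mfderiv_extChartAt (β : ∀ q : M, TangentSpace (𝓡 3) q →L[ℝ] ℝ) {p q : M}
    (hq : q ∈ (extChartAt (𝓡 3) p).source) (v : TangentSpace (𝓡 3) q) :
    formInChart β p (extChartAt (𝓡 3) p q) (mfderiv (𝓡 3) 𝓘(ℝ, E3) (extChartAt (𝓡 3) p) q v)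
      = β q v := by
  -- The chart followed by its inverse returns `q` only propositionally, so the two tangent spaces
  -- are different types. Generalizing the base point lets the equality be substituted; the same
  -- device recurs below.
  have h : ∀ q' (h : q' = q) (w : TangentSpace (𝓡 3) q'), (w : E3) = v → β q' w = β q v := by
    rintro q' rfl w rfl; rfl
  exact h _ ((extChartAt (𝓡 3) p).left_inv hq) _ (mfderiv_symm_comp_mfderiv_extChartAt hq v)

lemma fieldInChart_extChartAt (Y : ∀ q : M, TangentSpace (𝓡 3) q) {p q : M}
    (hq : q ∈ (extChartAt (𝓡 3) p).source) :
    fieldInChart Y p (extChartAt (𝓡 3) p q)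
      = mfderiv (𝓡 3) 𝓘(ℝ, E3) (extChartAt (𝓡 3) p) q (Y q) := by
  have hy := (extChartAt (𝓡 3) p).map_source hq
  have hi := isInvertible_mfderiv_extChartAt_symm hy
  apply hi.injective
  refine (hi.self_apply_inverse _).trans ?_
  refine Eq.trans ?_ (mfderiv_symm_comp_mfderiv_extChartAt hq (Y q)).symm
  have h : ∀ q' (h : q' = q), (Y q' : E3) = Y q := by rintro q' rfl; rfl
  exact h _ ((extChartAt (𝓡 3) p).left_inv hq)

lemma differentiableAt_fieldInChart {Y : ∀ q : M, TangentSpace (𝓡 3) q} {p : M}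
    (hY : MDifferentiableAt (𝓡 3) ((𝓡 3).prod 𝓘(ℝ, E3)) (fun q ↦ TotalSpace.mk' E3 q (Y q)) p) :
    DifferentiableAt ℝ (fieldInChart Y p) (extChartAt (𝓡 3) p p) := by
  have := (hY.mdifferentiableWithinAt (s := univ)
    ).differentiableWithinAt_mpullbackWithin_vectorField
  simp only [ModelWithCorners.range_eq_univ, preimage_univ, inter_self,
    mpullbackWithin_univ] at this
  rw [← differentiableWithinAt_univ]
  exact this

/-- The manifold bracket is by definition the pullback of the Euclidean bracket in the preferred
chart. Pairing it with a form turns this into an identity of real numbers, with no vectors to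
transport. -/
lemma form_apply_mlieBracket (β : ∀ q : M, TangentSpace (𝓡 3) q →L[ℝ] ℝ)
    (Y Z : ∀ q : M, TangentSpace (𝓡 3) q) (p : M) :
    β p (mlieBracket (𝓡 3) Y Z p)
      = formInChart β p (extChartAt (𝓡 3) p p)
        (fderiv ℝ (fieldInChart Z p) (extChartAt (𝓡 3) p p)
            (fieldInChart Y p (extChartAt (𝓡 3) p p))
          - fderiv ℝ (fieldInChart Y p) (extChartAt (𝓡 3) p p)
            (fieldInChart Z p (extChartAt (𝓡 3) p p))) := by
  have hp := mem_extChartAt_source (I := 𝓡 3) p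
  rw [← formInChart_mfderiv_extChartAt β hp (mlieBracket (𝓡 3) Y Z p)]
  congr 1
  rw [← mlieBracketWithin_univ, mlieBracketWithin_apply]
  refine ((isInvertible_mfderiv_extChartAt hp).self_apply_inverse _).trans ?_
  simp only [ModelWithCorners.range_eq_univ, preimage_univ, inter_self, mpullbackWithin_univ]
  exact congrFun (lieBracketWithin_univ (𝕜 := ℝ) (V := fieldInChart Y p)
    (W := fieldInChart Z p)) _

lemma hasMFDerivAt_form_apply {β : ∀ q : M, TangentSpace (𝓡 3) q →L[ℝ] ℝ}
    {Z : ∀ q : M, TangentSpace (𝓡 3) q} {p : M}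
    (hβ : DifferentiableAt ℝ (formInChart β p) (extChartAt (𝓡 3) p p))
    (hZ : DifferentiableAt ℝ (fieldInChart Z p) (extChartAt (𝓡 3) p p)) :
    HasMFDerivAt (𝓡 3) 𝓘(ℝ, ℝ) (fun q ↦ β q (Z q)) p
      ((fderiv ℝ (fun y ↦ formInChart β p y (fieldInChart Z p y)) (extChartAt (𝓡 3) p p)).comp
        (mfderiv (𝓡 3) 𝓘(ℝ, E3) (extChartAt (𝓡 3) p) p)) := by
  have h1 : HasMFDerivAt 𝓘(ℝ, E3) 𝓘(ℝ, ℝ) (fun y ↦ formInChart β p y (fieldInChart Z p y))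
      (extChartAt (𝓡 3) p p) _ := (hβ.clm_apply hZ).hasFDerivAt.hasMFDerivAt
  have h2 := (mdifferentiableAt_extChartAt (I := 𝓡 3) (mem_chart_source E3 p)).hasMFDerivAt
  refine (h1.comp p h2).congr_of_eventuallyEq ?_
  filter_upwards [extChartAt_source_mem_nhds (I := 𝓡 3) p] with q hq
  have := formInChart_fieldInChart β Z ((extChartAt (𝓡 3) p).map_source hq)
  have h : ∀ q' (h : q' = q), β q' (Z q') = β q (Z q) := by rintro q' rfl; rfl
  rw [Function.comp_apply, this, h _ ((extChartAt (𝓡 3) p).left_inv hq)]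

lemma mfderiv_form_apply {β : ∀ q : M, TangentSpace (𝓡 3) q →L[ℝ] ℝ}
    {Z : ∀ q : M, TangentSpace (𝓡 3) q} {p : M}
    (hβ : DifferentiableAt ℝ (formInChart β p) (extChartAt (𝓡 3) p p))
    (hZ : DifferentiableAt ℝ (fieldInChart Z p) (extChartAt (𝓡 3) p p))
    (Y : ∀ q : M, TangentSpace (𝓡 3) q) :
    dForm (fun q ↦ β q (Z q)) p (Y p)
      = fderiv ℝ (formInChart β p) (extChartAt (𝓡 3) p p)
          (fieldInChart Y p (extChartAt (𝓡 3) p p)) (fieldInChart Z p (extChartAt (𝓡 3) p p))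
        + formInChart β p (extChartAt (𝓡 3) p p)
          (fderiv ℝ (fieldInChart Z p) (extChartAt (𝓡 3) p p)
            (fieldInChart Y p (extChartAt (𝓡 3) p p))) := by
  rw [dForm, (hasMFDerivAt_form_apply hβ hZ).mfderiv,
    fieldInChart_extChartAt Y (mem_extChartAt_source (I := 𝓡 3) p)]
  have := fderiv_clm_apply hβ hZ
  exact (DFunLike.congr_fun this _).trans (add_comm _ _)

/-- Cartan's formula `dβ(Y, Z) = Y(β(Z)) - Z(β(Y)) - β([Y, Z])` for the alternation of the
derivative of `β` in the preferred chart. -/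
lemma alternation_fderiv_formInChart {β : ∀ q : M, TangentSpace (𝓡 3) q →L[ℝ] ℝ}
    {Y Z : ∀ q : M, TangentSpace (𝓡 3) q} {p : M}
    (hβ : DifferentiableAt ℝ (formInChart β p) (extChartAt (𝓡 3) p p))
    (hY : SmoothFieldAt Y p) (hZ : SmoothFieldAt Z p) :
    fderiv ℝ (formInChart β p) (extChartAt (𝓡 3) p p)
        (fieldInChart Y p (extChartAt (𝓡 3) p p)) (fieldInChart Z p (extChartAt (𝓡 3) p p))
      - fderiv ℝ (formInChart β p) (extChartAt (𝓡 3) p p)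
        (fieldInChart Z p (extChartAt (𝓡 3) p p)) (fieldInChart Y p (extChartAt (𝓡 3) p p))
      = dForm (fun q ↦ β q (Z q)) p (Y p)
        - dForm (fun q ↦ β q (Y q)) p (Z p)
        - β p (mlieBracket (𝓡 3) Y Z p) := by
  have hY' := differentiableAt_fieldInChart (hY.mdifferentiableAt (by simp))
  have hZ' := differentiableAt_fieldInChart (hZ.mdifferentiableAt (by simp))
  rw [form_apply_mlieBracket, mfderiv_form_apply hβ hZ' Y, mfderiv_form_apply hβ hY' Z, map_sub]
  ring

/-- The expression of a form in the chart at `p` is its expression in the trivialization of the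
cotangent bundle at `p`. -/
lemma inCoordinates_eq_formInChart (β : ∀ q : M, TangentSpace (𝓡 3) q →L[ℝ] ℝ) {p q : M}
    (hq : q ∈ (extChartAt (𝓡 3) p).source) :
    ContinuousLinearMap.inCoordinates E3 (TangentSpace (𝓡 3) : M → Type _) ℝ (Bundle.Trivial M ℝ)
      p q p q (β q) = formInChart β p (extChartAt (𝓡 3) p q) := by
  have hq' := hq
  rw [extChartAt_source] at hq
  ext v
  simp only [ContinuousLinearMap.inCoordinates, ContinuousLinearMap.comp_apply,
    TangentBundle.symmL_trivializationAt hq, ModelWithCorners.range_eq_univ, mfderivWithin_univ]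
  have h : ∀ q' (h : q' = q) (w : E3), β q w = β q' w := by
    rintro q' rfl w; rfl
  have h2 := h _ ((extChartAt (𝓡 3) p).left_inv hq')
    (mfderiv 𝓘(ℝ, E3) (𝓡 3) (extChartAt (𝓡 3) p).symm (extChartAt (𝓡 3) p q) v)
  refine Eq.trans ?_ h2
  exact DFunLike.congr_fun (Bundle.Trivial.continuousLinearMapAt_trivialization ℝ M ℝ q) _

lemma smoothFormAt_iff {β : ∀ q : M, TangentSpace (𝓡 3) q →L[ℝ] ℝ} {p : M} :
    SmoothFormAt β p ↔
      ContMDiffAt (𝓡 3) 𝓘(ℝ, E3 →L[ℝ] ℝ) ∞ (fun q ↦ formInChart β p (extChartAt (𝓡 3) p q)) p := by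
  unfold SmoothFormAt
  rw [contMDiffAt_hom_bundle (F₂ := ℝ) (E₂ := Bundle.Trivial M ℝ)]
  refine ⟨fun h ↦ h.2.congr_of_eventuallyEq ?_,
    fun h ↦ ⟨contMDiffAt_id, h.congr_of_eventuallyEq ?_⟩⟩
  · filter_upwards [extChartAt_source_mem_nhds (I := 𝓡 3) p] with q hq
    exact (inCoordinates_eq_formInChart β hq).symm
  · filter_upwards [extChartAt_source_mem_nhds (I := 𝓡 3) p] with q hq
    exact inCoordinates_eq_formInChart β hq

lemma contDiffAt_formInChart {β : ∀ q : M, TangentSpace (𝓡 3) q →L[ℝ] ℝ} {p : M}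
    (hβ : SmoothFormAt β p) :
    ContDiffAt ℝ ∞ (formInChart β p) (extChartAt (𝓡 3) p p) := by
  have h := smoothFormAt_iff.1 hβ
  have hs : ContMDiffAt 𝓘(ℝ, E3) (𝓡 3) ∞ (extChartAt (𝓡 3) p).symm (extChartAt (𝓡 3) p p) :=
    (contMDiffOn_extChartAt_symm p).contMDiffAt (extChartAt_target_mem_nhds p)
  have h2 := ContMDiffAt.comp (extChartAt (𝓡 3) p p)
    (by rw [extChartAt_to_inv]; exact h) hs
  refine (ContMDiffAt.contDiffAt h2).congr_of_eventuallyEq ?_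
  filter_upwards [extChartAt_target_mem_nhds (I := 𝓡 3) p] with y hy
  simp only [Function.comp_apply, (extChartAt (𝓡 3) p).right_inv hy]

lemma differentiableAt_formInChart {β : ∀ q : M, TangentSpace (𝓡 3) q →L[ℝ] ℝ} {p : M}
    (hβ : SmoothFormAt β p) :
    DifferentiableAt ℝ (formInChart β p) (extChartAt (𝓡 3) p p) :=
  (contDiffAt_formInChart hβ).differentiableAt (by simp)

lemma SmoothOneForm.smoothFormAt (α : SmoothOneForm M) (p : M) : SmoothFormAt α p :=
  α.contMDiff p

lemma SmoothVectorField.smoothFieldAt (Y : SmoothVectorField M) (p : M) : SmoothFieldAt Y p :=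
  Y.contMDiff p

/-- The differential in a chart is the derivative of the expression of the function. -/
lemma formInChart_dForm {f : M → ℝ} {p : M} {y : E3} (hy : y ∈ (extChartAt (𝓡 3) p).target)
    (hf : MDifferentiableAt (𝓡 3) 𝓘(ℝ, ℝ) f ((extChartAt (𝓡 3) p).symm y)) :
    formInChart (dForm f) p y = fderiv ℝ (f ∘ (extChartAt (𝓡 3) p).symm) y := by
  rw [← mfderiv_eq_fderiv, mfderiv_comp y hf]
  · rfl
  · exact ((contMDiffOn_extChartAt_symm (I := 𝓡 3) (n := ∞) p).contMDiffAt
      ((isOpen_extChartAt_target p).mem_nhds hy)).mdifferentiableAt (by simp)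

lemma contDiffAt_comp_extChartAt_symm {f : M → ℝ} {p : M}
    (hf : ContMDiffAt (𝓡 3) 𝓘(ℝ, ℝ) ∞ f p) :
    ContDiffAt ℝ ∞ (f ∘ (extChartAt (𝓡 3) p).symm) (extChartAt (𝓡 3) p p) := by
  have hs : ContMDiffAt 𝓘(ℝ, E3) (𝓡 3) ∞ (extChartAt (𝓡 3) p).symm (extChartAt (𝓡 3) p p) :=
    (contMDiffOn_extChartAt_symm p).contMDiffAt (extChartAt_target_mem_nhds p)
  exact (ContMDiffAt.comp (extChartAt (𝓡 3) p p) (by rw [extChartAt_to_inv]; exact hf)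
    hs).contDiffAt

lemma formInChart_dForm_eventuallyEq {f : M → ℝ} {p : M}
    (hf : ContMDiffAt (𝓡 3) 𝓘(ℝ, ℝ) ∞ f p) :
    formInChart (dForm f) p =ᶠ[𝓝 (extChartAt (𝓡 3) p p)]
      fderiv ℝ (f ∘ (extChartAt (𝓡 3) p).symm) := by
  have h1 : ∀ᶠ q in 𝓝 p, ContMDiffAt (𝓡 3) 𝓘(ℝ, ℝ) 1 f q :=
    (contMDiffAt_iff_contMDiffAt_nhds (by simp)).1
      (ContMDiffAt.of_le hf (WithTop.coe_le_coe.2 le_top))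
  have h2 : ContinuousAt (extChartAt (𝓡 3) p).symm (extChartAt (𝓡 3) p p) :=
    continuousAt_extChartAt_symm p
  have h3 := h2.eventually (by rw [extChartAt_to_inv]; exact h1)
  filter_upwards [h3, extChartAt_target_mem_nhds (I := 𝓡 3) p] with y hy hy'
  exact formInChart_dForm hy' (hy.mdifferentiableAt (by simp))

lemma smoothFormAt_dForm {f : M → ℝ} {p : M} (hf : ContMDiffAt (𝓡 3) 𝓘(ℝ, ℝ) ∞ f p) :
    SmoothFormAt (dForm f) p := by
  rw [smoothFormAt_iff]
  have h1 : ContDiffAt ℝ ∞ (fderiv ℝ (f ∘ (extChartAt (𝓡 3) p).symm)) (extChartAt (𝓡 3) p p) :=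
    (contDiffAt_comp_extChartAt_symm hf).fderiv_right (by simp)
  exact (h1.congr_of_eventuallyEq (formInChart_dForm_eventuallyEq hf)).contMDiffAt.comp p
    contMDiffAt_extChartAt

/-- The Lie bracket is the commutator of derivations. -/
lemma dForm_mlieBracket {f : M → ℝ} {p : M} (hf : ContMDiffAt (𝓡 3) 𝓘(ℝ, ℝ) ∞ f p)
    {Y Z : ∀ q : M, TangentSpace (𝓡 3) q} (hY : SmoothFieldAt Y p) (hZ : SmoothFieldAt Z p) :
    dForm f p (mlieBracket (𝓡 3) Y Z p)
      = dForm (fun q ↦ dForm f q (Z q)) p (Y p) - dForm (fun q ↦ dForm f q (Y q)) p (Z p) := by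
  -- Cartan's formula applied to $\beta=df$: its left side vanishes because the second derivative of
  -- $f$ in the chart is symmetric.
  have h := alternation_fderiv_formInChart
    (differentiableAt_formInChart (smoothFormAt_dForm hf)) hY hZ
  rw [(formInChart_dForm_eventuallyEq hf).fderiv_eq] at h
  have hs := ((contDiffAt_comp_extChartAt_symm hf).isSymmSndFDerivAt
    (by simpa using (WithTop.coe_le_coe.2 le_top : ((2 : ℕ∞) : WithTop ℕ∞) ≤ ∞))).eq
    (fieldInChart Y p (extChartAt (𝓡 3) p p)) (fieldInChart Z p (extChartAt (𝓡 3) p p))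
  rw [hs, sub_self] at h
  linarith

/-- Cartan's formula for the exterior derivative. -/
lemma oneFormExtDeriv_apply (α : SmoothOneForm M) {p : M}
    {Y Z : ∀ q : M, TangentSpace (𝓡 3) q} (hY : SmoothFieldAt Y p) (hZ : SmoothFieldAt Z p) :
    oneFormExtDeriv α p (Y p) (Z p)
      = dForm (fun q ↦ α q (Z q)) p (Y p) - dForm (fun q ↦ α q (Y q)) p (Z p)
        - α p (mlieBracket (𝓡 3) Y Z p) := by
  rw [← alternation_fderiv_formInChart (differentiableAt_formInChart (α.smoothFormAt p)) hY hZ,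
    fieldInChart_extChartAt Y (mem_extChartAt_source p),
    fieldInChart_extChartAt Z (mem_extChartAt_source p)]
  rfl

lemma contMDiffAt_form_apply {β : ∀ q : M, TangentSpace (𝓡 3) q →L[ℝ] ℝ}
    {Y : ∀ q : M, TangentSpace (𝓡 3) q} {p : M} (hβ : SmoothFormAt β p) (hY : SmoothFieldAt Y p) :
    ContMDiffAt (𝓡 3) 𝓘(ℝ, ℝ) ∞ (fun q ↦ β q (Y q)) p := by
  have h := ContMDiffAt.clm_bundle_apply (E₂ := Bundle.Trivial M ℝ) (F₂ := ℝ) hβ hY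
  exact ((contMDiffAt_section (F := ℝ) (E := Bundle.Trivial M ℝ) _).1 h)

lemma contMDiffAt_dForm_apply {f : M → ℝ} {Y : ∀ q : M, TangentSpace (𝓡 3) q} {p : M}
    (hf : ContMDiffAt (𝓡 3) 𝓘(ℝ, ℝ) ∞ f p) (hY : SmoothFieldAt Y p) :
    ContMDiffAt (𝓡 3) 𝓘(ℝ, ℝ) ∞ (fun q ↦ dForm f q (Y q)) p :=
  contMDiffAt_form_apply (smoothFormAt_dForm hf) hY

lemma smoothFieldAt_mlieBracket {Y Z : ∀ q : M, TangentSpace (𝓡 3) q} {p : M}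
    (hY : SmoothFieldAt Y p) (hZ : SmoothFieldAt Z p) :
    SmoothFieldAt (mlieBracket (𝓡 3) Y Z) p := by
  have : IsManifold (𝓡 3) (((⊤ : ℕ∞) : WithTop ℕ∞) + 1) M := by
    simpa using (inferInstance : IsManifold (𝓡 3) ∞ M)
  have : IsManifold (𝓡 3) (minSmoothness ℝ 2) M := by
    simpa using (inferInstance : IsManifold (𝓡 3) 2 M)
  have : IsManifold (𝓡 3) (minSmoothness ℝ 3) M := by
    simpa using (inferInstance : IsManifold (𝓡 3) 3 M)
  exact ContMDiffAt.mlieBracket_vectorField (m := ⊤) (n := ⊤) hY hZ (by simp)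

/-- A smooth frame near a point. -/
lemma exists_smooth_frame (p : M) : ∃ U : Set M, IsOpen U ∧ p ∈ U ∧
    ∃ s : Fin 3 → ∀ q : M, TangentSpace (𝓡 3) q, (∀ i, ∀ q ∈ U, SmoothFieldAt (s i) q) ∧
      ∀ q ∈ U, ∃ b : Module.Basis (Fin 3) ℝ (TangentSpace (𝓡 3) q), ∀ i, b i = s i q := by
  let e := trivializationAt E3 (TangentSpace (𝓡 3) : M → Type _) p
  have h := Bundle.Trivialization.isLocalFrameOn_localFrame_baseSet (𝓡 3) ∞ e
    (EuclideanSpace.basisFun (Fin 3) ℝ).toBasis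
  refine ⟨e.baseSet, e.open_baseSet, FiberBundle.mem_baseSet_trivializationAt' p, _,
    fun i q hq ↦ h.contMDiffAt e.open_baseSet hq i, fun q hq ↦ ⟨h.toBasisAt hq, fun i ↦ ?_⟩⟩
  simp

/-- A tangent vector extends to a vector field which is smooth near the point. -/
lemma exists_smooth_extension {p : M} (v : TangentSpace (𝓡 3) p) :
    ∃ (Y : ∀ q : M, TangentSpace (𝓡 3) q) (U : Set M), IsOpen U ∧ p ∈ U ∧ Y p = v ∧
      ∀ q ∈ U, SmoothFieldAt Y q := by
  obtain ⟨s, hs, hY⟩ := FiberBundle.exists_contMDiffOn_extend (k := ∞) (𝓡 3) E3 v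
  obtain ⟨U, hU, hUo, hpU⟩ := mem_nhds_iff.1 hs
  exact ⟨_, U, hUo, hpU, FiberBundle.extend_apply_self _ v,
    fun q hq ↦ hY.contMDiffAt (Filter.mem_of_superset (hUo.mem_nhds hq) hU)⟩

set_option synthInstance.maxHeartbeats 200000 in
/-- The tensor product of two smooth fields of linear forms is smooth. -/
lemma contMDiffAt_smulRight {β γ : ∀ q : M, TangentSpace (𝓡 3) q →L[ℝ] ℝ} {p : M}
    (hβ : SmoothFormAt β p) (hγ : SmoothFormAt γ p) :
    ContMDiffAt (𝓡 3) ((𝓡 3).prod 𝓘(ℝ, E3 →L[ℝ] E3 →L[ℝ] ℝ)) ∞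
      (fun q ↦ TotalSpace.mk' (E3 →L[ℝ] E3 →L[ℝ] ℝ)
        (E := fun q : M ↦ TangentSpace (𝓡 3) q →L[ℝ] TangentSpace (𝓡 3) q →L[ℝ] ℝ) q
        ((β q).smulRight (γ q))) p := by
  have hβ' := smoothFormAt_iff.1 hβ
  have hγ' := smoothFormAt_iff.1 hγ
  rw [contMDiffAt_hom_bundle (F₂ := E3 →L[ℝ] ℝ)
    (E₂ := fun q : M ↦ TangentSpace (𝓡 3) q →L[ℝ] Bundle.Trivial M ℝ q)]
  refine ⟨contMDiffAt_id, ?_⟩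
  have h : ContMDiffAt (𝓡 3) 𝓘(ℝ, E3 →L[ℝ] E3 →L[ℝ] ℝ) ∞
      (fun q ↦ (formInChart β p (extChartAt (𝓡 3) p q)).smulRight
        (formInChart γ p (extChartAt (𝓡 3) p q))) p := by
    have hc : ContDiff ℝ ∞ (fun x : (E3 →L[ℝ] ℝ) × (E3 →L[ℝ] ℝ) ↦ x.1.smulRight x.2) :=
      contDiff_fst.smulRight contDiff_snd
    exact hc.contMDiff.contMDiffAt.comp p (hβ'.prodMk_space hγ')
  refine h.congr_of_eventuallyEq ?_
  filter_upwards [extChartAt_source_mem_nhds (I := 𝓡 3) p] with q hq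
  rw [← inCoordinates_eq_formInChart β hq, ← inCoordinates_eq_formInChart γ hq]
  have hq1 : q ∈ (trivializationAt E3 (TangentSpace (𝓡 3) : M → Type _) p).baseSet := by
    simpa using hq
  have hq2 : q ∈ (trivializationAt (E3 →L[ℝ] ℝ)
      (fun q : M ↦ TangentSpace (𝓡 3) q →L[ℝ] Bundle.Trivial M ℝ q) p).baseSet := by
    rw [hom_trivializationAt_baseSet]
    exact ⟨hq1, by simp⟩
  refine ContinuousLinearMap.ext fun v ↦ ?_
  -- The trivialization of the cotangent bundle is fiberwise linear, so the scalar produced by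
  -- $\beta$ passes through it and only $\gamma$ is read in coordinates.
  have h1 := (((trivializationAt (E3 →L[ℝ] ℝ)
      (fun q : M ↦ TangentSpace (𝓡 3) q →L[ℝ] Bundle.Trivial M ℝ q) p).continuousLinearMapAt
        ℝ q)).map_smul
      (β q ((trivializationAt E3 (TangentSpace (𝓡 3) : M → Type _) p).symmL ℝ q v)) (γ q)
  have h2 : (trivializationAt (E3 →L[ℝ] ℝ)
      (fun q : M ↦ TangentSpace (𝓡 3) q →L[ℝ] Bundle.Trivial M ℝ q) p).continuousLinearMapAt
        ℝ q (γ q) = ContinuousLinearMap.inCoordinates E3 (TangentSpace (𝓡 3) : M → Type _) ℝ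
          (Bundle.Trivial M ℝ) p q p q (γ q) := by
    rw [Bundle.Trivialization.continuousLinearMapAt_apply,
      Bundle.Trivialization.coe_linearMapAt_of_mem _ hq2]
    exact congrArg Prod.snd (hom_trivializationAt_apply (RingHom.id ℝ) p
      (⟨q, γ q⟩ : TotalSpace (E3 →L[ℝ] ℝ)
        (fun q : M ↦ TangentSpace (𝓡 3) q →L[ℝ] Bundle.Trivial M ℝ q)))
  have h3 : ContinuousLinearMap.inCoordinates E3 (TangentSpace (𝓡 3) : M → Type _) ℝ
      (Bundle.Trivial M ℝ) p q p q (β q) v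
      = β q ((trivializationAt E3 (TangentSpace (𝓡 3) : M → Type _) p).symmL ℝ q v) :=
    DFunLike.congr_fun (Bundle.Trivial.continuousLinearMapAt_trivialization ℝ M ℝ q) _
  rw [h2] at h1
  rw [ContinuousLinearMap.smulRight_apply, h3]
  exact h1

end ChartCalculus

/-! ### Linear algebra of $a\wedge\theta$ on a three-dimensional space -/

section ThreeDimensionalAlgebra

variable {T : Type*} [AddCommGroup T] [Module ℝ T]

/-- The trilinear alternating form `a ∧ θ`. -/
def wedgeOneTwo (a : T →ₗ[ℝ] ℝ) (θ : T →ₗ[ℝ] T →ₗ[ℝ] ℝ) (u v w : T) : ℝ :=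
  a u * θ v w + a v * θ w u + a w * θ u v

/-- Alternating 3-forms on a three-dimensional space form a line. This normalization is what makes
signs and densities computed in different frames comparable. -/
lemma wedgeOneTwo_eq_det_mul (a : T →ₗ[ℝ] ℝ) {θ : T →ₗ[ℝ] T →ₗ[ℝ] ℝ}
    (hθ : ∀ u v, θ u v = -θ v u) (b : Module.Basis (Fin 3) ℝ T) (u : Fin 3 → T) :
    wedgeOneTwo a θ (u 0) (u 1) (u 2) = b.det u * wedgeOneTwo a θ (b 0) (b 1) (b 2) := by
  have hu : ∀ i, u i = b.repr (u i) 0 • b 0 + b.repr (u i) 1 • b 1 + b.repr (u i) 2 • b 2 := by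
    intro i
    rw [← Fin.sum_univ_three fun j ↦ b.repr (u i) j • b j, b.sum_repr]
  have h0 : ∀ x, θ x x = 0 := fun x ↦ by linarith [hθ x x]
  rw [Module.Basis.det_apply, Matrix.det_fin_three]
  simp only [Module.Basis.toMatrix_apply, wedgeOneTwo]
  generalize hc : (fun i j ↦ b.repr (u i) j) = c
  have hc' : ∀ i j, b.repr (u i) j = c i j := fun i j ↦ by rw [← hc]
  simp only [hc'] at hu ⊢
  rw [hu 0, hu 1, hu 2]
  simp only [map_add, map_smul, LinearMap.add_apply, LinearMap.smul_apply, smul_eq_mul, h0,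
    hθ (b 1) (b 0), hθ (b 2) (b 1), hθ (b 0) (b 2)]
  ring

lemma wedgeOneTwo_basis_ne_zero {a : T →ₗ[ℝ] ℝ} {θ : T →ₗ[ℝ] T →ₗ[ℝ] ℝ}
    (hθ : ∀ u v, θ u v = -θ v u) (h : ∃ u v w, wedgeOneTwo a θ u v w ≠ 0)
    (b : Module.Basis (Fin 3) ℝ T) : wedgeOneTwo a θ (b 0) (b 1) (b 2) ≠ 0 := by
  obtain ⟨u, v, w, huvw⟩ := h
  have := wedgeOneTwo_eq_det_mul a hθ b ![u, v, w]
  simp only [Matrix.cons_val] at this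
  intro h
  rw [h, mul_zero] at this
  exact huvw this

/-- A nonzero volume form has no kernel, while the contraction of $a\wedge\theta$ with such an $x$
is zero. Explicitly, each coordinate of $x$ times the volume is a combination of $a(x)$ and the
$\theta(x,b_j)$. -/
lemma eq_zero_of_wedgeOneTwo {a : T →ₗ[ℝ] ℝ} {θ : T →ₗ[ℝ] T →ₗ[ℝ] ℝ}
    (hθ : ∀ u v, θ u v = -θ v u) {b : Module.Basis (Fin 3) ℝ T}
    (hb : wedgeOneTwo a θ (b 0) (b 1) (b 2) ≠ 0) {x : T} (hax : a x = 0) (hθx : ∀ v, θ x v = 0) :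
    x = 0 := by
  have h0 : ∀ x, θ x x = 0 := fun x ↦ by linarith [hθ x x]
  have hx : x = b.repr x 0 • b 0 + b.repr x 1 • b 1 + b.repr x 2 • b 2 := by
    rw [← Fin.sum_univ_three fun j ↦ b.repr x j • b j, b.sum_repr]
  generalize b.repr x 0 = x0 at hx
  generalize b.repr x 1 = x1 at hx
  generalize b.repr x 2 = x2 at hx
  have e0 := hθx (b 0)
  have e1 := hθx (b 1)
  have e2 := hθx (b 2)
  rw [hx] at hax e0 e1 e2
  simp only [map_add, map_smul, LinearMap.add_apply, LinearMap.smul_apply, smul_eq_mul, h0,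
    hθ (b 1) (b 0), hθ (b 2) (b 1), hθ (b 0) (b 2)] at hax e0 e1 e2
  simp only [wedgeOneTwo] at hb
  have z0 : x0 = 0 := by
    refine (mul_eq_zero.1 (?_ : x0 * _ = 0)).resolve_right hb
    linear_combination hax * θ (b 1) (b 2) + e1 * a (b 2) - e2 * a (b 1)
  have z1 : x1 = 0 := by
    refine (mul_eq_zero.1 (?_ : x1 * _ = 0)).resolve_right hb
    linear_combination hax * θ (b 2) (b 0) + e2 * a (b 0) - e0 * a (b 2)
  have z2 : x2 = 0 := by
    refine (mul_eq_zero.1 (?_ : x2 * _ = 0)).resolve_right hb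
    linear_combination hax * θ (b 0) (b 1) + e0 * a (b 1) - e1 * a (b 0)
  rw [hx, z0, z1, z2]
  simp

/-- The vector `R` with `a(R) = 1` and `θ(R, ·) = 0`, in terms of a basis. -/
lemma exists_reeb_of_basis {a : T →ₗ[ℝ] ℝ} {θ : T →ₗ[ℝ] T →ₗ[ℝ] ℝ}
    (hθ : ∀ u v, θ u v = -θ v u) {b : Module.Basis (Fin 3) ℝ T}
    (hb : wedgeOneTwo a θ (b 0) (b 1) (b 2) ≠ 0) {x : T}
    (hx : x = (θ (b 1) (b 2) / wedgeOneTwo a θ (b 0) (b 1) (b 2)) • b 0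
      + (θ (b 2) (b 0) / wedgeOneTwo a θ (b 0) (b 1) (b 2)) • b 1
      + (θ (b 0) (b 1) / wedgeOneTwo a θ (b 0) (b 1) (b 2)) • b 2) :
    a x = 1 ∧ ∀ v, θ x v = 0 := by
  have h0 : ∀ x, θ x x = 0 := fun x ↦ by linarith [hθ x x]
  constructor
  · rw [hx]
    simp only [map_add, map_smul, smul_eq_mul]
    rw [div_mul_eq_mul_div, div_mul_eq_mul_div, div_mul_eq_mul_div, ← add_div, ← add_div,
      div_eq_one_iff_eq hb, wedgeOneTwo]
    ring
  · intro v
    have : θ x = 0 := by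
      refine b.ext fun i ↦ ?_
      rw [hx]
      fin_cases i <;>
      simp only [map_add, map_smul, LinearMap.add_apply, LinearMap.smul_apply, smul_eq_mul, h0,
        hθ (b 1) (b 0), hθ (b 2) (b 1), hθ (b 0) (b 2), Fin.zero_eta, Fin.mk_one,
        Fin.reduceFinMk, LinearMap.zero_apply] <;> ring
    rw [this, LinearMap.zero_apply]

/-- The alternation of a bilinear form, pulled back under a linear map. -/
def alternationComp (D : E3 →L[ℝ] E3 →L[ℝ] ℝ) (m : T →ₗ[ℝ] E3) : T →ₗ[ℝ] T →ₗ[ℝ] ℝ :=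
  LinearMap.mk₂ ℝ (fun u v ↦ D (m u) (m v) - D (m v) (m u))
    (fun u u' v ↦ by simp; ring) (fun c u v ↦ by simp; ring)
    (fun u v v' ↦ by simp; ring) (fun c u v ↦ by simp; ring)

end ThreeDimensionalAlgebra

/-! ### The Reeb field, and its commutation with $X$ -/

section Reeb

variable {M : Type*} [TopologicalSpace M] [ChartedSpace E3 M] [IsManifold (𝓡 3) ∞ M]

/-- The exterior derivative at a point as a bilinear form. -/
def extDerivBilin (α : SmoothOneForm M) (p : M) :
    TangentSpace (𝓡 3) p →ₗ[ℝ] TangentSpace (𝓡 3) p →ₗ[ℝ] ℝ :=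
  alternationComp (fderiv ℝ (oneFormInChart α p) (extChartAt (𝓡 3) p p))
    (show TangentSpace (𝓡 3) p →L[ℝ] E3 from
      mfderiv (𝓡 3) 𝓘(ℝ, E3) (extChartAt (𝓡 3) p) p).toLinearMap

lemma extDerivBilin_apply (α : SmoothOneForm M) (p : M) (u v : TangentSpace (𝓡 3) p) :
    extDerivBilin α p u v = oneFormExtDeriv α p u v := rfl

lemma extDerivBilin_swap (α : SmoothOneForm M) (p : M) (u v : TangentSpace (𝓡 3) p) :
    extDerivBilin α p u v = -extDerivBilin α p v u := by
  simp only [extDerivBilin_apply, oneFormExtDeriv]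
  ring

/-- The value of `α ∧ dα`. -/
def contactVol (α : SmoothOneForm M) (p : M) (u v w : TangentSpace (𝓡 3) p) : ℝ :=
  wedgeOneTwo (α p : TangentSpace (𝓡 3) p →ₗ[ℝ] ℝ) (extDerivBilin α p) u v w

lemma dForm_eq_zero_of_forall_eq {f : M → ℝ} {c : ℝ} (h : ∀ q, f q = c) (p : M) :
    dForm f p = 0 := by
  rw [funext h]
  exact mfderiv_const

lemma IsContactForm.contactVol_ne_zero {α : SmoothOneForm M} (hα : IsContactForm α) {p : M}
    (b : Module.Basis (Fin 3) ℝ (TangentSpace (𝓡 3) p)) :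
    contactVol α p (b 0) (b 1) (b 2) ≠ 0 := by
  obtain ⟨u, v, w, h⟩ := hα p
  exact wedgeOneTwo_basis_ne_zero (extDerivBilin_swap α p) ⟨u, v, w, h⟩ b

lemma IsContactForm.eq_zero {α : SmoothOneForm M} (hα : IsContactForm α) {p : M}
    {x : TangentSpace (𝓡 3) p} (h1 : α p x = 0) (h2 : ∀ v, oneFormExtDeriv α p x v = 0) :
    x = 0 := by
  obtain ⟨U, -, hpU, s, -, hs⟩ := exists_smooth_frame p
  obtain ⟨b, -⟩ := hs p hpU
  exact eq_zero_of_wedgeOneTwo (a := (α p : TangentSpace (𝓡 3) p →ₗ[ℝ] ℝ))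
    (extDerivBilin_swap α p) (hα.contactVol_ne_zero b) h1 h2

/-- The definition of $d\alpha$ uses a chart that changes with the point, so smoothness is not
visible from it. Cartan's formula replaces it by a chart-free expression. -/
lemma contMDiffAt_oneFormExtDeriv (α : SmoothOneForm M) {Y Z : ∀ q : M, TangentSpace (𝓡 3) q}
    {p : M} (hY : ∀ᶠ q in 𝓝 p, SmoothFieldAt Y q) (hZ : ∀ᶠ q in 𝓝 p, SmoothFieldAt Z q) :
    ContMDiffAt (𝓡 3) 𝓘(ℝ, ℝ) ∞ (fun q ↦ oneFormExtDeriv α q (Y q) (Z q)) p := by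
  have hY' := hY.self_of_nhds
  have hZ' := hZ.self_of_nhds
  have h := ((contMDiffAt_dForm_apply (contMDiffAt_form_apply (α.smoothFormAt p) hZ') hY').sub
    (contMDiffAt_dForm_apply (contMDiffAt_form_apply (α.smoothFormAt p) hY') hZ')).sub
    (contMDiffAt_form_apply (α.smoothFormAt p) (smoothFieldAt_mlieBracket hY' hZ'))
  refine h.congr_of_eventuallyEq ?_
  filter_upwards [hY, hZ] with q hYq hZq
  exact oneFormExtDeriv_apply α hYq hZq

lemma contMDiffAt_contactVol (α : SmoothOneForm M) {s : Fin 3 → ∀ q : M, TangentSpace (𝓡 3) q}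
    {p : M} (hs : ∀ i, ∀ᶠ q in 𝓝 p, SmoothFieldAt (s i) q) :
    ContMDiffAt (𝓡 3) 𝓘(ℝ, ℝ) ∞ (fun q ↦ contactVol α q (s 0 q) (s 1 q) (s 2 q)) p := by
  have h1 : ∀ i, ContMDiffAt (𝓡 3) 𝓘(ℝ, ℝ) ∞ (fun q ↦ α q (s i q)) p := fun i ↦
    contMDiffAt_form_apply (α.smoothFormAt p) (hs i).self_of_nhds
  have h2 : ∀ i j, ContMDiffAt (𝓡 3) 𝓘(ℝ, ℝ) ∞
      (fun q ↦ oneFormExtDeriv α q (s i q) (s j q)) p := fun i j ↦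
    contMDiffAt_oneFormExtDeriv α (hs i) (hs j)
  exact (((h1 0).mul (h2 1 2)).add ((h1 1).mul (h2 2 0))).add ((h1 2).mul (h2 0 1))

/-- The Reeb vector is chosen pointwise. Smoothness follows from uniqueness: in a smooth local frame
it must agree with the Cramer-type formula, whose denominator $(\alpha\wedge d\alpha)(s_0,s_1,s_2)$
does not vanish. -/
lemma IsContactForm.exists_reeb {α : SmoothOneForm M} (hα : IsContactForm α) :
    ∃ R : SmoothVectorField M, (∀ p, α p (R p) = 1) ∧ ∀ p v, oneFormExtDeriv α p (R p) v = 0 := by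
  have hex : ∀ p : M, ∃ x : TangentSpace (𝓡 3) p, α p x = 1 ∧
      ∀ v, oneFormExtDeriv α p x v = 0 := by
    intro p
    obtain ⟨U, -, hpU, s, -, hs⟩ := exists_smooth_frame p
    obtain ⟨b, -⟩ := hs p hpU
    exact ⟨_, exists_reeb_of_basis (a := (α p : TangentSpace (𝓡 3) p →ₗ[ℝ] ℝ))
      (extDerivBilin_swap α p) (hα.contactVol_ne_zero b) rfl⟩
  choose R hR1 hR2 using hex
  refine ⟨⟨R, fun p ↦ ?_⟩, hR1, hR2⟩
  obtain ⟨U, hU, hpU, s, hs, hb⟩ := exists_smooth_frame p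
  have hsU : ∀ i, ∀ᶠ q in 𝓝 p, SmoothFieldAt (s i) q := fun i ↦ by
    filter_upwards [hU.mem_nhds hpU] with q hq using hs i q hq
  have hvol := contMDiffAt_contactVol α hsU
  have hne : contactVol α p (s 0 p) (s 1 p) (s 2 p) ≠ 0 := by
    obtain ⟨b, hb⟩ := hb p hpU
    rw [← hb, ← hb, ← hb]
    exact hα.contactVol_ne_zero b
  have hc : ∀ i j, ContMDiffAt (𝓡 3) 𝓘(ℝ, ℝ) ∞ (fun q ↦ oneFormExtDeriv α q (s i q) (s j q)
      / contactVol α q (s 0 q) (s 1 q) (s 2 q)) p := fun i j ↦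
    (contMDiffAt_oneFormExtDeriv α (hsU i) (hsU j)).div₀ hvol hne
  have hsm := (((hc 1 2).smul_section (hsU 0).self_of_nhds).add_section
    ((hc 2 0).smul_section (hsU 1).self_of_nhds)).add_section
    ((hc 0 1).smul_section (hsU 2).self_of_nhds)
  refine hsm.congr_of_eventuallyEq ?_
  filter_upwards [hU.mem_nhds hpU] with q hq
  obtain ⟨b, hb⟩ := hb q hq
  congr 1
  have hv := hα.contactVol_ne_zero b
  obtain ⟨x, hx⟩ : ∃ x : TangentSpace (𝓡 3) q, x = (oneFormExtDeriv α q (b 1) (b 2)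
      / contactVol α q (b 0) (b 1) (b 2)) • b 0 + (oneFormExtDeriv α q (b 2) (b 0)
      / contactVol α q (b 0) (b 1) (b 2)) • b 1 + (oneFormExtDeriv α q (b 0) (b 1)
      / contactVol α q (b 0) (b 1) (b 2)) • b 2 := ⟨_, rfl⟩
  have hr := exists_reeb_of_basis (a := (α q : TangentSpace (𝓡 3) q →ₗ[ℝ] ℝ))
    (extDerivBilin_swap α q) hv hx
  have hRx : R q - x = 0 := by
    refine hα.eq_zero ?_ fun v ↦ ?_
    · rw [map_sub, hR1 q, sub_eq_zero]
      exact hr.1.symm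
    · rw [← extDerivBilin_apply, map_sub, LinearMap.sub_apply, hr.2 v, extDerivBilin_apply, hR2,
        sub_zero]
  rw [sub_eq_zero.1 hRx, hx]
  simp only [hb]
  rfl

/-- `dα(X, ·) = -d(α(X))` if `α` is invariant under `X`. -/
lemma PreservesForm.oneFormExtDeriv_apply_left {X : SmoothVectorField M} {α : SmoothOneForm M}
    (h : PreservesForm X α) (p : M) (v : TangentSpace (𝓡 3) p) :
    oneFormExtDeriv α p (X p) v = -dForm (fun q ↦ α q (X q)) p v := by
  obtain ⟨Y, U, hU, hpU, rfl, hY⟩ := exists_smooth_extension v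
  have h1 : dForm (fun q ↦ α q (Y q)) p (X p) = α p (mlieBracket (𝓡 3) (fun q ↦ X q) Y p) :=
    h p Y (hY p hpU)
  rw [oneFormExtDeriv_apply α (X.smoothFieldAt p) (hY p hpU), h1]
  ring

/-- Conversely, the Reeb field preserves `α`. -/
lemma form_mlieBracket_reeb {R : SmoothVectorField M} {α : SmoothOneForm M}
    (h1 : ∀ p, α p (R p) = 1) (h2 : ∀ p v, oneFormExtDeriv α p (R p) v = 0)
    {p : M} {Y : ∀ q : M, TangentSpace (𝓡 3) q} (hY : SmoothFieldAt Y p) :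
    dForm (fun q ↦ α q (Y q)) p (R p) = α p (mlieBracket (𝓡 3) (fun q ↦ R q) Y p) := by
  have h := oneFormExtDeriv_apply α (R.smoothFieldAt p) hY
  have h0 : dForm (fun q ↦ α q (R q)) p (Y p) = 0 := by
    rw [dForm_eq_zero_of_forall_eq h1]
    rfl
  rw [h2, h0] at h
  linarith

/-- A vector field preserving a contact form commutes with the Reeb field. -/
lemma PreservesForm.mlieBracket_reeb_eq_zero {X R : SmoothVectorField M} {α : SmoothOneForm M}
    (hα : IsContactForm α) (hX : PreservesForm X α)
    (h1 : ∀ p, α p (R p) = 1) (h2 : ∀ p v, oneFormExtDeriv α p (R p) v = 0) (p : M) :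
    mlieBracket (𝓡 3) (fun q ↦ X q) (fun q ↦ R q) p = 0 := by
  have hX' : ∀ (p : M) (Y : ∀ q : M, TangentSpace (𝓡 3) q), SmoothFieldAt Y p →
      dForm (fun q ↦ α q (Y q)) p (X p) = α p (mlieBracket (𝓡 3) (fun q ↦ X q) Y p) := hX
  set Q := mlieBracket (𝓡 3) (fun q ↦ X q) (fun q ↦ R q) with hQdef
  have hQ : ∀ q, SmoothFieldAt Q q := fun q ↦
    smoothFieldAt_mlieBracket (X.smoothFieldAt q) (R.smoothFieldAt q)
  have hαQ : ∀ q, α q (Q q) = 0 := fun q ↦ by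
    rw [← hX' q _ (R.smoothFieldAt q), dForm_eq_zero_of_forall_eq h1]
    rfl
  refine hα.eq_zero (hαQ p) fun v ↦ ?_
  obtain ⟨Z, U, hU, hpU, rfl, hZ⟩ := exists_smooth_extension v
  have hXZ : ∀ᶠ q in 𝓝 p, dForm (fun q ↦ α q (Z q)) q (X q)
      = α q (mlieBracket (𝓡 3) (fun q ↦ X q) Z q) := by
    filter_upwards [hU.mem_nhds hpU] with q hq using hX' q Z (hZ q hq)
  have hRZ : ∀ᶠ q in 𝓝 p, dForm (fun q ↦ α q (Z q)) q (R q)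
      = α q (mlieBracket (𝓡 3) (fun q ↦ R q) Z q) := by
    filter_upwards [hU.mem_nhds hpU] with q hq using form_mlieBracket_reeb h1 h2 (hZ q hq)
  have hZp := hZ p hpU
  -- This is $L_Q\alpha=[L_X,L_R]\alpha=0$ for $Q=[X,R]$, obtained from the Jacobi identity.
  -- Together with $\alpha(Q)=X(\alpha(R))=0$, it gives $\iota_Q d\alpha=0$, and the contact
  -- condition kills $Q$.
  have hQZ : dForm (fun q ↦ α q (Z q)) p (Q p) = α p (mlieBracket (𝓡 3) Q Z p) := by
    rw [hQdef, dForm_mlieBracket (contMDiffAt_form_apply (α.smoothFormAt p) hZp)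
      (X.smoothFieldAt p) (R.smoothFieldAt p)]
    have e1 : dForm (fun q ↦ dForm (fun q ↦ α q (Z q)) q (R q)) p
        = dForm (fun q ↦ α q (mlieBracket (𝓡 3) (fun q ↦ R q) Z q)) p :=
      Filter.EventuallyEq.mfderiv_eq hRZ
    have e2 : dForm (fun q ↦ dForm (fun q ↦ α q (Z q)) q (X q)) p
        = dForm (fun q ↦ α q (mlieBracket (𝓡 3) (fun q ↦ X q) Z q)) p :=
      Filter.EventuallyEq.mfderiv_eq hXZ
    rw [e1, e2, hX' p _ (smoothFieldAt_mlieBracket (R.smoothFieldAt p) hZp),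
      form_mlieBracket_reeb h1 h2 (smoothFieldAt_mlieBracket (X.smoothFieldAt p) hZp)]
    have : IsManifold (𝓡 3) (minSmoothness ℝ 3) M := by
      simpa using (inferInstance : IsManifold (𝓡 3) 3 M)
    have h2le : minSmoothness ℝ 2 ≤ (∞ : WithTop ℕ∞) := by
      simpa using (WithTop.coe_le_coe.2 le_top : ((2 : ℕ∞) : WithTop ℕ∞) ≤ ∞)
    rw [leibniz_identity_mlieBracket_apply ((X.smoothFieldAt p).of_le h2le)
      ((R.smoothFieldAt p).of_le h2le) (hZp.of_le h2le), map_add]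
    ring
  rw [oneFormExtDeriv_apply α (hQ p) hZp, hQZ]
  have h0 : dForm (fun q ↦ α q (Q q)) p (Z p) = 0 := by
    rw [dForm_eq_zero_of_forall_eq hαQ]
    rfl
  rw [h0]
  ring

end Reeb

/-! ### Variation of an invariant form along a family of reparametrized integral curves -/

section InvariantForms

variable {M : Type*} [TopologicalSpace M] [ChartedSpace E3 M] [IsManifold (𝓡 3) ∞ M]

/-- The invariance `L_X α = 0` in the preferred chart at a point. -/
lemma PreservesForm.fderiv_formInChart_add {X : SmoothVectorField M} {α : SmoothOneForm M}
    (h : PreservesForm X α) (p : M) (v : E3) :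
    fderiv ℝ (formInChart α p) (extChartAt (𝓡 3) p p)
        (fieldInChart X p (extChartAt (𝓡 3) p p)) v
      + formInChart α p (extChartAt (𝓡 3) p p)
        (fderiv ℝ (fieldInChart X p) (extChartAt (𝓡 3) p p) v) = 0 := by
  obtain ⟨w, hw⟩ := (isInvertible_mfderiv_extChartAt (I := 𝓡 3)
    (mem_extChartAt_source (I := 𝓡 3) p)).surjective v
  obtain ⟨Y, U, hU, hpU, rfl, hY⟩ := exists_smooth_extension w
  have hv : fieldInChart Y p (extChartAt (𝓡 3) p p) = v := by
    rw [fieldInChart_extChartAt Y (mem_extChartAt_source (I := 𝓡 3) p)]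
    exact hw
  have h1 : dForm (fun q ↦ α q (Y q)) p (X p) = α p (mlieBracket (𝓡 3) (fun q ↦ X q) Y p) :=
    h p Y (hY p hpU)
  rw [mfderiv_form_apply (differentiableAt_formInChart (α.smoothFormAt p))
    (differentiableAt_fieldInChart ((hY p hpU).mdifferentiableAt (by simp))),
    form_apply_mlieBracket, hv, map_sub] at h1
  linarith

lemma PreservesForm.dForm_apply_self {X : SmoothVectorField M} {α : SmoothOneForm M}
    (h : PreservesForm X α) (p : M) : dForm (fun q ↦ α q (X q)) p (X p) = 0 := by
  have h1 : dForm (fun q ↦ α q (X q)) p (X p)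
    = α p (mlieBracket (𝓡 3) (fun q ↦ X q) (fun q ↦ X q) p) := h p _ (X.smoothFieldAt p)
  rw [h1, mlieBracket_self]
  simp

/-- For a map `σ` with `∂_t σ = K X`, and a constant vector `e`, one has
`∂_t (α (∂_e σ)) = (∂_e K) α(X)`, if `α` is invariant under `X`. -/
lemma PreservesForm.fderiv_form_comp {X : SmoothVectorField M} {α : SmoothOneForm M}
    (h : PreservesForm X α) {N : Type*} [NormedAddCommGroup N] [NormedSpace ℝ N] {σ : N → M}
    {x : N} (hσ : ContMDiffAt 𝓘(ℝ, N) (𝓡 3) ∞ σ x) {K : N → ℝ} (hK : DifferentiableAt ℝ K x)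
    {t : N} (ht : ∀ᶠ y in 𝓝 x, mfderiv 𝓘(ℝ, N) (𝓡 3) σ y t = K y • X (σ y)) (e : N) :
    HasFDerivAt (fun y ↦ α (σ y) (mfderiv 𝓘(ℝ, N) (𝓡 3) σ y e))
        (fderiv ℝ (fun y ↦ α (σ y) (mfderiv 𝓘(ℝ, N) (𝓡 3) σ y e)) x) x ∧
      fderiv ℝ (fun y ↦ α (σ y) (mfderiv 𝓘(ℝ, N) (𝓡 3) σ y e)) x t
        = fderiv ℝ K x e * α (σ x) (X (σ x)) := by
  set p := σ x with hp
  set τ : N → E3 := extChartAt (𝓡 3) p ∘ σ with hτdef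
  have hτ : ContDiffAt ℝ ∞ τ x :=
    ((contMDiffAt_extChartAt (n := ∞) (x := p)).comp x hσ).contDiffAt
  have hτx : τ x = extChartAt (𝓡 3) p p := rfl
  have hsrc : ∀ᶠ y in 𝓝 x, σ y ∈ (extChartAt (𝓡 3) p).source :=
    hσ.continuousAt.eventually (extChartAt_source_mem_nhds (I := 𝓡 3) p)
  have hdiff : ∀ᶠ y in 𝓝 x, MDifferentiableAt 𝓘(ℝ, N) (𝓡 3) σ y := by
    filter_upwards [(contMDiffAt_iff_contMDiffAt_nhds (n := 1) (by simp)).1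
      (ContMDiffAt.of_le hσ (WithTop.coe_le_coe.2 le_top))] with y hy
    exact hy.mdifferentiableAt (by simp)
  have hcomp : ∀ᶠ y in 𝓝 x, ∀ v : N, fderiv ℝ τ y v = mfderiv (𝓡 3) 𝓘(ℝ, E3) (extChartAt (𝓡 3) p)
      (σ y) (mfderiv 𝓘(ℝ, N) (𝓡 3) σ y v) := by
    filter_upwards [hsrc, hdiff] with y hy hy' v
    rw [← mfderiv_eq_fderiv, hτdef, mfderiv_comp y
      (mdifferentiableAt_extChartAt (by rwa [extChartAt_source] at hy)) hy']
    rfl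
  have hform : (fun y ↦ α (σ y) (mfderiv 𝓘(ℝ, N) (𝓡 3) σ y e)) =ᶠ[𝓝 x]
      fun y ↦ formInChart α p (τ y) (fderiv ℝ τ y e) := by
    filter_upwards [hsrc, hcomp] with y hy hy'
    rw [hy' e]
    exact (formInChart_mfderiv_extChartAt α hy _).symm
  have htime : (fun y ↦ fderiv ℝ τ y t) =ᶠ[𝓝 x] fun y ↦ K y • fieldInChart X p (τ y) := by
    filter_upwards [hsrc, hcomp, ht] with y hy hy' hy''
    rw [hy' t, hy'']
    refine (map_smul _ _ _).trans ?_
    exact congrArg (K y • ·) (fieldInChart_extChartAt X hy).symm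
  have hτd : DifferentiableAt ℝ τ x := hτ.differentiableAt (by simp)
  have hDτ : DifferentiableAt ℝ (fderiv ℝ τ) x :=
    (hτ.fderiv_right (m := 1) (WithTop.coe_le_coe.2 le_top)).differentiableAt (by simp)
  have hαd : DifferentiableAt ℝ (formInChart α p) (τ x) :=
    differentiableAt_formInChart (α.smoothFormAt p)
  have hXd : DifferentiableAt ℝ (fieldInChart X p) (τ x) :=
    differentiableAt_fieldInChart ((X.smoothFieldAt p).mdifferentiableAt (by simp))
  have hα1 : HasFDerivAt (fun y ↦ formInChart α p (τ y))
      ((fderiv ℝ (formInChart α p) (τ x)).comp (fderiv ℝ τ x)) x :=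
    hαd.hasFDerivAt.comp x hτd.hasFDerivAt
  have hX1 : HasFDerivAt (fun y ↦ fieldInChart X p (τ y))
      ((fderiv ℝ (fieldInChart X p) (τ x)).comp (fderiv ℝ τ x)) x :=
    hXd.hasFDerivAt.comp x hτd.hasFDerivAt
  have hD : ∀ v : N, HasFDerivAt (fun y ↦ fderiv ℝ τ y v) ((fderiv ℝ (fderiv ℝ τ) x).flip v) x :=
    fun v ↦ by
      have := hDτ.hasFDerivAt.clm_apply (hasFDerivAt_const v x)
      refine this.congr_fderiv ?_
      ext w; simp
  have hG := hα1.clm_apply (hD e)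
  have hT := (hK.hasFDerivAt.smul hX1).congr_of_eventuallyEq htime
  -- The equation $\partial_t\tau=K X$ is differentiated in the direction $e$. Symmetry of second
  -- derivatives then identifies $\partial_e\partial_t\tau$ with the $\partial_t\partial_e\tau$
  -- occurring in the derivative of $\alpha(\partial_e\tau)$.
  have hTe := DFunLike.congr_fun ((hD t).unique hT) e
  have hsymm := (hτ.isSymmSndFDerivAt (by
    simpa using (WithTop.coe_le_coe.2 le_top : ((2 : ℕ∞) : WithTop ℕ∞) ≤ ∞))).eq t e
  have hG' := hG.congr_of_eventuallyEq hform
  rw [hG'.fderiv]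
  refine ⟨hG', ?_⟩
  have hinv := h.fderiv_formInChart_add p (fderiv ℝ τ x e)
  have htx : fderiv ℝ τ x t = K x • fieldInChart X p (τ x) := htime.self_of_nhds
  have hH : formInChart α p (τ x) (fieldInChart X p (τ x)) = α p (X p) := by
    rw [hτx, fieldInChart_extChartAt X (mem_extChartAt_source (I := 𝓡 3) p)]
    exact formInChart_mfderiv_extChartAt α (mem_extChartAt_source (I := 𝓡 3) p) _
  rw [← hτx] at hinv
  simp only [ContinuousLinearMap.flip_apply, add_apply, ContinuousLinearMap.comp_apply,
    smul_apply, ContinuousLinearMap.smulRight_apply] at hTe ⊢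
  rw [hsymm, hTe, htx]
  simp only [map_add, map_smul, smul_apply, smul_eq_mul, hH]
  -- The terms with the derivatives of $\alpha$ and $X$ add up to
  -- $K\,(L_X\alpha)(\partial_e\tau)=0$, so only the derivative of $K$ survives.
  linear_combination K x * hinv

end InvariantForms

/-! ### Smooth dependence of integrals on parameters -/

section ParametricIntegrals

open MeasureTheory

/-- The integral is the value at $0$ of a convolution of the indicator of $(0,T]$ with the reflected
integrand, so smoothness of convolutions with parameters applies. -/
lemma contDiffOn_parametric_intervalIntegral {P : Type*} [NormedAddCommGroup P] [NormedSpace ℝ P]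
    {F : P → ℝ → ℝ} {s : Set P} (hs : IsOpen s)
    (hF : ContDiffOn ℝ ∞ (Function.uncurry F) (s ×ˢ univ)) {T : ℝ} (hT : 0 ≤ T) :
    ContDiffOn ℝ ∞ (fun p ↦ ∫ t in (0 : ℝ)..T, F p t) s := by
  -- The convolution theorem needs an integrand of compact support. The bump is $1$ on $[-T-1,T+1]$,
  -- which contains every $-t$ with $t\in(0,T]$, so the integral is unchanged.
  let b : ContDiffBump (0 : ℝ) := ⟨T + 1, T + 2, by linarith, by linarith⟩
  have hneg : ContDiffOn ℝ ∞ (fun x : P × ℝ ↦ ((x.1, -x.2) : P × ℝ)) (s ×ˢ univ) :=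
    (contDiff_fst.prodMk contDiff_snd.neg).contDiffOn
  have hg : ContDiffOn ℝ ∞ (Function.uncurry fun (p : P) (y : ℝ) ↦ b y * F p (-y)) (s ×ˢ univ) := by
    refine ContDiffOn.mul ?_ (hF.comp hneg fun x hx ↦ ⟨hx.1, mem_univ _⟩)
    exact (b.contDiff.comp contDiff_snd).contDiffOn
  have h := contDiffOn_convolution_right_with_param_comp (n := ⊤) (μ := (volume : Measure ℝ))
    (ContinuousLinearMap.mul ℝ ℝ) (contDiffOn_const (c := (0 : ℝ)) (s := s))
    (f := (Ioc 0 T).indicator fun _ ↦ (1 : ℝ)) hs (isCompact_closedBall (0 : ℝ) (T + 2))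
    (g := fun (p : P) (y : ℝ) ↦ b y * F p (-y))
    (fun p x _ hx ↦ by
      rw [b.zero_of_le_dist, zero_mul]
      simpa using le_of_lt (not_le.1 (fun h ↦ hx (Metric.mem_closedBall.2 h))))
    ((integrableOn_const (by simp)).integrable_indicator measurableSet_Ioc).locallyIntegrable hg
  refine h.congr fun p _ ↦ ?_
  rw [intervalIntegral.integral_of_le hT, ← integral_indicator measurableSet_Ioc]
  simp only [convolution_def]
  congr 1 with t
  by_cases ht : t ∈ Ioc 0 T
  · rw [indicator_of_mem ht, indicator_of_mem ht, b.one_of_mem_closedBall]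
    · simp
    · rw [mem_closedBall_zero_iff, Real.norm_eq_abs, abs_le]
      constructor <;> simp <;> linarith [ht.1, ht.2]
  · rw [indicator_of_notMem ht, indicator_of_notMem ht]
    simp

/-- Differentiation under the integral sign, for a `C¹` integrand on an interval. -/
lemma hasDerivAt_parametric_intervalIntegral {F F' : ℝ → ℝ → ℝ} {s : Set ℝ} (hs : IsOpen s)
    {x : ℝ} (hx : x ∈ s) (hF : ∀ y ∈ s, Continuous (F y))
    (hF' : ContinuousOn (Function.uncurry F') (s ×ˢ univ))
    (h : ∀ y ∈ s, ∀ t, HasDerivAt (fun y ↦ F y t) (F' y t) y) (a b : ℝ) :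
    HasDerivAt (fun y ↦ ∫ t in a..b, F y t) (∫ t in a..b, F' x t) x := by
  obtain ⟨ε, hε, hεs⟩ := Metric.nhds_basis_closedBall.mem_iff.1 (hs.mem_nhds hx)
  have hc : IsCompact (Metric.closedBall x ε ×ˢ uIcc a b) :=
    (isCompact_closedBall x ε).prod isCompact_uIcc
  obtain ⟨C, hC⟩ := hc.exists_bound_of_continuousOn
    (hF'.mono (prod_mono hεs (subset_univ _)))
  have hcont : Continuous (F' x) := by
    rw [← continuousOn_univ]
    exact hF'.comp (by fun_prop : ContinuousOn (fun t : ℝ ↦ (x, t)) univ) fun t _ ↦ ⟨hx, mem_univ _⟩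
  refine (intervalIntegral.hasDerivAt_integral_of_dominated_loc_of_deriv_le
    (bound := fun _ ↦ C) (Metric.ball_mem_nhds x hε) ?_
    ((hF x hx).intervalIntegrable a b) hcont.aestronglyMeasurable ?_ (by simp) ?_).2
  · filter_upwards [hs.mem_nhds hx] with y hy using (hF y hy).aestronglyMeasurable
  · refine Filter.Eventually.of_forall fun t ht y hy ↦ ?_
    exact hC (y, t) ⟨Metric.ball_subset_closedBall hy, uIoc_subset_uIcc ht⟩
  · refine Filter.Eventually.of_forall fun t ht y hy ↦ ?_
    exact h y (hεs (Metric.ball_subset_closedBall hy)) t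

end ParametricIntegrals

/-! ### Differentials of complex functions and derivatives along curves -/

section ComplexDifferential

variable {M : Type*} [TopologicalSpace M] [ChartedSpace E3 M] [IsManifold (𝓡 3) ∞ M]

/-- The differential of a complex function, as a field of complex valued linear forms. -/
def cForm (f : M → ℂ) (q : M) : TangentSpace (𝓡 3) q →L[ℝ] ℂ :=
  mfderiv (𝓡 3) 𝓘(ℝ, ℂ) f q

lemma dForm_re {f : M → ℂ} {q : M} (hf : MDifferentiableAt (𝓡 3) 𝓘(ℝ, ℂ) f q)
    (v : TangentSpace (𝓡 3) q) : dForm (fun q ↦ (f q).re) q v = (cForm f q v).re := by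
  have h : HasMFDerivAt 𝓘(ℝ, ℂ) 𝓘(ℝ, ℝ) Complex.reCLM (f q) Complex.reCLM :=
    Complex.reCLM.hasFDerivAt.hasMFDerivAt
  have := (h.comp q hf.hasMFDerivAt).mfderiv
  exact DFunLike.congr_fun this v

lemma dForm_im {f : M → ℂ} {q : M} (hf : MDifferentiableAt (𝓡 3) 𝓘(ℝ, ℂ) f q)
    (v : TangentSpace (𝓡 3) q) : dForm (fun q ↦ (f q).im) q v = (cForm f q v).im := by
  have h : HasMFDerivAt 𝓘(ℝ, ℂ) 𝓘(ℝ, ℝ) Complex.imCLM (f q) Complex.imCLM :=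
    Complex.imCLM.hasFDerivAt.hasMFDerivAt
  have := (h.comp q hf.hasMFDerivAt).mfderiv
  exact DFunLike.congr_fun this v

/-- The derivative of a function along a parametrized curve. -/
lemma hasDerivAt_cForm_comp {f : M → ℂ} {γ : ℝ → M} {t : ℝ}
    (hf : MDifferentiableAt (𝓡 3) 𝓘(ℝ, ℂ) f (γ t)) {v : TangentSpace (𝓡 3) (γ t)}
    (hγ : HasMFDerivAt 𝓘(ℝ, ℝ) (𝓡 3) γ t ((1 : ℝ →L[ℝ] ℝ).smulRight v)) :
    HasDerivAt (fun s ↦ f (γ s)) (cForm f (γ t) v) t := by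
  let L : ℝ →L[ℝ] ℂ := (1 : ℝ →L[ℝ] ℝ).smulRight (cForm f (γ t) v)
  have h : HasMFDerivAt 𝓘(ℝ, ℝ) 𝓘(ℝ, ℂ) (fun s ↦ f (γ s)) t L := by
    refine (hf.hasMFDerivAt.comp t hγ).congr_mfderiv (ContinuousLinearMap.ext fun s ↦ ?_)
    exact map_smul (cForm f (γ t)) _ v
  have h2 : HasFDerivAt (fun s ↦ f (γ s)) L t := hasMFDerivAt_iff_hasFDerivAt.1 h
  simpa [L] using h2.hasDerivAt

lemma hasDerivAt_dForm_comp {f : M → ℝ} {γ : ℝ → M} {t : ℝ}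
    (hf : MDifferentiableAt (𝓡 3) 𝓘(ℝ, ℝ) f (γ t)) {v : TangentSpace (𝓡 3) (γ t)}
    (hγ : HasMFDerivAt 𝓘(ℝ, ℝ) (𝓡 3) γ t ((1 : ℝ →L[ℝ] ℝ).smulRight v)) :
    HasDerivAt (fun s ↦ f (γ s)) (dForm f (γ t) v) t := by
  let L : ℝ →L[ℝ] ℝ := (1 : ℝ →L[ℝ] ℝ).smulRight (dForm f (γ t) v)
  have h : HasMFDerivAt 𝓘(ℝ, ℝ) 𝓘(ℝ, ℝ) (fun s ↦ f (γ s)) t L := by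
    refine (hf.hasMFDerivAt.comp t hγ).congr_mfderiv (ContinuousLinearMap.ext fun s ↦ ?_)
    exact map_smul (dForm f (γ t)) _ v
  have h2 : HasFDerivAt (fun s ↦ f (γ s)) L t := hasMFDerivAt_iff_hasFDerivAt.1 h
  simpa [L] using h2.hasDerivAt

end ComplexDifferential

/-! ### Fibered solid tori: coordinates, orbits and unwrapping -/

section FiberedTori

variable {M : Type*} [TopologicalSpace M] [ChartedSpace E3 M] [IsManifold (𝓡 3) ∞ M]

/-- A diffeomorphism of a saturated open set onto a fibered solid torus. -/
structure FiberedTorusChart (S : SeifertFibration M) where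
  /-- the multiplicity of the central fiber -/
  a : ℕ
  /-- the twisting of the fibers around the central one -/
  b : ℤ
  /-- the diffeomorphism -/
  φ : OpenPartialHomeomorph M (ℂ × Circle)
  a_pos : 0 < a
  target_eq : φ.target = Metric.ball (0 : ℂ) 1 ×ˢ univ
  smooth : ContMDiffOn (𝓡 3) (𝓘(ℝ, ℂ).prod (𝓡 1)) ∞ φ φ.source
  smooth_symm : ContMDiffOn (𝓘(ℝ, ℂ).prod (𝓡 1)) (𝓡 3) ∞ φ.symm φ.target
  sameFiber_iff : ∀ x ∈ φ.source, ∀ y : M, S.sameFiber x y ↔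
    y ∈ φ.source ∧ ∃ c : Circle, φ y = (((c ^ b : Circle) : ℂ) * (φ x).1, c ^ a * (φ x).2)

lemma SeifertFibration.exists_fiberedTorusChart (S : SeifertFibration M) (p : M) :
    ∃ τ : FiberedTorusChart S, p ∈ τ.φ.source ∧ (τ.φ p).1 = 0 := by
  obtain ⟨a, b, φ, ha, -, hp, hp0, ht, h1, h2, h3⟩ := S.exists_fiberedTorus p
  exact ⟨⟨a, b, φ, ha, ht, h1, h2, h3⟩, hp, hp0⟩

namespace FiberedTorusChart

variable {S : SeifertFibration M} (τ : FiberedTorusChart S)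

/-- The disc coordinate. -/
def Z (q : M) : ℂ := (τ.φ q).1

/-- The circle coordinate. -/
def W (q : M) : ℂ := ((τ.φ q).2 : ℂ)

lemma contMDiffOn_Z : ContMDiffOn (𝓡 3) 𝓘(ℝ, ℂ) ∞ τ.Z τ.φ.source :=
  contMDiff_fst.comp_contMDiffOn τ.smooth

lemma contMDiff_circle_coe : ContMDiff (𝓡 1) 𝓘(ℝ, ℂ) ∞ (fun w : Circle ↦ (w : ℂ)) := by
  have := finrank_real_complex_fact'
  exact contMDiff_coe_sphere

lemma contMDiffOn_W : ContMDiffOn (𝓡 3) 𝓘(ℝ, ℂ) ∞ τ.W τ.φ.source :=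
  contMDiff_circle_coe.comp_contMDiffOn (contMDiff_snd.comp_contMDiffOn τ.smooth)

lemma mdifferentiableAt_Z {q : M} (hq : q ∈ τ.φ.source) :
    MDifferentiableAt (𝓡 3) 𝓘(ℝ, ℂ) τ.Z q :=
  (τ.contMDiffOn_Z.contMDiffAt (τ.φ.open_source.mem_nhds hq)).mdifferentiableAt (by simp)

lemma mdifferentiableAt_W {q : M} (hq : q ∈ τ.φ.source) :
    MDifferentiableAt (𝓡 3) 𝓘(ℝ, ℂ) τ.W q :=
  (τ.contMDiffOn_W.contMDiffAt (τ.φ.open_source.mem_nhds hq)).mdifferentiableAt (by simp)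

/-- The circle is immersed in $\mathbb C$, so $dZ$ and $dW$ together determine $d\varphi$, and
$\varphi$ has a smooth inverse. -/
lemma eq_zero_of_cForm {q : M} (hq : q ∈ τ.φ.source) {v : TangentSpace (𝓡 3) q}
    (hZ : cForm τ.Z q v = 0) (hW : cForm τ.W q v = 0) : v = 0 := by
  have hφ : MDifferentiableAt (𝓡 3) (𝓘(ℝ, ℂ).prod (𝓡 1)) τ.φ q :=
    (τ.smooth.contMDiffAt (τ.φ.open_source.mem_nhds hq)).mdifferentiableAt (by simp)
  have hψ : MDifferentiableAt (𝓘(ℝ, ℂ).prod (𝓡 1)) (𝓡 3) τ.φ.symm (τ.φ q) :=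
    (τ.smooth_symm.contMDiffAt (τ.φ.open_target.mem_nhds (τ.φ.map_source hq))).mdifferentiableAt
      (by simp)
  have hid : mfderiv (𝓡 3) (𝓡 3) (τ.φ.symm ∘ τ.φ) q v = v := by
    have : τ.φ.symm ∘ τ.φ =ᶠ[𝓝 q] id := by
      filter_upwards [τ.φ.open_source.mem_nhds hq] with x hx using τ.φ.left_inv hx
    rw [this.mfderiv_eq, mfderiv_id]
    rfl
  have h2 : MDifferentiableAt (𝓡 3) (𝓡 1) (fun x ↦ (τ.φ x).2) q := hφ.snd
  have h1 : MDifferentiableAt (𝓡 3) 𝓘(ℝ, ℂ) (fun x ↦ (τ.φ x).1) q := hφ.fst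
  have hprod : mfderiv (𝓡 3) (𝓘(ℝ, ℂ).prod (𝓡 1)) τ.φ q v = 0 := by
    have e : mfderiv (𝓡 3) (𝓘(ℝ, ℂ).prod (𝓡 1)) (fun x ↦ ((τ.φ x).1, (τ.φ x).2)) q
        = (mfderiv (𝓡 3) 𝓘(ℝ, ℂ) (fun x ↦ (τ.φ x).1) q).prod
          (mfderiv (𝓡 3) (𝓡 1) (fun x ↦ (τ.φ x).2) q) := h1.mfderiv_prod h2
    have e2 : mfderiv (𝓡 3) (𝓡 1) (fun x ↦ (τ.φ x).2) q v = 0 := by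
      have := finrank_real_complex_fact'
      apply injective_mvfderiv_subtypeVal_sphere (n := 1) (τ.φ q).2
      have hc : MDifferentiableAt (𝓡 1) 𝓘(ℝ, ℂ) (fun w : Circle ↦ (w : ℂ)) (τ.φ q).2 :=
        contMDiff_circle_coe.contMDiffAt.mdifferentiableAt (by simp)
      have h3 : mfderiv (𝓡 3) 𝓘(ℝ, ℂ) τ.W q
          = (mfderiv (𝓡 1) 𝓘(ℝ, ℂ) (fun w : Circle ↦ (w : ℂ)) (τ.φ q).2).comp
            (mfderiv (𝓡 3) (𝓡 1) (fun x ↦ (τ.φ x).2) q) := mfderiv_comp q hc h2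
      have h4 := DFunLike.congr_fun h3 v
      refine (h4.symm.trans hW).trans ?_
      exact (map_zero (mfderiv (𝓡 1) 𝓘(ℝ, ℂ) (fun w : Circle ↦ (w : ℂ)) (τ.φ q).2)).symm
    refine (DFunLike.congr_fun e v).trans ?_
    exact Prod.ext hZ e2
  rw [mfderiv_comp q hψ hφ] at hid
  rw [← hid]
  refine (congrArg (mfderiv (𝓘(ℝ, ℂ).prod (𝓡 1)) (𝓡 3) τ.φ.symm (τ.φ q)) hprod).trans ?_
  exact map_zero _

/-- The solid torus unwrapped along the orbits of the circle action. -/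
def unwrap (x : ℂ × ℝ) : M :=
  τ.φ.symm ((Circle.exp (τ.b * x.2) : ℂ) * x.1, Circle.exp (τ.a * x.2))

/-- The circle action on the solid torus. -/
def orbit (q : M) (t : ℝ) : M :=
  τ.φ.symm ((Circle.exp (τ.b * t) : ℂ) * (τ.φ q).1, Circle.exp (τ.a * t) * (τ.φ q).2)

lemma mem_target_iff (x : ℂ × Circle) : x ∈ τ.φ.target ↔ ‖x.1‖ < 1 := by
  rw [τ.target_eq]; simp

lemma norm_Z_lt {q : M} (hq : q ∈ τ.φ.source) : ‖τ.Z q‖ < 1 :=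
  (τ.mem_target_iff _).1 (τ.φ.map_source hq)

lemma norm_W (q : M) : ‖τ.W q‖ = 1 := Circle.norm_coe _

lemma unwrap_mem {x : ℂ × ℝ} (hx : ‖x.1‖ < 1) : τ.unwrap x ∈ τ.φ.source :=
  τ.φ.map_target ((τ.mem_target_iff _).2 (by simpa using hx))

lemma φ_unwrap {x : ℂ × ℝ} (hx : ‖x.1‖ < 1) :
    τ.φ (τ.unwrap x) = ((Circle.exp (τ.b * x.2) : ℂ) * x.1, Circle.exp (τ.a * x.2)) :=
  τ.φ.right_inv ((τ.mem_target_iff _).2 (by simpa using hx))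

lemma Z_unwrap {x : ℂ × ℝ} (hx : ‖x.1‖ < 1) :
    τ.Z (τ.unwrap x) = Complex.exp (τ.b * x.2 * Complex.I) * x.1 := by
  rw [Z, φ_unwrap τ hx, Circle.coe_exp]; push_cast; rfl

lemma W_unwrap {x : ℂ × ℝ} (hx : ‖x.1‖ < 1) :
    τ.W (τ.unwrap x) = Complex.exp (τ.a * x.2 * Complex.I) := by
  rw [W, φ_unwrap τ hx, Circle.coe_exp]; push_cast; rfl

lemma unwrap_add_two_pi (z : ℂ) (t : ℝ) : τ.unwrap (z, t + 2 * Real.pi) = τ.unwrap (z, t) := by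
  have h1 : Circle.exp (τ.b * (t + 2 * Real.pi)) = Circle.exp (τ.b * t) := by
    rw [mul_add, Circle.exp_add, Circle.exp_int_mul_two_pi, mul_one]
  have h2 : Circle.exp (τ.a * (t + 2 * Real.pi)) = Circle.exp (τ.a * t) := by
    rw [mul_add, Circle.exp_add]
    have := Circle.exp_int_mul_two_pi τ.a
    rw [Int.cast_natCast] at this
    rw [this, mul_one]
  simp only [unwrap, h1, h2]

lemma exists_unwrap_eq {q : M} (hq : q ∈ τ.φ.source) :
    ∃ x : ℂ × ℝ, ‖x.1‖ < 1 ∧ τ.unwrap x = q := by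
  obtain ⟨s, hs⟩ : ∃ s, Circle.exp s = (τ.φ q).2 := ⟨_, Circle.exp_arg _⟩
  have ha : (τ.a : ℝ) ≠ 0 := Nat.cast_ne_zero.2 τ.a_pos.ne'
  -- The time $s/a$ gives the right circle coordinate $e^{is}$. The disc coordinate is rotated back
  -- by the angle $bs/a$ that the action adds in that time.
  refine ⟨((Circle.exp (-(τ.b * (s / τ.a))) : ℂ) * τ.Z q, s / τ.a), ?_, ?_⟩
  · rw [norm_mul, Circle.norm_coe, one_mul]
    exact τ.norm_Z_lt hq
  · rw [unwrap, mul_div_cancel₀ _ ha, hs, ← mul_assoc, ← Circle.coe_mul, ← Circle.exp_add,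
      add_neg_cancel, Circle.exp_zero, Circle.coe_one, one_mul]
    exact τ.φ.left_inv hq

lemma orbit_unwrap {x : ℂ × ℝ} (hx : ‖x.1‖ < 1) (t : ℝ) :
    τ.orbit (τ.unwrap x) t = τ.unwrap (x.1, x.2 + t) := by
  rw [orbit, φ_unwrap τ hx, unwrap]
  congr 2
  · rw [← mul_assoc, ← Circle.coe_mul, ← Circle.exp_add]
    congr 3; ring
  · rw [← Circle.exp_add]
    congr 1; ring

lemma isOpen_domain : IsOpen {x : ℂ × ℝ | ‖x.1‖ < 1} :=
  isOpen_lt (by fun_prop) continuous_const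

lemma contMDiffOn_unwrap :
    ContMDiffOn 𝓘(ℝ, ℂ × ℝ) (𝓡 3) ∞ τ.unwrap {x | ‖x.1‖ < 1} := by
  have h1 : ContMDiff 𝓘(ℝ, ℂ × ℝ) (𝓡 1) ∞ (fun x : ℂ × ℝ ↦ Circle.exp (τ.b * x.2)) :=
    contMDiff_circleExp.comp (by fun_prop : ContDiff ℝ ∞ fun x : ℂ × ℝ ↦ τ.b * x.2).contMDiff
  have h2 : ContMDiff 𝓘(ℝ, ℂ × ℝ) (𝓡 1) ∞ (fun x : ℂ × ℝ ↦ Circle.exp (τ.a * x.2)) :=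
    contMDiff_circleExp.comp (by fun_prop : ContDiff ℝ ∞ fun x : ℂ × ℝ ↦ τ.a * x.2).contMDiff
  have h3 : ContMDiff 𝓘(ℝ, ℂ × ℝ) 𝓘(ℝ, ℂ) ∞
      (fun x : ℂ × ℝ ↦ (Circle.exp (τ.b * x.2) : ℂ) * x.1) :=
    (contDiff_fst.mul contDiff_snd : ContDiff ℝ ∞ fun w : ℂ × ℂ ↦ w.1 * w.2).contMDiff.comp
      ((contMDiff_circle_coe.comp h1).prodMk_space contDiff_fst.contMDiff)
  refine τ.smooth_symm.comp (h3.prodMk h2).contMDiffOn fun x hx ↦ ?_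
  exact (τ.mem_target_iff _).2 (by simpa using hx)

end FiberedTorusChart

end FiberedTori

/-! ### Tangent fields as multiples of the generator of the model circle action -/

section FieldsOnFiberedTori

variable {M : Type*} [TopologicalSpace M] [ChartedSpace E3 M] [IsManifold (𝓡 3) ∞ M]

/-- The derivative at `0` of a curve in an orbit of the weighted circle action on `ℂ²`. -/
lemma deriv_eq_of_weighted_orbit {a : ℕ} (ha : 0 < a) {b : ℤ} {z w : ℝ → ℂ} {z' w' : ℂ}
    (hz : HasDerivAt z z' 0) (hw : HasDerivAt w w' 0) (hnorm : ∀ t, ‖w t‖ = 1)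
    (horb : ∀ t, ∃ c : Circle, z t = ((c ^ b : Circle) : ℂ) * z 0 ∧
      w t = ((c ^ a : Circle) : ℂ) * w 0) :
    w' = Complex.I * ((w' * starRingEnd ℂ (w 0)).im : ℂ) * w 0 ∧
      a * z' = b * (Complex.I * ((w' * starRingEnd ℂ (w 0)).im : ℂ)) * z 0 := by
  have hconj : ∀ t, w t * starRingEnd ℂ (w t) = 1 := fun t ↦ by
    rw [Complex.mul_conj, Complex.normSq_eq_norm_sq, hnorm t]; simp
  have hw0 : w 0 ≠ 0 := fun h ↦ by simpa [h] using hnorm 0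
  have hre : (w' * starRingEnd ℂ (w 0)).re = 0 := by
    have h1 : HasDerivAt (fun t ↦ w t * starRingEnd ℂ (w t))
        (w' * starRingEnd ℂ (w 0) + w 0 * starRingEnd ℂ w') 0 := hw.mul hw.star
    have h2 : HasDerivAt (fun t ↦ w t * starRingEnd ℂ (w t)) 0 0 := by
      simp only [hconj]; exact hasDerivAt_const _ _
    have h3 := congrArg Complex.re (h1.unique h2)
    simp only [Complex.add_re, Complex.mul_re, Complex.conj_re, Complex.conj_im,
      Complex.zero_re] at h3 ⊢
    linarith
  set r : ℝ := (w' * starRingEnd ℂ (w 0)).im with hr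
  have hI : w' * starRingEnd ℂ (w 0) = Complex.I * r := by
    apply Complex.ext <;> simp [hre, hr]
  have hw' : w' = Complex.I * r * w 0 := by
    rw [← hI, mul_assoc, mul_comm (starRingEnd ℂ (w 0)), hconj, mul_one]
  refine ⟨hw', ?_⟩
  -- On the central fiber $z$ vanishes identically, so both sides are zero.
  by_cases hz0 : z 0 = 0
  · have : z = fun _ ↦ 0 := by
      funext t
      obtain ⟨c, hc, -⟩ := horb t
      rw [hc, hz0, mul_zero]
    rw [hz0, mul_zero]
    rw [this] at hz
    rw [hz.unique (hasDerivAt_const _ _), mul_zero]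
  -- The rotation $c=c(t)$ is not known to depend smoothly, or even continuously, on $t$. Since
  -- $(c^b)^a=(c^a)^b$, taking the $a$-th power of $z$ expresses it through $w$ and eliminates $c$.
  · have heq : (fun t ↦ z t ^ a) = fun t ↦ (w t / w 0) ^ b * z 0 ^ a := by
      funext t
      obtain ⟨c, hc, hc'⟩ := horb t
      rw [hc', mul_div_assoc, div_self hw0, mul_one, hc, mul_pow]
      congr 1
      rw [← Circle.coe_pow, ← Circle.coe_zpow, ← zpow_natCast, ← zpow_natCast, ← zpow_mul,
        ← zpow_mul, mul_comm]
    have h1 : HasDerivAt (fun t ↦ z t ^ a) (a * z 0 ^ (a - 1) * z') 0 := hz.pow a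
    have h2 : HasDerivAt (fun t ↦ (w t / w 0) ^ b * z 0 ^ a)
        (b * (w 0 / w 0) ^ (b - 1) * (w' / w 0) * z 0 ^ a) 0 :=
      (HasDerivAt.comp (0 : ℝ) (hasDerivAt_zpow b (w 0 / w 0) (Or.inl (by simp [hw0])))
        (hw.div_const (w 0))).mul_const _
    rw [heq] at h1
    have h3 := h1.unique h2
    rw [div_self hw0, one_zpow, hw', mul_div_assoc, div_self hw0, mul_one, mul_one] at h3
    have h4 : z 0 ^ a = z 0 ^ (a - 1) * z 0 := by
      rw [← pow_succ, Nat.sub_add_cancel ha]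
    rw [h4] at h3
    have h5 : z 0 ^ (a - 1) ≠ 0 := pow_ne_zero _ hz0
    apply mul_left_cancel₀ h5
    linear_combination h3

namespace FiberedTorusChart

variable {S : SeifertFibration M} (τ : FiberedTorusChart S)

/-- The factor between a vector field tangent to the fibers and the generator of the circle
action. -/
def speed (X : SmoothVectorField M) (q : M) : ℝ :=
  (cForm τ.W q (X q) * starRingEnd ℂ (τ.W q)).im / τ.a

lemma a_ne_zero : (τ.a : ℂ) ≠ 0 := Nat.cast_ne_zero.2 τ.a_pos.ne'

variable {X : SmoothVectorField M}

/-- At each point $X$ is the velocity of a curve inside an orbit of the weighted action, hence a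
multiple of its generator. The factor is read off from the circle coordinate, which never vanishes.
-/
lemma cForm_field (hX : TangentToFibers S X) {q : M} (hq : q ∈ τ.φ.source) :
    cForm τ.W q (X q) = τ.a * Complex.I * τ.speed X q * τ.W q ∧
      cForm τ.Z q (X q) = τ.b * Complex.I * τ.speed X q * τ.Z q := by
  obtain ⟨γ, -, hfib, hγ0, hγ⟩ := hX q
  subst hγ0
  have hmem : ∀ t, γ t ∈ τ.φ.source ∧ ∃ c : Circle, τ.φ (γ t)
      = (((c ^ τ.b : Circle) : ℂ) * (τ.φ (γ 0)).1, c ^ τ.a * (τ.φ (γ 0)).2) := fun t ↦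
    (τ.sameFiber_iff _ hq _).1 (hfib t)
  have hz := hasDerivAt_cForm_comp (τ.mdifferentiableAt_Z hq) hγ
  have hw := hasDerivAt_cForm_comp (τ.mdifferentiableAt_W hq) hγ
  obtain ⟨h1, h2⟩ := deriv_eq_of_weighted_orbit τ.a_pos (b := τ.b) hz hw (fun t ↦ τ.norm_W _)
    (fun t ↦ by
      obtain ⟨-, c, hc⟩ := hmem t
      refine ⟨c, congrArg Prod.fst hc, ?_⟩
      have := congrArg Prod.snd hc
      simp only [W, this, Circle.coe_mul])
  have ha := τ.a_ne_zero
  constructor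
  · conv_lhs => rw [h1]
    rw [speed]
    push_cast
    field_simp
  · apply mul_left_cancel₀ ha
    rw [h2, speed]
    push_cast
    field_simp

lemma speed_ne_zero (hX : TangentToFibers S X) (hX0 : ∀ p, X p ≠ 0) {q : M}
    (hq : q ∈ τ.φ.source) : τ.speed X q ≠ 0 := by
  intro h
  obtain ⟨h1, h2⟩ := τ.cForm_field hX hq
  rw [h] at h1 h2
  exact hX0 q (τ.eq_zero_of_cForm hq (by simpa using h2) (by simpa using h1))

lemma contMDiffOn_speed (X : SmoothVectorField M) :
    ContMDiffOn (𝓡 3) 𝓘(ℝ, ℝ) ∞ (τ.speed X) τ.φ.source := by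
  intro q hq
  have hn := τ.φ.open_source.mem_nhds hq
  have hW := τ.contMDiffOn_W.contMDiffAt hn
  have hre : ContMDiffAt (𝓡 3) 𝓘(ℝ, ℝ) ∞ (fun q ↦ (τ.W q).re) q :=
    Complex.reCLM.contDiff.contMDiff.contMDiffAt.comp q hW
  have him : ContMDiffAt (𝓡 3) 𝓘(ℝ, ℝ) ∞ (fun q ↦ (τ.W q).im) q :=
    Complex.imCLM.contDiff.contMDiff.contMDiffAt.comp q hW
  have h := (((contMDiffAt_dForm_apply him (X.smoothFieldAt q)).mul hre).sub
    ((contMDiffAt_dForm_apply hre (X.smoothFieldAt q)).mul him)).mul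
      (contMDiffAt_const (c := (τ.a : ℝ)⁻¹))
  refine (h.congr_of_eventuallyEq ?_).contMDiffWithinAt
  filter_upwards [hn] with x hx
  have hd := τ.mdifferentiableAt_W hx
  simp only [Pi.mul_apply, dForm_re hd, dForm_im hd, speed, Complex.mul_im,
    Complex.conj_re, Complex.conj_im]
  ring

lemma mdifferentiableAt_unwrap {x : ℂ × ℝ} (hx : ‖x.1‖ < 1) :
    MDifferentiableAt 𝓘(ℝ, ℂ × ℝ) (𝓡 3) τ.unwrap x :=
  (τ.contMDiffOn_unwrap.contMDiffAt (isOpen_domain.mem_nhds hx)).mdifferentiableAt (by simp)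

lemma cForm_Z_mfderiv_unwrap {x : ℂ × ℝ} (hx : ‖x.1‖ < 1) (v : ℂ × ℝ) :
    cForm τ.Z (τ.unwrap x) (mfderiv 𝓘(ℝ, ℂ × ℝ) (𝓡 3) τ.unwrap x v)
      = Complex.exp (τ.b * x.2 * Complex.I) * v.1
        + τ.b * v.2 * Complex.I * (Complex.exp (τ.b * x.2 * Complex.I) * x.1) := by
  have h1 : mfderiv 𝓘(ℝ, ℂ × ℝ) 𝓘(ℝ, ℂ) (τ.Z ∘ τ.unwrap) x v
      = cForm τ.Z (τ.unwrap x) (mfderiv 𝓘(ℝ, ℂ × ℝ) (𝓡 3) τ.unwrap x v) := by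
    rw [mfderiv_comp x (τ.mdifferentiableAt_Z (τ.unwrap_mem hx)) (τ.mdifferentiableAt_unwrap hx)]
    rfl
  have h2 : τ.Z ∘ τ.unwrap =ᶠ[𝓝 x] fun y ↦ Complex.exp (τ.b * y.2 * Complex.I) * y.1 := by
    filter_upwards [isOpen_domain.mem_nhds hx] with y hy using τ.Z_unwrap hy
  rw [← h1, mfderiv_eq_fderiv, h2.fderiv_eq]
  have h3 : HasFDerivAt (fun y : ℂ × ℝ ↦ (y.2 : ℂ))
      (Complex.ofRealCLM.comp (ContinuousLinearMap.snd ℝ ℂ ℝ)) x :=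
    (Complex.ofRealCLM.comp (ContinuousLinearMap.snd ℝ ℂ ℝ)).hasFDerivAt
  have h4 := (((h3.const_mul (τ.b : ℂ)).mul_const Complex.I).cexp).mul (hasFDerivAt_fst (p := x))
  refine (DFunLike.congr_fun h4.fderiv v).trans ?_
  simp
  ring

lemma cForm_W_mfderiv_unwrap {x : ℂ × ℝ} (hx : ‖x.1‖ < 1) (v : ℂ × ℝ) :
    cForm τ.W (τ.unwrap x) (mfderiv 𝓘(ℝ, ℂ × ℝ) (𝓡 3) τ.unwrap x v)
      = τ.a * v.2 * Complex.I * Complex.exp (τ.a * x.2 * Complex.I) := by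
  have h1 : mfderiv 𝓘(ℝ, ℂ × ℝ) 𝓘(ℝ, ℂ) (τ.W ∘ τ.unwrap) x v
      = cForm τ.W (τ.unwrap x) (mfderiv 𝓘(ℝ, ℂ × ℝ) (𝓡 3) τ.unwrap x v) := by
    rw [mfderiv_comp x (τ.mdifferentiableAt_W (τ.unwrap_mem hx)) (τ.mdifferentiableAt_unwrap hx)]
    rfl
  have h2 : τ.W ∘ τ.unwrap =ᶠ[𝓝 x] fun y ↦ Complex.exp (τ.a * y.2 * Complex.I) := by
    filter_upwards [isOpen_domain.mem_nhds hx] with y hy using τ.W_unwrap hy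
  rw [← h1, mfderiv_eq_fderiv, h2.fderiv_eq]
  have h3 : HasFDerivAt (fun y : ℂ × ℝ ↦ (y.2 : ℂ))
      (Complex.ofRealCLM.comp (ContinuousLinearMap.snd ℝ ℂ ℝ)) x :=
    (Complex.ofRealCLM.comp (ContinuousLinearMap.snd ℝ ℂ ℝ)).hasFDerivAt
  have h4 := ((h3.const_mul (τ.a : ℂ)).mul_const Complex.I).cexp
  refine (DFunLike.congr_fun h4.fderiv v).trans ?_
  simp
  ring

lemma surjective_mfderiv_unwrap {x : ℂ × ℝ} (hx : ‖x.1‖ < 1) :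
    Function.Surjective (mfderiv 𝓘(ℝ, ℂ × ℝ) (𝓡 3) τ.unwrap x) := by
  let L : ℂ × ℝ →L[ℝ] E3 := mfderiv 𝓘(ℝ, ℂ × ℝ) (𝓡 3) τ.unwrap x
  have hinj : Function.Injective (L : ℂ × ℝ →ₗ[ℝ] E3) := by
    rw [← LinearMap.ker_eq_bot, LinearMap.ker_eq_bot']
    intro v hv
    have hv' : mfderiv 𝓘(ℝ, ℂ × ℝ) (𝓡 3) τ.unwrap x v = 0 := hv
    have hW := τ.cForm_W_mfderiv_unwrap hx v
    have hZ := τ.cForm_Z_mfderiv_unwrap hx v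
    rw [hv'] at hW hZ
    have h2 : v.2 = 0 := by
      have h0 : (τ.a * v.2 * Complex.I * Complex.exp (τ.a * x.2 * Complex.I) : ℂ) = 0 :=
        hW.symm.trans (map_zero _)
      simpa [τ.a_pos.ne'] using h0
    have h1 : v.1 = 0 := by
      have h0 := hZ.symm.trans (map_zero _)
      simpa [h2] using h0
    exact Prod.ext h1 h2
  have hfin : Module.finrank ℝ (ℂ × ℝ) = Module.finrank ℝ E3 := by simp
  exact (LinearMap.injective_iff_surjective_of_finrank_eq_finrank hfin).1 hinj

/-- The unwrapped fibers are integral curves of `X`, up to parametrization. -/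
lemma mfderiv_unwrap_time (hX : TangentToFibers S X) (hX0 : ∀ p, X p ≠ 0) {x : ℂ × ℝ}
    (hx : ‖x.1‖ < 1) :
    mfderiv 𝓘(ℝ, ℂ × ℝ) (𝓡 3) τ.unwrap x ((0, 1) : ℂ × ℝ)
      = (τ.speed X (τ.unwrap x))⁻¹ • X (τ.unwrap x) := by
  have hq := τ.unwrap_mem hx
  have hs := τ.speed_ne_zero hX hX0 hq
  have hs' : (τ.speed X (τ.unwrap x) : ℂ) ≠ 0 := Complex.ofReal_ne_zero.2 hs
  obtain ⟨h1, h2⟩ := τ.cForm_field hX hq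
  refine sub_eq_zero.1 (τ.eq_zero_of_cForm hq ?_ ?_)
  · refine (map_sub _ _ _).trans ?_
    rw [cForm_Z_mfderiv_unwrap τ hx, map_smul, h2, τ.Z_unwrap hx, Complex.real_smul]
    push_cast
    field_simp
    simp
  · refine (map_sub _ _ _).trans ?_
    rw [cForm_W_mfderiv_unwrap τ hx, map_smul, h1, τ.W_unwrap hx, Complex.real_smul]
    push_cast
    field_simp
    simp

lemma hasMFDerivAt_unwrap_time (hX : TangentToFibers S X) (hX0 : ∀ p, X p ≠ 0) {z : ℂ}
    (hz : ‖z‖ < 1) (t : ℝ) :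
    HasMFDerivAt 𝓘(ℝ, ℝ) (𝓡 3) (fun s ↦ τ.unwrap (z, s)) t
      ((1 : ℝ →L[ℝ] ℝ).smulRight
        ((τ.speed X (τ.unwrap (z, t)))⁻¹ • X (τ.unwrap (z, t)))) := by
  have h1 : HasMFDerivAt 𝓘(ℝ, ℝ) 𝓘(ℝ, ℂ × ℝ) (fun s : ℝ ↦ (z, s)) t
      (ContinuousLinearMap.inr ℝ ℂ ℝ) := by
    refine hasMFDerivAt_iff_hasFDerivAt.2 ?_
    exact hasFDerivAt_prodMk_right z t
  refine ((τ.mdifferentiableAt_unwrap (x := (z, t)) hz).hasMFDerivAt.comp t h1).congr_mfderiv ?_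
  rw [← τ.mfderiv_unwrap_time hX hX0 (x := (z, t)) hz]
  refine ContinuousLinearMap.ext fun (s : ℝ) ↦ ?_
  have hs : ContinuousLinearMap.inr ℝ ℂ ℝ s = s • ((0, 1) : ℂ × ℝ) := by simp
  refine (congrArg (mfderiv 𝓘(ℝ, ℂ × ℝ) (𝓡 3) τ.unwrap (z, t)) hs).trans ?_
  exact map_smul (mfderiv 𝓘(ℝ, ℂ × ℝ) (𝓡 3) τ.unwrap (z, t)) _ _

/-- Differentiation along `X` in terms of the unwrapped fibers. -/
lemma cForm_field_of_hasDerivAt (hX : TangentToFibers S X) (hX0 : ∀ p, X p ≠ 0) {z : ℂ}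
    (hz : ‖z‖ < 1) {t : ℝ} {f : M → ℂ}
    (hf : MDifferentiableAt (𝓡 3) 𝓘(ℝ, ℂ) f (τ.unwrap (z, t))) {f' : ℂ}
    (h : HasDerivAt (fun s ↦ f (τ.unwrap (z, s))) f' t) :
    cForm f (τ.unwrap (z, t)) (X (τ.unwrap (z, t))) = τ.speed X (τ.unwrap (z, t)) * f' := by
  have h1 := hasDerivAt_cForm_comp hf (τ.hasMFDerivAt_unwrap_time hX hX0 hz t)
  rw [h.unique h1, map_smul, Complex.real_smul, Complex.ofReal_inv, mul_inv_cancel_left₀]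
  exact Complex.ofReal_ne_zero.2 (τ.speed_ne_zero hX hX0 (τ.unwrap_mem hz))

end FiberedTorusChart

end FieldsOnFiberedTori

/-! ### Constancy of the period of the flow -/

section Period

variable {M : Type*} [TopologicalSpace M] [ChartedSpace E3 M] [IsManifold (𝓡 3) ∞ M]

/-- Differentiating $\sigma(x+w)=\sigma(x)$ shows that $d\sigma$ is periodic. Pairing with $\alpha$
gives real numbers, since the tangent spaces at the two base points are different types. -/
lemma form_mfderiv_add_period (α : SmoothOneForm M) {N : Type*} [NormedAddCommGroup N]
    [NormedSpace ℝ N] {σ : N → M} {w : N} (hσ : ∀ x, σ (x + w) = σ x) {x : N}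
    (hd : MDifferentiableAt 𝓘(ℝ, N) (𝓡 3) σ (x + w)) (e : N) :
    α (σ (x + w)) (mfderiv 𝓘(ℝ, N) (𝓡 3) σ (x + w) e)
      = α (σ x) (mfderiv 𝓘(ℝ, N) (𝓡 3) σ x e) := by
  have h : ∀ σ' : N → M, σ' = σ → α (σ' x) (mfderiv 𝓘(ℝ, N) (𝓡 3) σ' x e)
      = α (σ x) (mfderiv 𝓘(ℝ, N) (𝓡 3) σ x e) := by
    rintro _ rfl; rfl
  rw [← h (σ ∘ fun y ↦ y + w) (funext hσ)]
  have h1 : HasMFDerivAt 𝓘(ℝ, N) 𝓘(ℝ, N) (fun y : N ↦ y + w) x (ContinuousLinearMap.id ℝ N) :=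
    hasMFDerivAt_iff_hasFDerivAt.2 ((hasFDerivAt_id x).add_const w)
  have h2 := (hd.hasMFDerivAt.comp x h1).mfderiv
  exact congrArg (α (σ (x + w))) (DFunLike.congr_fun h2 e).symm

namespace FiberedTorusChart

variable {S : SeifertFibration M} (τ : FiberedTorusChart S) {X : SmoothVectorField M}

/-- The time density of the flow of a vector field along the unwrapped fibers. -/
def timeDensity (X : SmoothVectorField M) (x : ℂ × ℝ) : ℝ := (τ.speed X (τ.unwrap x))⁻¹

lemma contDiffOn_timeDensity (hX : TangentToFibers S X) (hX0 : ∀ p, X p ≠ 0) :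
    ContDiffOn ℝ ∞ (τ.timeDensity X) {x | ‖x.1‖ < 1} := by
  rw [← contMDiffOn_iff_contDiffOn]
  have h := (τ.contMDiffOn_speed X).comp τ.contMDiffOn_unwrap fun x hx ↦ τ.unwrap_mem hx
  intro x hx
  have h1 : ContMDiffAt 𝓘(ℝ, ℝ) 𝓘(ℝ, ℝ) ∞ (fun y : ℝ ↦ y⁻¹) (τ.speed X (τ.unwrap x)) :=
    (contDiffAt_inv ℝ (τ.speed_ne_zero hX hX0 (τ.unwrap_mem hx))).contMDiffAt
  exact (h1.comp_contMDiffWithinAt x (h x hx))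

lemma timeDensity_ne_zero (hX : TangentToFibers S X) (hX0 : ∀ p, X p ≠ 0) {x : ℂ × ℝ}
    (hx : ‖x.1‖ < 1) : τ.timeDensity X x ≠ 0 :=
  inv_ne_zero (τ.speed_ne_zero hX hX0 (τ.unwrap_mem hx))

lemma continuous_timeDensity (hX : TangentToFibers S X) (hX0 : ∀ p, X p ≠ 0) {z : ℂ}
    (hz : ‖z‖ < 1) : Continuous fun t ↦ τ.timeDensity X (z, t) := by
  rw [← continuousOn_univ]
  exact (τ.contDiffOn_timeDensity hX hX0).continuousOn.comp (by fun_prop) fun t _ ↦ hz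

lemma timeDensity_add_two_pi (z : ℂ) (t : ℝ) :
    τ.timeDensity X (z, t + 2 * Real.pi) = τ.timeDensity X (z, t) := by
  rw [timeDensity, unwrap_add_two_pi, timeDensity]

/-- The time that the flow needs to traverse a fiber. -/
def period (X : SmoothVectorField M) (z : ℂ) : ℝ :=
  ∫ t in (0 : ℝ)..2 * Real.pi, τ.timeDensity X (z, t)

lemma domain_eq : {x : ℂ × ℝ | ‖x.1‖ < 1} = Metric.ball (0 : ℂ) 1 ×ˢ univ := by
  ext x; simp

lemma contDiffOn_period (hX : TangentToFibers S X) (hX0 : ∀ p, X p ≠ 0) :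
    ContDiffOn ℝ ∞ (τ.period X) (Metric.ball 0 1) := by
  have h := τ.contDiffOn_timeDensity hX hX0
  rw [domain_eq] at h
  exact contDiffOn_parametric_intervalIntegral (F := fun z t ↦ τ.timeDensity X (z, t))
    Metric.isOpen_ball h (by positivity)

lemma mdifferentiableAt_form_field (α : SmoothOneForm M) (q : M) :
    MDifferentiableAt (𝓡 3) 𝓘(ℝ, ℝ) (fun q ↦ α q (X q)) q :=
  (contMDiffAt_form_apply (α.smoothFormAt q) (X.smoothFieldAt q)).mdifferentiableAt (by simp)

/-- Invariance gives $X(\alpha(X))=\alpha([X,X])=0$, so $\alpha(X)$ is a first integral. -/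
lemma form_field_unwrap (hX : TangentToFibers S X) (hX0 : ∀ p, X p ≠ 0) {α : SmoothOneForm M}
    (hα : PreservesForm X α) {z : ℂ} (hz : ‖z‖ < 1) (t : ℝ) :
    α (τ.unwrap (z, t)) (X (τ.unwrap (z, t))) = α (τ.unwrap (z, 0)) (X (τ.unwrap (z, 0))) := by
  have h : ∀ t, HasDerivAt (fun t ↦ α (τ.unwrap (z, t)) (X (τ.unwrap (z, t)))) 0 t := by
    intro t
    have := hasDerivAt_dForm_comp (mdifferentiableAt_form_field (X := X) α (τ.unwrap (z, t)))
      (τ.hasMFDerivAt_unwrap_time hX hX0 hz t)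
    rwa [map_smul, hα.dForm_apply_self, smul_zero] at this
  exact is_const_of_deriv_eq_zero (fun t ↦ (h t).differentiableAt) (fun t ↦ (h t).deriv) t 0

/-- The function $t\mapsto\alpha(\partial_e\sigma)$ is $2\pi$-periodic and has derivative
$(\partial_e K)\,\alpha(X)$, where $\alpha(X)$ does not depend on $t$. Its increment over a period
is therefore both zero and $\alpha(X)\int_0^{2\pi}\partial_e K\,dt$, and that integral is the
derivative of the period. -/
lemma form_field_mul_fderiv_period (hX : TangentToFibers S X) (hX0 : ∀ p, X p ≠ 0)
    {α : SmoothOneForm M} (hα : PreservesForm X α) {z : ℂ} (hz : ‖z‖ < 1) (e : ℂ) :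
    fderiv ℝ (τ.period X) z e * α (τ.unwrap (z, 0)) (X (τ.unwrap (z, 0))) = 0 := by
  have hK := τ.contDiffOn_timeDensity hX hX0
  have hKd : ∀ x : ℂ × ℝ, ‖x.1‖ < 1 → DifferentiableAt ℝ (τ.timeDensity X) x := fun x hx ↦
    (hK.contDiffAt (isOpen_domain.mem_nhds hx)).differentiableAt (by simp)
  have hK' : ContinuousOn (fderiv ℝ (τ.timeDensity X)) {x | ‖x.1‖ < 1} :=
    hK.continuousOn_fderiv_of_isOpen isOpen_domain (by simp)
  let B : ℝ → ℝ := fun t ↦ fderiv ℝ (τ.timeDensity X) (z, t) (e, 0)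
  have hB : Continuous B := by
    rw [← continuousOn_univ]
    exact (hK'.comp (f := fun t : ℝ ↦ (z, t)) (by fun_prop) fun t _ ↦ hz).clm_apply
      continuousOn_const
  have h1 : ∀ t, HasDerivAt (fun t ↦ α (τ.unwrap (z, t))
      (mfderiv 𝓘(ℝ, ℂ × ℝ) (𝓡 3) τ.unwrap (z, t) ((e, 0) : ℂ × ℝ)))
      (B t * α (τ.unwrap (z, 0)) (X (τ.unwrap (z, 0)))) t := by
    intro t
    obtain ⟨h1, h2⟩ := hα.fderiv_form_comp (σ := τ.unwrap) (x := (z, t)) (t := ((0, 1) : ℂ × ℝ))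
      (τ.contMDiffOn_unwrap.contMDiffAt (isOpen_domain.mem_nhds hz)) (hKd (z, t) hz)
      (by
        filter_upwards [isOpen_domain.mem_nhds (x := ((z, t) : ℂ × ℝ)) hz] with y hy
        exact τ.mfderiv_unwrap_time hX hX0 hy) (e, 0)
    have h3 : HasDerivAt (fun s : ℝ ↦ ((z, s) : ℂ × ℝ)) (0, 1) t :=
      (hasDerivAt_const t z).prodMk (hasDerivAt_id t)
    have h4 := h1.comp_hasDerivAt t h3
    rw [h2, τ.form_field_unwrap hX hX0 hα hz t] at h4
    exact h4
  have h2 := intervalIntegral.integral_eq_sub_of_hasDerivAt (a := 0) (b := 2 * Real.pi)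
    (fun t _ ↦ h1 t) ((hB.mul continuous_const).intervalIntegrable _ _)
  have hper := form_mfderiv_add_period α (σ := τ.unwrap) (w := (0, 2 * Real.pi))
    (fun x ↦ by
      have := τ.unwrap_add_two_pi x.1 x.2
      rwa [show x + (0, 2 * Real.pi) = (x.1, x.2 + 2 * Real.pi) by ext <;> simp])
    (x := (z, 0)) (τ.mdifferentiableAt_unwrap (by simpa using hz)) (e, 0)
  rw [show ((z, 0) + (0, 2 * Real.pi) : ℂ × ℝ) = (z, 2 * Real.pi) by simp] at hper
  rw [hper, sub_self, intervalIntegral.integral_mul_const] at h2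
  -- Differentiation under the integral is carried out along the line $z+se$, reducing it to one
  -- real parameter.
  have hopen : IsOpen {s : ℝ | ‖z + s • e‖ < 1} := isOpen_lt (by fun_prop) continuous_const
  have h3 := hasDerivAt_parametric_intervalIntegral (s := {s : ℝ | ‖z + s • e‖ < 1})
    (F := fun s t ↦ τ.timeDensity X (z + s • e, t))
    (F' := fun s t ↦ fderiv ℝ (τ.timeDensity X) (z + s • e, t) (e, 0)) (x := 0) hopen
    (by simpa using hz) (fun y hy ↦ τ.continuous_timeDensity hX hX0 hy)
    ((hK'.comp (f := fun x : ℝ × ℝ ↦ (z + x.1 • e, x.2)) (by fun_prop) fun x hx ↦ hx.1).clm_apply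
      continuousOn_const)
    (fun y hy t ↦ by
      have h5 : HasDerivAt (fun s : ℝ ↦ ((z + s • e, t) : ℂ × ℝ)) (e, 0) y := by
        have := (((hasDerivAt_id y).smul_const e).const_add z).prodMk (hasDerivAt_const y t)
        simpa using this
      exact (hKd (z + y • e, t) hy).hasFDerivAt.comp_hasDerivAt y h5) 0 (2 * Real.pi)
  have h4 : HasDerivAt (fun s : ℝ ↦ τ.period X (z + s • e)) (fderiv ℝ (τ.period X) z e) 0 := by
    have hd : DifferentiableAt ℝ (τ.period X) (z + (0 : ℝ) • e) :=
      ((τ.contDiffOn_period hX hX0).contDiffAt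
        (Metric.isOpen_ball.mem_nhds (by simpa using hz))).differentiableAt (by simp)
    have h5 : HasDerivAt (fun s : ℝ ↦ z + s • e) e 0 := by
      have := ((hasDerivAt_id (0 : ℝ)).smul_const e).const_add z
      simpa using this
    have h6 := hd.hasFDerivAt.comp_hasDerivAt (0 : ℝ) h5
    rw [show z + (0 : ℝ) • e = z by simp] at h6
    exact h6
  have h5 := h4.unique h3
  rw [h5]
  simpa [B] using h2

/-- If the derivative were nonzero at $z$, it would be nonzero nearby by continuity, so $\alpha(X)$
would vanish on a neighbourhood. Then $\iota_X d\alpha=-d(\alpha(X))=0$ as well, and the contact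
condition would give $X=0$. -/
lemma fderiv_period_eq_zero (hX : TangentToFibers S X) (hX0 : ∀ p, X p ≠ 0)
    {α : SmoothOneForm M} (hc : IsContactForm α) (hα : PreservesForm X α) {z : ℂ}
    (hz : ‖z‖ < 1) : fderiv ℝ (τ.period X) z = 0 := by
  ext e
  by_contra hne
  have hz' : z ∈ Metric.ball (0 : ℂ) 1 := by simpa using hz
  have hcont : ContinuousAt (fun y ↦ fderiv ℝ (τ.period X) y e) z :=
    (((τ.contDiffOn_period hX hX0).continuousOn_fderiv_of_isOpen Metric.isOpen_ball
      (by simp)).continuousAt (Metric.isOpen_ball.mem_nhds hz')).clm_apply continuousAt_const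
  have hzero : (fun x : ℂ × ℝ ↦ α (τ.unwrap x) (X (τ.unwrap x))) =ᶠ[𝓝 (z, 0)] fun _ ↦ 0 := by
    have h1 : ∀ᶠ x : ℂ × ℝ in 𝓝 (z, 0), fderiv ℝ (τ.period X) x.1 e ≠ 0 :=
      (continuous_fst.tendsto (z, (0 : ℝ))).eventually (hcont.eventually_ne hne)
    filter_upwards [h1, isOpen_domain.mem_nhds (x := ((z, 0) : ℂ × ℝ)) hz] with x hx hx'
    rw [τ.form_field_unwrap hX hX0 hα hx' x.2]
    exact (mul_eq_zero.1 (τ.form_field_mul_fderiv_period hX hX0 hα hx' e)).resolve_left hx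
  have hd : ∀ v, dForm (fun q ↦ α q (X q)) (τ.unwrap (z, 0)) v = 0 := by
    intro v
    obtain ⟨w, rfl⟩ := τ.surjective_mfderiv_unwrap (x := (z, 0)) hz v
    have h1 := ((mdifferentiableAt_form_field (X := X) α (τ.unwrap (z, 0))).hasMFDerivAt.comp
      ((z, 0) : ℂ × ℝ) (τ.mdifferentiableAt_unwrap (x := (z, 0)) hz).hasMFDerivAt).mfderiv
    have h2 : mfderiv 𝓘(ℝ, ℂ × ℝ) 𝓘(ℝ, ℝ) ((fun q ↦ α q (X q)) ∘ τ.unwrap) (z, 0) = 0 :=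
      hzero.mfderiv_eq.trans mfderiv_const
    exact (DFunLike.congr_fun (h1.symm.trans h2) w)
  refine hX0 _ (hc.eq_zero hzero.self_of_nhds fun v ↦ ?_)
  rw [hα.oneFormExtDeriv_apply_left, hd, neg_zero]

/-- All the fibers have the same period. -/
lemma exists_period_eq (hX : TangentToFibers S X) (hX0 : ∀ p, X p ≠ 0)
    {α : SmoothOneForm M} (hc : IsContactForm α) (hα : PreservesForm X α) :
    ∃ c : ℝ, c ≠ 0 ∧ ∀ z : ℂ, ‖z‖ < 1 → τ.period X z = 2 * Real.pi * c := by
  have h0 : ‖(0 : ℂ)‖ < 1 := by simp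
  refine ⟨τ.period X 0 / (2 * Real.pi), ?_, fun z hz ↦ ?_⟩
  · refine div_ne_zero (fun h ↦ ?_) (by positivity)
    -- If the period were zero, Rolle's theorem for the primitive of the density would give a zero
    -- of the density. The sign of $c$ depends on the direction of $X$ and is irrelevant.
    have hc := τ.continuous_timeDensity hX hX0 h0
    have hF : ∀ x, HasDerivAt (fun x ↦ ∫ t in (0 : ℝ)..x, τ.timeDensity X (0, t))
        (τ.timeDensity X (0, x)) x := fun x ↦
      intervalIntegral.integral_hasDerivAt_right (hc.intervalIntegrable _ _)
        (hc.stronglyMeasurableAtFilter _ _) hc.continuousAt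
    obtain ⟨ξ, -, hξ⟩ := exists_hasDerivAt_eq_zero (a := 0) (b := 2 * Real.pi) (by positivity)
      (fun x _ ↦ (hF x).continuousAt.continuousWithinAt)
      (by simpa [period] using h.symm) (fun x _ ↦ hF x)
    exact τ.timeDensity_ne_zero hX hX0 h0 hξ
  · rw [mul_div_cancel₀ _ (by positivity)]
    refine Metric.isOpen_ball.is_const_of_fderiv_eq_zero (𝕜 := ℝ)
      (convex_ball (0 : ℂ) 1).isPreconnected
      ((τ.contDiffOn_period hX hX0).differentiableOn (by simp)) (fun z hz ↦ ?_)
      (by simpa using hz) (by simp)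
    exact τ.fderiv_period_eq_zero hX hX0 hc hα (by simpa using hz)

end FiberedTorusChart

end Period

/-! ### Correcting the parametrization, and cut-off functions of constant frequency -/

section Phase

variable {M : Type*} [TopologicalSpace M] [ChartedSpace E3 M] [IsManifold (𝓡 3) ∞ M]

/-- A first moment of a density of period `2π` over a moving period. -/
lemma hasDerivAt_moving_moment {K : ℝ → ℝ} (hK : Continuous K)
    (hper : ∀ t, K (t + 2 * Real.pi) = K t) (t : ℝ) :
    HasDerivAt (fun t ↦ ∫ s in (0 : ℝ)..2 * Real.pi, s * K (t + s))
      (2 * Real.pi * K t - ∫ s in (0 : ℝ)..2 * Real.pi, K s) t := by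
  -- The substitution $r=t+s$ moves the dependence on $t$ into the limits and a linear term. By
  -- periodicity, the integral of $K$ over $[t,t+2\pi]$ does not depend on $t$.
  have h1 : ∀ t, ∫ s in (0 : ℝ)..2 * Real.pi, s * K (t + s)
      = (∫ r in (0 : ℝ)..t + 2 * Real.pi, r * K r) - (∫ r in (0 : ℝ)..t, r * K r)
        - t * ∫ s in (0 : ℝ)..2 * Real.pi, K s := by
    intro t
    have hm : Continuous fun r ↦ r * K r := continuous_id.mul hK
    have hk : Continuous fun r ↦ t * K r := continuous_const.mul hK
    have h2 := intervalIntegral.integral_comp_add_left (a := 0) (b := 2 * Real.pi)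
      (fun r ↦ (r - t) * K r) t
    have h3 : ∫ s in (0 : ℝ)..2 * Real.pi, K s = ∫ s in t..t + 2 * Real.pi, K s := by
      have := (show Function.Periodic K (2 * Real.pi) from hper).intervalIntegral_add_eq 0 t
      rwa [zero_add] at this
    simp only [add_sub_cancel_left, add_zero] at h2
    rw [h2, h3, intervalIntegral.integral_interval_sub_left (hm.intervalIntegrable _ _)
      (hm.intervalIntegrable _ _), ← intervalIntegral.integral_const_mul,
      ← intervalIntegral.integral_sub (hm.intervalIntegrable _ _)
        (hk.intervalIntegrable _ _)]
    simp only [sub_mul]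
  have hm : Continuous fun r ↦ r * K r := continuous_id.mul hK
  have hF : ∀ x, HasDerivAt (fun x ↦ ∫ r in (0 : ℝ)..x, r * K r) (x * K x) x := fun x ↦
    intervalIntegral.integral_hasDerivAt_right (hm.intervalIntegrable _ _)
      (hm.stronglyMeasurableAtFilter _ _) hm.continuousAt
  rw [funext h1]
  have h4 := (((hF (t + 2 * Real.pi)).comp_add_const t (2 * Real.pi)).sub (hF t)).sub
    ((hasDerivAt_id t).mul_const (∫ s in (0 : ℝ)..2 * Real.pi, K s))
  rw [hper] at h4
  refine h4.congr_deriv ?_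
  ring

namespace FiberedTorusChart

variable {S : SeifertFibration M} (τ : FiberedTorusChart S) {X : SmoothVectorField M}

/-- A function on the solid torus measuring the defect of the flow from the circle action. -/
def phase (X : SmoothVectorField M) (q : M) : ℝ :=
  (∫ t in (0 : ℝ)..2 * Real.pi, t * (τ.speed X (τ.orbit q t))⁻¹) / (2 * Real.pi)

lemma orbit_mem {q : M} (hq : q ∈ τ.φ.source) (t : ℝ) : τ.orbit q t ∈ τ.φ.source := by
  obtain ⟨x, hx, rfl⟩ := τ.exists_unwrap_eq hq
  rw [τ.orbit_unwrap hx]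
  exact τ.unwrap_mem (x := (x.1, x.2 + t)) hx

lemma contMDiffOn_orbit {N : Type*} [NormedAddCommGroup N] [NormedSpace ℝ N] {ψ : N → M}
    {s : Set N} (hψ : ContMDiffOn 𝓘(ℝ, N) (𝓡 3) ∞ ψ s) (hs : ∀ y ∈ s, ψ y ∈ τ.φ.source) :
    ContMDiffOn 𝓘(ℝ, N × ℝ) (𝓡 3) ∞ (fun x : N × ℝ ↦ τ.orbit (ψ x.1) x.2) (s ×ˢ univ) := by
  have h0 : ContMDiffOn 𝓘(ℝ, N × ℝ) (𝓡 3) ∞ (fun x : N × ℝ ↦ ψ x.1) (s ×ˢ univ) :=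
    hψ.comp (contDiff_fst.contMDiff.contMDiffOn) fun x hx ↦ hx.1
  have hφ := τ.smooth.comp h0 fun x hx ↦ hs _ hx.1
  have h1 : ContMDiff 𝓘(ℝ, N × ℝ) (𝓡 1) ∞ (fun x : N × ℝ ↦ Circle.exp (τ.b * x.2)) :=
    contMDiff_circleExp.comp (by fun_prop : ContDiff ℝ ∞ fun x : N × ℝ ↦ τ.b * x.2).contMDiff
  have h2 : ContMDiff 𝓘(ℝ, N × ℝ) (𝓡 1) ∞ (fun x : N × ℝ ↦ Circle.exp (τ.a * x.2)) :=
    contMDiff_circleExp.comp (by fun_prop : ContDiff ℝ ∞ fun x : N × ℝ ↦ τ.a * x.2).contMDiff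
  have hZ : ContMDiffOn 𝓘(ℝ, N × ℝ) 𝓘(ℝ, ℂ) ∞ (fun x : N × ℝ ↦ (τ.φ (ψ x.1)).1) (s ×ˢ univ) :=
    contMDiff_fst.comp_contMDiffOn hφ
  have hW : ContMDiffOn 𝓘(ℝ, N × ℝ) (𝓡 1) ∞ (fun x : N × ℝ ↦ (τ.φ (ψ x.1)).2) (s ×ˢ univ) :=
    contMDiff_snd.comp_contMDiffOn hφ
  have h3 : ContMDiffOn 𝓘(ℝ, N × ℝ) 𝓘(ℝ, ℂ) ∞
      (fun x : N × ℝ ↦ (Circle.exp (τ.b * x.2) : ℂ) * (τ.φ (ψ x.1)).1) (s ×ˢ univ) :=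
    (contDiff_fst.mul contDiff_snd :
      ContDiff ℝ ∞ fun w : ℂ × ℂ ↦ w.1 * w.2).contMDiff.comp_contMDiffOn
      ((contMDiff_circle_coe.comp h1).contMDiffOn.prodMk_space hZ)
  refine τ.smooth_symm.comp (h3.prodMk (h2.contMDiffOn.mul hW)) fun x hx ↦ ?_
  exact (τ.mem_target_iff _).2 (by simpa [Z] using τ.norm_Z_lt (hs _ hx.1))

/-- The moment is taken along the orbit starting at $q$ itself. It thus needs no section of the
fibration and is smooth across the central fiber, even when that fiber is exceptional. -/
lemma contMDiffOn_phase (hX : TangentToFibers S X) (hX0 : ∀ p, X p ≠ 0) :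
    ContMDiffOn (𝓡 3) 𝓘(ℝ, ℝ) ∞ (τ.phase X) τ.φ.source := by
  intro q hq
  let s : Set E3 := (extChartAt (𝓡 3) q).target ∩ (extChartAt (𝓡 3) q).symm ⁻¹' τ.φ.source
  have hs : IsOpen s := (continuousOn_extChartAt_symm q).isOpen_inter_preimage
    (isOpen_extChartAt_target q) τ.φ.open_source
  have hψ : ContMDiffOn 𝓘(ℝ, E3) (𝓡 3) ∞ (extChartAt (𝓡 3) q).symm s :=
    (contMDiffOn_extChartAt_symm q).mono inter_subset_left
  have h1 := (τ.contMDiffOn_speed X).comp (τ.contMDiffOn_orbit hψ fun y hy ↦ hy.2)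
    fun x hx ↦ τ.orbit_mem hx.1.2 x.2
  have h2 : ContDiffOn ℝ ∞ (fun x : E3 × ℝ ↦ x.2 * (τ.speed X
      (τ.orbit ((extChartAt (𝓡 3) q).symm x.1) x.2))⁻¹) (s ×ˢ univ) := by
    refine contDiff_snd.contDiffOn.mul (ContDiffOn.inv (contMDiffOn_iff_contDiffOn.1 h1) ?_)
    exact fun x hx ↦ τ.speed_ne_zero hX hX0 (τ.orbit_mem hx.1.2 x.2)
  have h3 := contDiffOn_parametric_intervalIntegral (T := 2 * Real.pi)
    (F := fun (y : E3) (t : ℝ) ↦ t * (τ.speed X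
      (τ.orbit ((extChartAt (𝓡 3) q).symm y) t))⁻¹) hs h2 (by positivity)
  have hmem : extChartAt (𝓡 3) q q ∈ s :=
    ⟨mem_extChartAt_target q, by rw [mem_preimage, extChartAt_to_inv]; exact hq⟩
  have h4 := ((h3.contDiffAt (hs.mem_nhds hmem)).div_const (2 * Real.pi)).contMDiffAt.comp q
    (contMDiffAt_extChartAt (n := ∞))
  refine (h4.congr_of_eventuallyEq ?_).contMDiffWithinAt
  filter_upwards [extChartAt_source_mem_nhds (I := 𝓡 3) q] with x hx
  simp only [Function.comp_apply, (extChartAt (𝓡 3) q).left_inv hx, phase]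

/-- The moving moment has derivative $2\pi K-2\pi c$. Thus the phase measures how far the flow time
$\int K\,dt$ deviates from uniform growth at rate $c$. -/
lemma hasDerivAt_phase_unwrap (hX : TangentToFibers S X) (hX0 : ∀ p, X p ≠ 0) {c : ℝ}
    {z : ℂ} (hz : ‖z‖ < 1) (hc : τ.period X z = 2 * Real.pi * c) (t : ℝ) :
    HasDerivAt (fun t ↦ τ.phase X (τ.unwrap (z, t))) (τ.timeDensity X (z, t) - c) t := by
  have h := (hasDerivAt_moving_moment (τ.continuous_timeDensity hX hX0 hz)
    (τ.timeDensity_add_two_pi z) t).div_const (2 * Real.pi)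
  have hfun : (fun t ↦ τ.phase X (τ.unwrap (z, t)))
      = fun t ↦ (∫ s in (0 : ℝ)..2 * Real.pi, s * τ.timeDensity X (z, t + s)) / (2 * Real.pi) := by
    funext t
    simp only [phase, τ.orbit_unwrap (x := (z, t)) hz, timeDensity]
  rw [hfun]
  refine h.congr_deriv ?_
  rw [show (∫ s in (0 : ℝ)..2 * Real.pi, τ.timeDensity X (z, s)) = τ.period X z from rfl, hc]
  have := Real.pi_ne_zero
  field_simp

/-- A cutoff function on the disc. -/
def cutoff (z : ℂ) : ℝ := Real.smoothTransition (2 - 4 * Complex.normSq z)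

lemma contDiff_cutoff : ContDiff ℝ ∞ cutoff := by
  refine Real.smoothTransition.contDiff.comp ?_
  have : (fun z : ℂ ↦ 2 - 4 * Complex.normSq z) = fun z ↦ 2 - 4 * (z.re * z.re + z.im * z.im) := by
    funext z; rw [Complex.normSq_apply]
  rw [this]
  have h1 : ContDiff ℝ ∞ Complex.re := Complex.reCLM.contDiff
  have h2 : ContDiff ℝ ∞ Complex.im := Complex.imCLM.contDiff
  fun_prop

lemma cutoff_eq_one {z : ℂ} (hz : ‖z‖ ≤ 1 / 2) : cutoff z = 1 := by
  refine Real.smoothTransition.one_of_one_le ?_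
  rw [Complex.normSq_eq_norm_sq]
  nlinarith [norm_nonneg z]

lemma cutoff_eq_zero {z : ℂ} (hz : 3 / 4 ≤ ‖z‖) : cutoff z = 0 := by
  refine Real.smoothTransition.zero_of_nonpos ?_
  rw [Complex.normSq_eq_norm_sq]
  nlinarith

/-- The cutoff depends only on $|z|$, which the circle action preserves; multiplication by it
therefore keeps frequencies. -/
lemma cutoff_unwrap {z : ℂ} (hz : ‖z‖ < 1) (t : ℝ) :
    cutoff (τ.Z (τ.unwrap (z, t))) = cutoff z := by
  rw [τ.Z_unwrap (x := (z, t)) hz, cutoff, cutoff, Complex.normSq_eq_norm_sq,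
    Complex.normSq_eq_norm_sq, norm_mul]
  have : ‖Complex.exp (τ.b * ((z, t) : ℂ × ℝ).2 * Complex.I)‖ = 1 := by
    have := Complex.norm_exp_ofReal_mul_I (τ.b * t)
    push_cast at this
    exact this
  rw [this, one_mul]

/-- A function of weight `m` for the circle action, twisted to a function of constant frequency
along the flow, and cut off. -/
def equivariant (X : SmoothVectorField M) (V : M → ℂ) (l : ℝ) (q : M) : ℂ :=
  open Classical in
  if q ∈ τ.φ.source then
    cutoff (τ.Z q) * (V q * Complex.exp (l * τ.phase X q * Complex.I)) else 0

lemma equivariant_apply (V : M → ℂ) (l : ℝ) {q : M} (hq : q ∈ τ.φ.source) :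
    τ.equivariant X V l q
      = cutoff (τ.Z q) * (V q * Complex.exp (l * τ.phase X q * Complex.I)) :=
  if_pos hq

/-- The part of the solid torus with $|z|\le 3/4$ is compact, so its image is closed in the
Hausdorff space $M$. The function vanishes off this image, so extension by zero is smooth. -/
lemma equivariant_eventuallyEq_zero [T2Space M] (V : M → ℂ) (l : ℝ) {q : M}
    (hq : q ∉ τ.φ.source) : τ.equivariant X V l =ᶠ[𝓝 q] fun _ ↦ 0 := by
  let C : Set (ℂ × Circle) := Metric.closedBall 0 (3 / 4) ×ˢ univ
  have hCt : C ⊆ τ.φ.target := fun x hx ↦ (τ.mem_target_iff x).2 (by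
    have := hx.1
    rw [mem_closedBall_zero_iff] at this
    linarith)
  have hC : IsCompact (τ.φ.symm '' C) :=
    ((isCompact_closedBall _ _).prod isCompact_univ).image_of_continuousOn
      (τ.φ.continuousOn_symm.mono hCt)
  have hqC : q ∈ (τ.φ.symm '' C)ᶜ := by
    rintro ⟨x, hx, rfl⟩
    exact hq (τ.φ.map_target (hCt hx))
  filter_upwards [hC.isClosed.isOpen_compl.mem_nhds hqC] with x hx
  by_cases hxs : x ∈ τ.φ.source
  · rw [equivariant_apply τ V l hxs, cutoff_eq_zero, Complex.ofReal_zero, zero_mul]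
    by_contra h
    refine hx ⟨τ.φ x, ⟨?_, mem_univ _⟩, τ.φ.left_inv hxs⟩
    rw [mem_closedBall_zero_iff]
    exact (not_le.1 h).le
  · exact if_neg hxs

lemma contMDiff_equivariant [T2Space M] (hX : TangentToFibers S X) (hX0 : ∀ p, X p ≠ 0)
    {V : M → ℂ} (hV : ContMDiffOn (𝓡 3) 𝓘(ℝ, ℂ) ∞ V τ.φ.source) (l : ℝ) :
    ContMDiff (𝓡 3) 𝓘(ℝ, ℂ) ∞ (τ.equivariant X V l) := by
  intro q
  by_cases hq : q ∈ τ.φ.source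
  · have hn := τ.φ.open_source.mem_nhds hq
    have h1 := ((τ.contMDiffOn_Z.contMDiffAt hn).prodMk_space (hV.contMDiffAt hn)).prodMk_space
      ((τ.contMDiffOn_phase hX hX0).contMDiffAt hn)
    have h2 : ContDiff ℝ ∞ fun x : (ℂ × ℂ) × ℝ ↦
        (cutoff x.1.1 : ℂ) * (x.1.2 * Complex.exp (l * x.2 * Complex.I)) := by
      have h3 : ContDiff ℝ ∞ fun x : (ℂ × ℂ) × ℝ ↦ (cutoff x.1.1 : ℂ) :=
        Complex.ofRealCLM.contDiff.comp (contDiff_cutoff.comp contDiff_fst.fst)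
      have h4 : ContDiff ℝ ∞ fun x : (ℂ × ℂ) × ℝ ↦ (x.2 : ℂ) :=
        Complex.ofRealCLM.contDiff.comp contDiff_snd
      fun_prop
    refine (h2.contMDiff.contMDiffAt.comp q h1).congr_of_eventuallyEq ?_
    filter_upwards [hn] with x hx using τ.equivariant_apply V l hx
  · exact contMDiffAt_const.congr_of_eventuallyEq (τ.equivariant_eventuallyEq_zero V l hq)

/-- Along an unwrapped fiber the exponent is $i(mt+(m/c)u)$, whose derivative is
$i(m+(m/c)(K-c))=i(m/c)K$. Multiplying by the speed $1/K$ of $X$ leaves the constant $im/c$. -/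
lemma cForm_equivariant_field [T2Space M] (hX : TangentToFibers S X) (hX0 : ∀ p, X p ≠ 0)
    {V : M → ℂ} (hV : ContMDiffOn (𝓡 3) 𝓘(ℝ, ℂ) ∞ V τ.φ.source) {m : ℝ}
    (hVm : ∀ (z : ℂ) (t : ℝ), ‖z‖ < 1 →
      V (τ.unwrap (z, t)) = Complex.exp (m * t * Complex.I) * V (τ.unwrap (z, 0)))
    {c : ℝ} (hc0 : c ≠ 0) (hc : ∀ z : ℂ, ‖z‖ < 1 → τ.period X z = 2 * Real.pi * c) (q : M) :
    cForm (τ.equivariant X V (m / c)) q (X q)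
      = (m / c : ℝ) * Complex.I * τ.equivariant X V (m / c) q := by
  by_cases hq : q ∈ τ.φ.source
  · obtain ⟨⟨z, t⟩, hz, rfl⟩ := τ.exists_unwrap_eq hq
    have hz : ‖z‖ < 1 := hz
    have hd := ((τ.contMDiff_equivariant hX hX0 hV (m / c)) (τ.unwrap (z, t))).mdifferentiableAt
      (by simp)
    have hfun : (fun s ↦ τ.equivariant X V (m / c) (τ.unwrap (z, s))) = fun s : ℝ ↦
        (cutoff z * V (τ.unwrap (z, 0))) * Complex.exp
          ((m * s + (m / c : ℝ) * τ.phase X (τ.unwrap (z, s)) : ℝ) * Complex.I) := by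
      funext s
      rw [τ.equivariant_apply V _ (τ.unwrap_mem (x := (z, s)) hz), τ.cutoff_unwrap hz, hVm z s hz]
      push_cast
      rw [add_mul, Complex.exp_add]
      ring
    have h1 : HasDerivAt (fun s : ℝ ↦ m * s + m / c * τ.phase X (τ.unwrap (z, s)))
        (m / c * τ.timeDensity X (z, t)) t := by
      refine (((hasDerivAt_id t).const_mul m).add
        ((τ.hasDerivAt_phase_unwrap hX hX0 hz (hc z hz) t).const_mul (m / c))).congr_deriv ?_
      field_simp
      ring
    have h2 := ((h1.ofReal_comp.mul_const Complex.I).cexp).const_mul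
      (cutoff z * V (τ.unwrap (z, 0)))
    rw [← hfun] at h2
    rw [τ.cForm_field_of_hasDerivAt hX hX0 hz hd h2, congrFun hfun t, timeDensity]
    have := Complex.ofReal_ne_zero.2 (τ.speed_ne_zero hX hX0 hq)
    push_cast
    field_simp
  · have h := τ.equivariant_eventuallyEq_zero (X := X) V (m / c) hq
    rw [h.self_of_nhds, mul_zero]
    exact DFunLike.congr_fun (h.mfderiv_eq.trans mfderiv_const) (X q)

end FiberedTorusChart

end Phase

/-! ### A finite family of eigenfunctions separating tangent vectors -/

section EquivariantFunctions

variable {M : Type*} [TopologicalSpace M] [ChartedSpace E3 M] [IsManifold (𝓡 3) ∞ M]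

lemma cForm_mul_exp {V : M → ℂ} {u : M → ℝ} {q : M} (l : ℝ)
    (hV : MDifferentiableAt (𝓡 3) 𝓘(ℝ, ℂ) V q) (hu : MDifferentiableAt (𝓡 3) 𝓘(ℝ, ℝ) u q)
    (v : TangentSpace (𝓡 3) q) :
    cForm (fun q ↦ V q * Complex.exp (l * u q * Complex.I)) q v
      = (cForm V q v + l * dForm u q v * Complex.I * V q) * Complex.exp (l * u q * Complex.I) := by
  let G : ℂ × ℝ → ℂ := fun x ↦ x.1 * Complex.exp (l * x.2 * Complex.I)
  have h1 : HasFDerivAt (fun x : ℂ × ℝ ↦ (x.2 : ℂ))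
      (Complex.ofRealCLM.comp (ContinuousLinearMap.snd ℝ ℂ ℝ)) (V q, u q) :=
    Complex.ofRealCLM.hasFDerivAt.comp _ hasFDerivAt_snd
  have h2 := (hasFDerivAt_fst (𝕜 := ℝ) (p := (V q, u q))).mul
    (((h1.const_mul (l : ℂ)).mul_const Complex.I).cexp)
  have h3 : HasMFDerivAt 𝓘(ℝ, ℂ × ℝ) 𝓘(ℝ, ℂ) G (V q, u q) _ := hasMFDerivAt_iff_hasFDerivAt.2 h2
  have hVu : HasMFDerivAt (𝓡 3) 𝓘(ℝ, ℂ × ℝ) (fun q ↦ (V q, u q)) q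
      ((cForm V q).prod (dForm u q)) :=
    ⟨hV.hasMFDerivAt.1.prodMk hu.hasMFDerivAt.1, hV.hasMFDerivAt.2.prodMk hu.hasMFDerivAt.2⟩
  have h4 := DFunLike.congr_fun (h3.comp q hVu).mfderiv v
  refine h4.trans ?_
  have h5 : ∀ (x : ℂ) (y : ℝ), (V q • Complex.exp (l * u q * Complex.I) •
        Complex.I • (l : ℂ) • Complex.ofRealCLM.comp (ContinuousLinearMap.snd ℝ ℂ ℝ)
      + Complex.exp (l * u q * Complex.I) • ContinuousLinearMap.fst ℝ ℂ ℝ :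
        ℂ × ℝ →L[ℝ] ℂ) (x, y)
      = (x + l * y * Complex.I * V q) * Complex.exp (l * u q * Complex.I) := by
    intro x y
    simp
    ring
  exact h5 _ _

namespace FiberedTorusChart

variable {S : SeifertFibration M} (τ : FiberedTorusChart S) {X : SmoothVectorField M}

lemma cForm_equivariant (hX : TangentToFibers S X) (hX0 : ∀ p, X p ≠ 0) {V : M → ℂ}
    (hV : ContMDiffOn (𝓡 3) 𝓘(ℝ, ℂ) ∞ V τ.φ.source) (l : ℝ) {q : M} (hq : q ∈ τ.φ.source)
    (hZ : ‖τ.Z q‖ < 1 / 2) (v : TangentSpace (𝓡 3) q) :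
    cForm (τ.equivariant X V l) q v
      = (cForm V q v + l * dForm (τ.phase X) q v * Complex.I * V q)
        * Complex.exp (l * τ.phase X q * Complex.I) := by
  have hn := τ.φ.open_source.mem_nhds hq
  rw [← cForm_mul_exp l ((hV.contMDiffAt hn).mdifferentiableAt (by simp))
    (((τ.contMDiffOn_phase hX hX0).contMDiffAt hn).mdifferentiableAt (by simp))]
  have hZc : ContinuousAt (fun x ↦ ‖τ.Z x‖) q := (τ.contMDiffOn_Z.continuousOn.continuousAt hn).norm
  have h : τ.equivariant X V l
      =ᶠ[𝓝 q] fun x ↦ V x * Complex.exp (l * τ.phase X x * Complex.I) := by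
    filter_upwards [hn, hZc.eventually (gt_mem_nhds hZ)] with x hx hxZ
    rw [τ.equivariant_apply V l hx, cutoff_eq_one hxZ.le, Complex.ofReal_one, one_mul]
  have h' : cForm (τ.equivariant X V l) q
      = cForm (fun x ↦ V x * Complex.exp (l * τ.phase X x * Complex.I)) q := h.mfderiv_eq
  rw [h']

/-- The phase factor could spoil the injectivity of $(dZ,dW)$ only in the fiber direction. If both
twisted differentials kill $v$, comparison with $dZ(X)$ and $dW(X)$ gives $v=-sX$; the twisted $W$
is an eigenfunction of nonzero frequency $a/c$ and does not vanish here, so $s=0$. -/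
lemma eq_zero_of_cForm_equivariant [T2Space M] (hX : TangentToFibers S X) (hX0 : ∀ p, X p ≠ 0)
    {c : ℝ} (hc0 : c ≠ 0) {q : M} (hq : q ∈ τ.φ.source) (hZ : ‖τ.Z q‖ < 1 / 2)
    {v : TangentSpace (𝓡 3) q} (h1 : cForm (τ.equivariant X τ.W (τ.a / c)) q v = 0)
    (h2 : cForm (τ.equivariant X τ.Z (τ.b / c)) q v = 0)
    (h3 : cForm (τ.equivariant X τ.W (τ.a / c)) q (X q)
      = (τ.a / c : ℝ) * Complex.I * τ.equivariant X τ.W (τ.a / c) q) : v = 0 := by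
  have hs := τ.speed_ne_zero hX hX0 hq
  obtain ⟨hW', hZ'⟩ := τ.cForm_field hX hq
  have h1' := h1
  rw [τ.cForm_equivariant hX hX0 τ.contMDiffOn_W _ hq hZ] at h1
  rw [τ.cForm_equivariant hX hX0 τ.contMDiffOn_Z _ hq hZ] at h2
  have h1 := (mul_eq_zero.1 h1).resolve_right (Complex.exp_ne_zero _)
  have h2 := (mul_eq_zero.1 h2).resolve_right (Complex.exp_ne_zero _)
  set s : ℝ := dForm (τ.phase X) q v / (c * τ.speed X q) with hsdef
  have hcs : (c : ℂ) ≠ 0 := Complex.ofReal_ne_zero.2 hc0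
  have hss : (τ.speed X q : ℂ) ≠ 0 := Complex.ofReal_ne_zero.2 hs
  have hv : v + s • X q = 0 := by
    refine τ.eq_zero_of_cForm hq ?_ ?_
    · rw [map_add, map_smul, hZ', eq_neg_of_add_eq_zero_left h2, hsdef, Complex.real_smul]
      push_cast
      field_simp
      ring
    · rw [map_add, map_smul, hW', eq_neg_of_add_eq_zero_left h1, hsdef, Complex.real_smul]
      push_cast
      field_simp
      ring
  have hv' : v = -s • X q := by rw [neg_smul]; exact eq_neg_of_add_eq_zero_left hv
  rw [hv', map_smul, h3, τ.equivariant_apply _ _ hq, cutoff_eq_one hZ.le] at h1'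
  have hW0 : τ.W q ≠ 0 := fun h ↦ by simpa [h] using τ.norm_W q
  have hs0 : s = 0 := by
    simpa [hW0, Complex.exp_ne_zero, hc0, τ.a_pos.ne'] using h1'
  rw [hv', hs0, neg_zero, zero_smul]

end FiberedTorusChart

/-- In a torus centered on the fiber through $p$, the coordinates $W$ and $Z$ have weights $a$ and
$b$. The separating neighbourhood is the part $|z|<1/2$, where the cutoff is $1$. -/
lemma exists_local_eigenfunctions [T2Space M] {S : SeifertFibration M} {X : SmoothVectorField M}
    (hX : TangentToFibers S X) (hX0 : ∀ p, X p ≠ 0) {α : SmoothOneForm M} (hc : IsContactForm α)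
    (hα : PreservesForm X α) (p : M) :
    ∃ O : Set M, IsOpen O ∧ p ∈ O ∧ ∃ (l : Fin 2 → ℝ) (F : Fin 2 → M → ℂ),
      (∀ i, ContMDiff (𝓡 3) 𝓘(ℝ, ℂ) ∞ (F i)) ∧
      (∀ i q, cForm (F i) q (X q) = l i * Complex.I * F i q) ∧
      ∀ q ∈ O, ∀ v, (∀ i, cForm (F i) q v = 0) → v = 0 := by
  obtain ⟨τ, hp, hp0⟩ := S.exists_fiberedTorusChart p
  obtain ⟨c, hc0, hper⟩ := τ.exists_period_eq hX hX0 hc hα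
  have hW : ∀ q, cForm (τ.equivariant X τ.W (τ.a / c)) q (X q)
      = (τ.a / c : ℝ) * Complex.I * τ.equivariant X τ.W (τ.a / c) q :=
    τ.cForm_equivariant_field hX hX0 τ.contMDiffOn_W (fun z t hz ↦ by
      rw [τ.W_unwrap (x := (z, t)) hz, τ.W_unwrap (x := (z, 0)) hz]
      simp) hc0 hper
  have hZ : ∀ q, cForm (τ.equivariant X τ.Z (τ.b / c)) q (X q)
      = (τ.b / c : ℝ) * Complex.I * τ.equivariant X τ.Z (τ.b / c) q :=
    τ.cForm_equivariant_field hX hX0 τ.contMDiffOn_Z (fun z t hz ↦ by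
      rw [τ.Z_unwrap (x := (z, t)) hz, τ.Z_unwrap (x := (z, 0)) hz]
      simp) hc0 hper
  refine ⟨τ.φ.source ∩ τ.Z ⁻¹' Metric.ball 0 (1 / 2),
    τ.contMDiffOn_Z.continuousOn.isOpen_inter_preimage τ.φ.open_source Metric.isOpen_ball,
    ⟨hp, ?_⟩, ![τ.a / c, τ.b / c],
    ![τ.equivariant X τ.W (τ.a / c), τ.equivariant X τ.Z (τ.b / c)], ?_, ?_, ?_⟩
  · rw [mem_preimage, FiberedTorusChart.Z, hp0]
    simp
  · rw [Fin.forall_fin_two]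
    exact ⟨τ.contMDiff_equivariant hX hX0 τ.contMDiffOn_W _,
      τ.contMDiff_equivariant hX hX0 τ.contMDiffOn_Z _⟩
  · rw [Fin.forall_fin_two]
    exact ⟨hW, hZ⟩
  · intro q hq v hv
    rw [Fin.forall_fin_two] at hv
    exact τ.eq_zero_of_cForm_equivariant hX hX0 hc0 hq.1 (by simpa using hq.2) hv.1 hv.2 (hW q)

/-- There are finitely many functions on which the flow acts by rotations and whose differentials
separate tangent vectors. -/
theorem exists_eigenfunctions [T2Space M] [CompactSpace M] {S : SeifertFibration M}
    {X : SmoothVectorField M} (hX : TangentToFibers S X) (hX0 : ∀ p, X p ≠ 0)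
    {α : SmoothOneForm M} (hc : IsContactForm α) (hα : PreservesForm X α) :
    ∃ (t : Finset (M × Fin 2)) (l : M × Fin 2 → ℝ) (a b : M × Fin 2 → M → ℝ),
      (∀ i, ContMDiff (𝓡 3) 𝓘(ℝ, ℝ) ∞ (a i)) ∧ (∀ i, ContMDiff (𝓡 3) 𝓘(ℝ, ℝ) ∞ (b i)) ∧
      (∀ i q, dForm (a i) q (X q) = -l i * b i q) ∧ (∀ i q, dForm (b i) q (X q) = l i * a i q) ∧
      ∀ q v, (∀ i ∈ t, dForm (a i) q v = 0 ∧ dForm (b i) q v = 0) → v = 0 := by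
  choose O hO hpO l F hF hFX hinj using exists_local_eigenfunctions hX hX0 hc hα
  obtain ⟨t, ht⟩ := isCompact_univ.elim_finite_subcover O hO
    fun p _ ↦ mem_iUnion.2 ⟨p, hpO p⟩
  have hd : ∀ x i q, MDifferentiableAt (𝓡 3) 𝓘(ℝ, ℂ) (F x i) q := fun x i q ↦
    (hF x i q).mdifferentiableAt (by simp)
  refine ⟨t ×ˢ Finset.univ, fun x ↦ l x.1 x.2, fun x q ↦ (F x.1 x.2 q).re,
    fun x q ↦ (F x.1 x.2 q).im, fun i ↦ ?_, fun i ↦ ?_, fun i q ↦ ?_, fun i q ↦ ?_,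
    fun q v hv ↦ ?_⟩
  · exact Complex.reCLM.contDiff.contMDiff.comp (hF _ _)
  · exact Complex.imCLM.contDiff.contMDiff.comp (hF _ _)
  · rw [dForm_re (hd _ _ _), hFX]
    simp
  · rw [dForm_im (hd _ _ _), hFX]
    simp
  · obtain ⟨x, hx, hq⟩ := mem_iUnion₂.1 (ht (mem_univ q))
    refine hinj x q hq v fun i ↦ ?_
    obtain ⟨h1, h2⟩ := hv (x, i) (by simpa using hx)
    rw [dForm_re (hd _ _ _)] at h1
    rw [dForm_im (hd _ _ _)] at h2
    exact Complex.ext h1 h2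

end EquivariantFunctions

/-! ### Metrics from positive forms, and Gram determinants -/

section Metrics

variable {M : Type*} [TopologicalSpace M] [ChartedSpace E3 M] [IsManifold (𝓡 3) ∞ M]

/-- By compactness the form has a positive minimum $m$ on the unit sphere, so its unit ball
satisfies $\|v\|^2\le m^{-1}$. -/
lemma isVonNBounded_of_pos {E : Type*} [NormedAddCommGroup E] [NormedSpace ℝ E]
    [FiniteDimensional ℝ E] (B : E →L[ℝ] E →L[ℝ] ℝ) (hB : ∀ v, v ≠ 0 → 0 < B v v) :
    Bornology.IsVonNBounded ℝ {v | B v v < 1} := by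
  refine NormedSpace.isVonNBounded_of_isBounded ℝ ?_
  have hc : Continuous fun v ↦ B v v := B.continuous.clm_apply continuous_id
  obtain hs | hs := (Metric.sphere (0 : E) 1).eq_empty_or_nonempty
  · refine (Bornology.isBounded_singleton (x := (0 : E))).subset fun v _ ↦ ?_
    by_contra hv
    have hv' : ‖v‖ ≠ 0 := norm_ne_zero_iff.2 hv
    have : ‖v‖⁻¹ • v ∈ Metric.sphere (0 : E) 1 := by
      rw [mem_sphere_zero_iff_norm, norm_smul, norm_inv, norm_norm, inv_mul_cancel₀ hv']
    rw [hs] at this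
    exact this
  · obtain ⟨w, hw, hmin⟩ := (isCompact_sphere (0 : E) 1).exists_isMinOn hs hc.continuousOn
    have hw1 : ‖w‖ = 1 := by simpa using hw
    have hm : 0 < B w w := hB w fun h ↦ by simp [h] at hw1
    -- This radius avoids a square root: $2\|v\|\le 1+\|v\|^2\le 1+m^{-1}$.
    refine (Metric.isBounded_closedBall (x := (0 : E)) (r := 1 + (B w w)⁻¹)).subset fun v hv ↦ ?_
    rw [mem_closedBall_zero_iff]
    obtain rfl | hv0 := eq_or_ne v 0
    · rw [norm_zero]; positivity
    have hv' : 0 < ‖v‖ := norm_pos_iff.2 hv0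
    have h1 : B w w ≤ B (‖v‖⁻¹ • v) (‖v‖⁻¹ • v) := hmin (by
      rw [mem_sphere_zero_iff_norm, norm_smul, norm_inv, norm_norm, inv_mul_cancel₀ hv'.ne'])
    have hv1 : B v v < 1 := hv
    simp only [map_smul, smul_apply, smul_eq_mul] at h1
    have h2 : B w w * ‖v‖ ^ 2 ≤ B v v := by
      calc B w w * ‖v‖ ^ 2 ≤ (‖v‖⁻¹ * (‖v‖⁻¹ * B v v)) * ‖v‖ ^ 2 := by gcongr
        _ = B v v := by field_simp
    have h3 : ‖v‖ ^ 2 ≤ (B w w)⁻¹ := by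
      rw [← one_div, le_div_iff₀ hm]
      linarith
    nlinarith [sq_nonneg (‖v‖ - 1), inv_pos.2 hm]

/-- A smooth field of positive definite symmetric bilinear forms is a Riemannian metric. -/
def metricOfPos (B : ∀ q : M, TangentSpace (𝓡 3) q →L[ℝ] TangentSpace (𝓡 3) q →L[ℝ] ℝ)
    (hsymm : ∀ q v w, B q v w = B q w v) (hpos : ∀ q v, v ≠ 0 → 0 < B q v v)
    (hsmooth : ContMDiff (𝓡 3) ((𝓡 3).prod 𝓘(ℝ, E3 →L[ℝ] E3 →L[ℝ] ℝ)) ∞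
      (fun q ↦ TotalSpace.mk' (E3 →L[ℝ] E3 →L[ℝ] ℝ)
        (E := fun q : M ↦ TangentSpace (𝓡 3) q →L[ℝ] TangentSpace (𝓡 3) q →L[ℝ] ℝ) q (B q))) :
    SmoothMetric M where
  inner := B
  symm := hsymm
  pos := hpos
  isVonNBounded q := isVonNBounded_of_pos (show E3 →L[ℝ] E3 →L[ℝ] ℝ from B q) (hpos q)
  contMDiff := hsmooth

lemma contMDiffAt_metric (g : SmoothMetric M) {Y Z : ∀ q : M, TangentSpace (𝓡 3) q} {p : M}
    (hY : SmoothFieldAt Y p) (hZ : SmoothFieldAt Z p) :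
    ContMDiffAt (𝓡 3) 𝓘(ℝ, ℝ) ∞ (fun q ↦ g.inner q (Y q) (Z q)) p := by
  have h := ContMDiffAt.clm_bundle_apply₂ (E₃ := Bundle.Trivial M ℝ) (F₃ := ℝ)
    (g.contMDiff p) hY hZ
  exact ((contMDiffAt_section (F := ℝ) (E := Bundle.Trivial M ℝ) _).1 h)

/-- The metric at a point as a bilinear form. -/
def metricBilin (g : SmoothMetric M) (p : M) : LinearMap.BilinForm ℝ (TangentSpace (𝓡 3) p) :=
  LinearMap.mk₂ ℝ (fun u v ↦ g.inner p u v) (fun u u' v ↦ by simp) (fun c u v ↦ by simp)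
    (fun u v v' ↦ by simp) (fun c u v ↦ by simp)

/-- The Gram determinant. -/
def gramDet (g : SmoothMetric M) (p : M) (s : Fin 3 → TangentSpace (𝓡 3) p) : ℝ :=
  (Matrix.of fun i j ↦ g.inner p (s i) (s j)).det

lemma gramDet_basis (g : SmoothMetric M) (p : M)
    (b c : Module.Basis (Fin 3) ℝ (TangentSpace (𝓡 3) p)) :
    gramDet g p c = b.det c ^ 2 * gramDet g p b := by
  have h : ∀ b : Module.Basis (Fin 3) ℝ (TangentSpace (𝓡 3) p),
      (Matrix.of fun i j ↦ g.inner p (b i) (b j))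
        = LinearMap.BilinForm.toMatrix b (metricBilin g p) := fun b ↦ by
    ext i j
    rw [LinearMap.BilinForm.toMatrix_apply]
    rfl
  rw [gramDet, gramDet, h, h,
    ← LinearMap.BilinForm.toMatrix_mul_basis_toMatrix b c, Matrix.det_mul, Matrix.det_mul,
    Matrix.det_transpose, Module.Basis.det_apply]
  ring

lemma gramDet_pos (g : SmoothMetric M) (p : M)
    (b : Module.Basis (Fin 3) ℝ (TangentSpace (𝓡 3) p)) : 0 < gramDet g p b := by
  refine Matrix.PosDef.det_pos (Matrix.PosDef.of_dotProduct_mulVec_pos ?_ fun x hx ↦ ?_)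
  · ext i j
    exact g.symm p _ _
  · have h : star x ⬝ᵥ (Matrix.of fun i j ↦ g.inner p (b i) (b j)).mulVec x
        = g.inner p (∑ i, x i • b i) (∑ i, x i • b i) := by
      simp only [dotProduct, Matrix.mulVec, Fin.sum_univ_three, map_add, map_smul, smul_apply,
        add_apply, smul_eq_mul, Matrix.of_apply, Pi.star_apply, star_trivial]
      ring
    rw [h]
    refine g.pos p _ fun h0 ↦ hx ?_
    funext i
    exact Fintype.linearIndependent_iff.1 b.linearIndependent x h0 i

lemma contMDiffAt_gramDet (g : SmoothMetric M) {s : Fin 3 → ∀ q : M, TangentSpace (𝓡 3) q}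
    {p : M} (hs : ∀ i, SmoothFieldAt (s i) p) :
    ContMDiffAt (𝓡 3) 𝓘(ℝ, ℝ) ∞ (fun q ↦ gramDet g q fun i ↦ s i q) p := by
  have h : ∀ i j, ContMDiffAt (𝓡 3) 𝓘(ℝ, ℝ) ∞ (fun q ↦ g.inner q (s i q) (s j q)) p :=
    fun i j ↦ contMDiffAt_metric g (hs i) (hs j)
  simp only [gramDet, Matrix.det_fin_three, Matrix.of_apply]
  exact (((((((h 0 0).mul (h 1 1)).mul (h 2 2)).sub (((h 0 0).mul (h 1 2)).mul (h 2 1))).sub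
    (((h 0 1).mul (h 1 0)).mul (h 2 2))).add (((h 0 1).mul (h 1 2)).mul (h 2 0))).add
    (((h 0 2).mul (h 1 0)).mul (h 2 1))).sub (((h 0 2).mul (h 1 1)).mul (h 2 0))

end Metrics

/-! ### Comparing $\alpha\wedge d\alpha$ with the Riemannian volume -/

section ContactDensity

variable {M : Type*} [TopologicalSpace M] [ChartedSpace E3 M] [IsManifold (𝓡 3) ∞ M]

lemma contactVol_eq_det_mul (α : SmoothOneForm M) (p : M)
    (b : Module.Basis (Fin 3) ℝ (TangentSpace (𝓡 3) p)) (u : Fin 3 → TangentSpace (𝓡 3) p) :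
    contactVol α p (u 0) (u 1) (u 2) = b.det u * contactVol α p (b 0) (b 1) (b 2) :=
  wedgeOneTwo_eq_det_mul _ (extDerivBilin_swap α p) b u

/-- The square of the ratio of `α ∧ dα` and the Riemannian volume. -/
def contactDensity (g : SmoothMetric M) (α : SmoothOneForm M) (p : M) : ℝ :=
  let b : Module.Basis (Fin 3) ℝ (TangentSpace (𝓡 3) p) :=
    (EuclideanSpace.basisFun (Fin 3) ℝ).toBasis
  contactVol α p (b 0) (b 1) (b 2) ^ 2 / gramDet g p b

/-- Under a change of basis the squared volume and the Gram determinant both scale by the square of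
the determinant. The density may thus be computed in a smooth frame (for smoothness) or in an
orthonormal basis (for its value). -/
lemma contactDensity_eq (g : SmoothMetric M) (α : SmoothOneForm M) (p : M)
    (b : Module.Basis (Fin 3) ℝ (TangentSpace (𝓡 3) p)) :
    contactDensity g α p = contactVol α p (b 0) (b 1) (b 2) ^ 2 / gramDet g p b := by
  rw [contactDensity]
  set c : Module.Basis (Fin 3) ℝ (TangentSpace (𝓡 3) p) :=
    (EuclideanSpace.basisFun (Fin 3) ℝ).toBasis
  have h1 : b.det c ≠ 0 := (b.isUnit_det c).ne_zero
  have h2 := (gramDet_pos g p b).ne'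
  rw [gramDet_basis g p b c, contactVol_eq_det_mul α p b c]
  field_simp

lemma contactDensity_pos (g : SmoothMetric M) {α : SmoothOneForm M} (hα : IsContactForm α)
    (p : M) : 0 < contactDensity g α p := by
  obtain ⟨U, -, hpU, s, -, hs⟩ := exists_smooth_frame p
  obtain ⟨b, -⟩ := hs p hpU
  rw [contactDensity_eq g α p b]
  have := hα.contactVol_ne_zero b
  have := gramDet_pos g p b
  positivity

lemma contMDiff_contactDensity (g : SmoothMetric M) (α : SmoothOneForm M) :
    ContMDiff (𝓡 3) 𝓘(ℝ, ℝ) ∞ (contactDensity g α) := by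
  intro p
  obtain ⟨U, hU, hpU, s, hsU, hs⟩ := exists_smooth_frame p
  have h1 : ContMDiffAt (𝓡 3) 𝓘(ℝ, ℝ) ∞ (fun q ↦ contactVol α q (s 0 q) (s 1 q) (s 2 q)) p :=
    contMDiffAt_contactVol α fun i ↦ Filter.mem_of_superset (hU.mem_nhds hpU) (hsU i)
  have h2 := contMDiffAt_gramDet g (s := s) fun i ↦ hsU i p hpU
  have h3 : gramDet g p (fun i ↦ s i p) ≠ 0 := by
    obtain ⟨b, hb⟩ := hs p hpU
    rw [← funext hb]
    exact (gramDet_pos g p b).ne'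
  refine ((h1.pow 2).div₀ h2 h3).congr_of_eventuallyEq ?_
  filter_upwards [hU.mem_nhds hpU] with q hq
  obtain ⟨b, hb⟩ := hs q hq
  rw [contactDensity_eq g α q b]
  simp only [hb, funext hb, Pi.div_apply]

/-- The value of `α ∧ dα` on a continuous frame is continuous. -/
lemma continuousAt_contactVol (α : SmoothOneForm M) {s : Fin 3 → ∀ q : M, TangentSpace (𝓡 3) q}
    {p : M} (hs : ∀ i, ContinuousAt (fun q ↦ TotalSpace.mk' E3 q (s i q)) p) :
    ContinuousAt (fun q ↦ contactVol α q (s 0 q) (s 1 q) (s 2 q)) p := by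
  -- The frames of an orientation are only continuous, so $d\alpha$ is evaluated on a smooth frame,
  -- and the given frame enters through its determinant, which is continuous.
  let e := trivializationAt E3 (TangentSpace (𝓡 3) : M → Type _) p
  let b := (EuclideanSpace.basisFun (Fin 3) ℝ).toBasis
  have hpe : p ∈ e.baseSet := FiberBundle.mem_baseSet_trivializationAt' p
  have hn := e.open_baseSet.mem_nhds hpe
  have hc : ContinuousAt
      (fun q ↦ contactVol α q (e.localFrame b 0 q) (e.localFrame b 1 q) (e.localFrame b 2 q)) p := by
    refine (contMDiffAt_contactVol α (s := e.localFrame b) fun i ↦ ?_).continuousAt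
    have h := Bundle.Trivialization.isLocalFrameOn_localFrame_baseSet (𝓡 3) ∞ e b
    filter_upwards [hn] with q hq using h.contMDiffAt e.open_baseSet hq i
  have hcoord : ∀ i, ContinuousAt (fun q ↦ (e ⟨q, s i q⟩).2) p := fun i ↦
    ((FiberBundle.continuousAt_totalSpace _ _).1 (hs i)).2
  have hdet : ContinuousAt (fun q ↦ b.det fun i ↦ (e ⟨q, s i q⟩).2) p := by
    have h1 : ContinuousAt (fun q ↦ fun i ↦ (e ⟨q, s i q⟩).2) p := continuousAt_pi.2 hcoord
    have h2 : Continuous fun u : Fin 3 → E3 ↦ b.det u := by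
      simp only [Module.Basis.det_apply]
      refine Continuous.matrix_det ?_
      refine continuous_matrix fun i j ↦ ?_
      simp only [Module.Basis.toMatrix_apply]
      exact (LinearMap.continuous_of_finiteDimensional (b.coord i)).comp (continuous_apply j)
    exact h2.continuousAt.comp h1
  refine (hdet.mul hc).congr ?_
  filter_upwards [hn] with q hq
  rw [contactVol_eq_det_mul α q (e.basisAt b hq) (fun i ↦ s i q)]
  have hf : ∀ i, e.localFrame b i q = e.basisAt b hq i := fun i ↦
    e.localFrame_apply_of_mem_baseSet b hq
  rw [Pi.mul_apply, hf, hf, hf]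
  congr 1

end ContactDensity

/-! ### Metrics dual to the Reeb field are adapted -/

section Adapted

variable {M : Type*} [TopologicalSpace M] [ChartedSpace E3 M] [IsManifold (𝓡 3) ∞ M]

/-- `α ∧ dα` is positive for the given orientation. -/
def IsPositiveAt (o : ManifoldOrientation M) (α : SmoothOneForm M) (p : M) : Prop :=
  ∃ b : Module.Basis (Fin 3) ℝ (TangentSpace (𝓡 3) p),
    b.orientation = o.orientationAt p ∧ 0 < contactVol α p (b 0) (b 1) (b 2)

lemma isPositiveAt_iff {o : ManifoldOrientation M} {α : SmoothOneForm M} {p : M}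
    {b : Module.Basis (Fin 3) ℝ (TangentSpace (𝓡 3) p)} (hb : b.orientation = o.orientationAt p) :
    IsPositiveAt o α p ↔ 0 < contactVol α p (b 0) (b 1) (b 2) := by
  refine ⟨fun ⟨c, hc, h⟩ ↦ ?_, fun h ↦ ⟨b, hb, h⟩⟩
  rw [contactVol_eq_det_mul α p c b]
  exact mul_pos ((c.orientation_eq_iff_det_pos b).1 (hc.trans hb.symm)) h

/-- On a continuous oriented frame $\alpha\wedge d\alpha$ is continuous and nonzero, so its sign is
locally constant. This makes the sign in `contactRatio` harmless for smoothness on a possibly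
disconnected $M$. -/
lemma eventually_isPositiveAt_iff (o : ManifoldOrientation M) {α : SmoothOneForm M}
    (hα : IsContactForm α) (p : M) : ∀ᶠ q in 𝓝 p, IsPositiveAt o α q ↔ IsPositiveAt o α p := by
  obtain ⟨U, hU, hpU, s, hs, hb⟩ := o.exists_frame p
  have hc := continuousAt_contactVol α (s := s) fun i ↦ (hs i).continuousAt (hU.mem_nhds hpU)
  have hiff : ∀ q ∈ U, (IsPositiveAt o α q ↔ 0 < contactVol α q (s 0 q) (s 1 q) (s 2 q)) ∧
      contactVol α q (s 0 q) (s 1 q) (s 2 q) ≠ 0 := fun q hq ↦ by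
    obtain ⟨b, hbs, hbo⟩ := hb q hq
    rw [isPositiveAt_iff hbo, ← hbs, ← hbs, ← hbs]
    exact ⟨Iff.rfl, hα.contactVol_ne_zero b⟩
  obtain h | h := (hiff p hpU).2.lt_or_gt
  · filter_upwards [hU.mem_nhds hpU, hc.eventually (gt_mem_nhds h)] with q hq hq'
    rw [(hiff q hq).1, (hiff p hpU).1]
    exact ⟨fun h' ↦ absurd hq' h'.not_gt, fun h' ↦ absurd h h'.not_gt⟩
  · filter_upwards [hU.mem_nhds hpU, hc.eventually (lt_mem_nhds h)] with q hq hq'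
    rw [(hiff q hq).1, (hiff p hpU).1]
    exact ⟨fun _ ↦ h, fun _ ↦ hq'⟩

/-- The ratio of `α ∧ dα` and the oriented Riemannian volume. -/
def contactRatio (o : ManifoldOrientation M) (g : SmoothMetric M) (α : SmoothOneForm M)
    (p : M) : ℝ :=
  open Classical in
  (if IsPositiveAt o α p then 1 else -1) * √(contactDensity g α p)

lemma contMDiff_contactRatio (o : ManifoldOrientation M) (g : SmoothMetric M)
    {α : SmoothOneForm M} (hα : IsContactForm α) :
    ContMDiff (𝓡 3) 𝓘(ℝ, ℝ) ∞ (contactRatio o g α) := by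
  intro p
  have h1 : ContMDiffAt 𝓘(ℝ, ℝ) 𝓘(ℝ, ℝ) ∞ Real.sqrt (contactDensity g α p) :=
    (Real.contDiffAt_sqrt (contactDensity_pos g hα p).ne').contMDiffAt
  have h2 := h1.comp p (contMDiff_contactDensity g α p)
  classical
  refine ((contMDiffAt_const (c := if IsPositiveAt o α p then (1 : ℝ) else -1)).mul
    h2).congr_of_eventuallyEq ?_
  filter_upwards [eventually_isPositiveAt_iff o hα p] with q hq
  simp [contactRatio, hq]

lemma contactRatio_ne_zero (o : ManifoldOrientation M) (g : SmoothMetric M)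
    {α : SmoothOneForm M} (hα : IsContactForm α) (p : M) : contactRatio o g α p ≠ 0 := by
  refine mul_ne_zero ?_ (Real.sqrt_pos.2 (contactDensity_pos g hα p)).ne'
  split_ifs <;> norm_num

lemma contactRatio_eq {o : ManifoldOrientation M} {g : SmoothMetric M} {α : SmoothOneForm M}
    {p : M} {e : Module.Basis (Fin 3) ℝ (TangentSpace (𝓡 3) p)}
    (he : ∀ i j, g.inner p (e i) (e j) = if i = j then 1 else 0)
    (heo : e.orientation = o.orientationAt p) :
    contactRatio o g α p = contactVol α p (e 0) (e 1) (e 2) := by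
  have hG : gramDet g p e = 1 := by
    rw [gramDet]
    convert Matrix.det_one (n := Fin 3) (R := ℝ)
    ext i j
    rw [Matrix.of_apply, he, Matrix.one_apply]
  rw [contactRatio, contactDensity_eq g α p e, hG, div_one, Real.sqrt_sq_eq_abs,
    isPositiveAt_iff heo]
  split_ifs with h
  · rw [abs_of_pos h, one_mul]
  · rw [abs_of_nonpos (not_lt.1 h), neg_mul_neg, one_mul]

/-- A metric for which the Reeb field is the dual of the contact form is adapted. -/
lemma isAdapted_of_reeb (o : ManifoldOrientation M) {g : SmoothMetric M} {α : SmoothOneForm M}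
    (hα : IsContactForm α) {R : SmoothVectorField M} (h1 : ∀ p, α p (R p) = 1)
    (h2 : ∀ p v, oneFormExtDeriv α p (R p) v = 0) (hg : ∀ p v, g.inner p (R p) v = α p v) :
    IsAdapted o g α := by
  refine ⟨contactRatio o g α, contMDiff_contactRatio o g hα, contactRatio_ne_zero o g hα,
    fun p e he heo ↦ ?_⟩
  -- The coordinates of $R$ in an orthonormal basis are $g(R,e_i)=\alpha(e_i)$. Applying $\alpha$
  -- shows that their squares sum to $1$.
  have hR : R p = α p (e 0) • e 0 + α p (e 1) • e 1 + α p (e 2) • e 2 := by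
    have h0 : ∀ v, g.inner p (R p - (α p (e 0) • e 0 + α p (e 1) • e 1 + α p (e 2) • e 2)) v
        = 0 := by
      have h0 : (g.inner p (R p - (α p (e 0) • e 0 + α p (e 1) • e 1 + α p (e 2) • e 2)) :
          TangentSpace (𝓡 3) p →ₗ[ℝ] ℝ) = 0 := by
        refine e.ext fun i ↦ ?_
        fin_cases i <;> simp [he, hg]
      exact fun v ↦ DFunLike.congr_fun h0 v
    by_contra h
    exact (g.pos p _ (sub_ne_zero.2 h)).ne' (h0 _)
  have hr : α p (e 0) ^ 2 + α p (e 1) ^ 2 + α p (e 2) ^ 2 = 1 := by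
    rw [← h1 p]
    conv_rhs => rw [hR]
    simp only [map_add, map_smul, smul_eq_mul]
    ring
  have hd : ∀ v, α p (e 0) * extDerivBilin α p (e 0) v + α p (e 1) * extDerivBilin α p (e 1) v
      + α p (e 2) * extDerivBilin α p (e 2) v = 0 := fun v ↦ by
    have h3 : extDerivBilin α p (R p) v = 0 := h2 p v
    rw [hR] at h3
    simpa only [map_add, map_smul, LinearMap.add_apply, LinearMap.smul_apply, smul_eq_mul] using h3
  have hs := extDerivBilin_swap α p
  have e1 := hd (e 1)
  have e2 := hd (e 2)
  change contactRatio o g α p * α p (e 0) = extDerivBilin α p (e 1) (e 2)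
  rw [contactRatio_eq he heo]
  have hvol : contactVol α p (e 0) (e 1) (e 2) = α p (e 0) * extDerivBilin α p (e 1) (e 2)
      + α p (e 1) * extDerivBilin α p (e 2) (e 0) + α p (e 2) * extDerivBilin α p (e 0) (e 1) := rfl
  have h11 : extDerivBilin α p (e 1) (e 1) = 0 := by linarith [hs (e 1) (e 1)]
  have h22 : extDerivBilin α p (e 2) (e 2) = 0 := by linarith [hs (e 2) (e 2)]
  rw [hvol]
  rw [h11, hs (e 2) (e 1)] at e1
  rw [h22, hs (e 0) (e 2)] at e2
  -- Write $\alpha_i=\alpha(e_i)$ and $\theta_{ij}=d\alpha(e_i,e_j)$. The relation $\iota_R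
  -- d\alpha=0$ gives $\alpha_0\theta_{20}=\alpha_1\theta_{12}$ and
  -- $\alpha_0\theta_{01}=\alpha_2\theta_{12}$, so $\alpha_0$ times the volume is
  -- $\theta_{12}\sum\alpha_i^2=\theta_{12}$.
  linear_combination extDerivBilin α p (e 1) (e 2) * hr + α p (e 2) * e1 - α p (e 1) * e2

end Adapted

/-! ### Lie derivatives of horizontal parts of differentials -/

section InvariantMetric

variable {M : Type*} [TopologicalSpace M] [ChartedSpace E3 M] [IsManifold (𝓡 3) ∞ M]

/-- The part of a differential which vanishes on the Reeb field `R`. -/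
def horizontalForm (R : SmoothVectorField M) (α : SmoothOneForm M) (f : M → ℝ) (q : M) :
    TangentSpace (𝓡 3) q →L[ℝ] ℝ :=
  dForm f q - dForm f q (R q) • α q

variable {R X : SmoothVectorField M} {α : SmoothOneForm M} {f : M → ℝ}

lemma horizontalForm_apply (q : M) (v : TangentSpace (𝓡 3) q) :
    horizontalForm R α f q v = dForm f q v - dForm f q (R q) * α q v := rfl

lemma smoothFormAt_horizontalForm {p : M} (hf : ContMDiffAt (𝓡 3) 𝓘(ℝ, ℝ) ∞ f p) :
    SmoothFormAt (horizontalForm R α f) p := by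
  have h1 := smoothFormAt_iff.1 (smoothFormAt_dForm hf)
  have h2 := smoothFormAt_iff.1 (α.smoothFormAt p)
  have h3 := contMDiffAt_dForm_apply hf (R.smoothFieldAt p)
  refine smoothFormAt_iff.2 ((h1.sub (h3.smul h2)).congr_of_eventuallyEq ?_)
  filter_upwards [extChartAt_source_mem_nhds (I := 𝓡 3) p] with q hq
  have hx : dForm f ((extChartAt (𝓡 3) p).symm (extChartAt (𝓡 3) p q))
      (R ((extChartAt (𝓡 3) p).symm (extChartAt (𝓡 3) p q))) = dForm f q (R q) := by
    rw [(extChartAt (𝓡 3) p).left_inv hq]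
  ext v
  change formInChart (dForm f) p (extChartAt (𝓡 3) p q) v
    - dForm f ((extChartAt (𝓡 3) p).symm (extChartAt (𝓡 3) p q))
        (R ((extChartAt (𝓡 3) p).symm (extChartAt (𝓡 3) p q)))
      * formInChart α p (extChartAt (𝓡 3) p q) v = _
  rw [hx]
  rfl

lemma horizontalForm_reeb (h1 : ∀ p, α p (R p) = 1) (p : M) :
    horizontalForm R α f p (R p) = 0 := by
  rw [horizontalForm_apply, h1]
  ring

/-- The Lie derivative of `horizontalForm R α f` along `X`, if `X f = l h`. -/
lemma lieDerivative_horizontalForm (hα : IsContactForm α) (hXα : PreservesForm X α)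
    (h1 : ∀ p, α p (R p) = 1) (h2 : ∀ p v, oneFormExtDeriv α p (R p) v = 0)
    (hf : ContMDiff (𝓡 3) 𝓘(ℝ, ℝ) ∞ f) {h : M → ℝ} (hh : ContMDiff (𝓡 3) 𝓘(ℝ, ℝ) ∞ h) {l : ℝ}
    (hl : ∀ q, dForm f q (X q) = l * h q) {p : M} {Y : ∀ q : M, TangentSpace (𝓡 3) q}
    (hY : SmoothFieldAt Y p) :
    dForm (fun q ↦ horizontalForm R α f q (Y q)) p (X p)
      = horizontalForm R α f p (mlieBracket (𝓡 3) (fun q ↦ X q) Y p)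
        + l * horizontalForm R α h p (Y p) := by
  have hαY : dForm (fun q ↦ α q (Y q)) p (X p) = α p (mlieBracket (𝓡 3) (fun q ↦ X q) Y p) :=
    hXα p Y hY
  have hXf : dForm (fun q ↦ dForm f q (X q)) p = l • dForm h p := by
    rw [funext hl]
    have hd : HasMFDerivAt (𝓡 3) 𝓘(ℝ, ℝ) (fun q ↦ l * h q) p (l • dForm h p) :=
      ((hh p).mdifferentiableAt (by simp)).hasMFDerivAt.const_smul l
    exact hd.mfderiv
  have hbY := dForm_mlieBracket (hf p) (X.smoothFieldAt p) hY
  have hbR := dForm_mlieBracket (hf p) (X.smoothFieldAt p) (R.smoothFieldAt p)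
  -- Since $[X,R]=0$, the derivations commute and $X(Rf)=R(Xf)=l\,R(h)$. So the coefficient $df(R)$
  -- transforms like $f$ itself.
  rw [hXα.mlieBracket_reeb_eq_zero hα h1 h2, map_zero] at hbR
  rw [hXf, smul_apply, smul_eq_mul] at hbY hbR
  have c1 := contMDiffAt_dForm_apply (hf p) hY
  have c2 := contMDiffAt_dForm_apply (hf p) (R.smoothFieldAt p)
  have c3 := contMDiffAt_form_apply (α.smoothFormAt p) hY
  have m1 := (c1.mdifferentiableAt (by simp)).hasMFDerivAt
  have m2 := (c2.mdifferentiableAt (by simp)).hasMFDerivAt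
  have m3 := (c3.mdifferentiableAt (by simp)).hasMFDerivAt
  have hsum : dForm (fun q ↦ horizontalForm R α f q (Y q)) p (X p)
      = dForm (fun q ↦ dForm f q (Y q)) p (X p)
        - (dForm f p (R p) * dForm (fun q ↦ α q (Y q)) p (X p)
          + α p (Y p) * dForm (fun q ↦ dForm f q (R q)) p (X p)) :=
    DFunLike.congr_fun (m1.sub (m2.mul m3)).mfderiv (X p)
  rw [hsum, horizontalForm_apply, horizontalForm_apply, hαY]
  linear_combination -hbY + α p (Y p) * hbR

end InvariantMetric

/-! ### The invariant adapted metric as a sum of squares -/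

section ExistenceOfMetric

variable {M : Type*} [TopologicalSpace M] [ChartedSpace E3 M] [IsManifold (𝓡 3) ∞ M]
  {ι : Type*} (t : Finset ι) (R : SmoothVectorField M) (α : SmoothOneForm M) (a b : ι → M → ℝ)

/-- The sum of the squares of a contact form and of the horizontal parts of finitely many
differentials. -/
def squaresForm (q : M) : TangentSpace (𝓡 3) q →L[ℝ] TangentSpace (𝓡 3) q →L[ℝ] ℝ :=
  (α q).smulRight (α q)
    + ∑ i ∈ t, ((horizontalForm R α (a i) q).smulRight (horizontalForm R α (a i) q)
      + (horizontalForm R α (b i) q).smulRight (horizontalForm R α (b i) q))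

lemma squaresForm_apply (q : M) (u v : TangentSpace (𝓡 3) q) :
    squaresForm t R α a b q u v = α q u * α q v
      + ∑ i ∈ t, (horizontalForm R α (a i) q u * horizontalForm R α (a i) q v
        + horizontalForm R α (b i) q u * horizontalForm R α (b i) q v) := by
  simp [squaresForm]

variable {t R α a b}

set_option synthInstance.maxHeartbeats 200000 in
lemma contMDiff_squaresForm (ha : ∀ i, ContMDiff (𝓡 3) 𝓘(ℝ, ℝ) ∞ (a i))
    (hb : ∀ i, ContMDiff (𝓡 3) 𝓘(ℝ, ℝ) ∞ (b i)) :
    ContMDiff (𝓡 3) ((𝓡 3).prod 𝓘(ℝ, E3 →L[ℝ] E3 →L[ℝ] ℝ)) ∞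
      (fun q ↦ TotalSpace.mk' (E3 →L[ℝ] E3 →L[ℝ] ℝ)
        (E := fun q : M ↦ TangentSpace (𝓡 3) q →L[ℝ] TangentSpace (𝓡 3) q →L[ℝ] ℝ) q
        (squaresForm t R α a b q)) := by
  intro p
  exact (contMDiffAt_smulRight (α.smoothFormAt p) (α.smoothFormAt p)).add_section
    (ContMDiffAt.sum_section fun i _ ↦
      (contMDiffAt_smulRight (smoothFormAt_horizontalForm (ha i p))
        (smoothFormAt_horizontalForm (ha i p))).add_section
      (contMDiffAt_smulRight (smoothFormAt_horizontalForm (hb i p))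
        (smoothFormAt_horizontalForm (hb i p))))

/-- If the sum of squares vanishes on $v$, then $\alpha(v)=0$, so the horizontal parts coincide with
the full differentials on $v$ and the separation hypothesis applies. -/
lemma squaresForm_pos
    (hinj : ∀ q v, (∀ i ∈ t, dForm (a i) q v = 0 ∧ dForm (b i) q v = 0) → v = 0) (q : M)
    (v : TangentSpace (𝓡 3) q) (hv : v ≠ 0) : 0 < squaresForm t R α a b q v v := by
  rw [squaresForm_apply]
  have hn : ∀ i ∈ t, 0 ≤ horizontalForm R α (a i) q v * horizontalForm R α (a i) q v
      + horizontalForm R α (b i) q v * horizontalForm R α (b i) q v := fun i _ ↦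
    add_nonneg (mul_self_nonneg _) (mul_self_nonneg _)
  refine lt_of_le_of_ne (add_nonneg (mul_self_nonneg _) (Finset.sum_nonneg hn)) fun h ↦ hv ?_
  obtain ⟨h0, hs⟩ := (add_eq_zero_iff_of_nonneg (mul_self_nonneg _) (Finset.sum_nonneg hn)).1 h.symm
  refine hinj q v fun i hi ↦ ?_
  have h2 := (add_eq_zero_iff_of_nonneg (mul_self_nonneg _) (mul_self_nonneg _)).1
    ((Finset.sum_eq_zero_iff_of_nonneg hn).1 hs i hi)
  simpa [horizontalForm_apply, mul_self_eq_zero.1 h0] using h2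

lemma squaresForm_reeb (h1 : ∀ p, α p (R p) = 1) (q : M) (v : TangentSpace (𝓡 3) q) :
    squaresForm t R α a b q (R q) v = α q v := by
  simp [squaresForm_apply, h1, horizontalForm_reeb h1]

lemma hasMFDerivAt_finset_sum (t : Finset ι) {f : ι → M → ℝ} {p : M}
    {f' : ι → TangentSpace (𝓡 3) p →L[ℝ] ℝ}
    (h : ∀ i, HasMFDerivAt (𝓡 3) 𝓘(ℝ, ℝ) (f i) p (f' i)) :
    HasMFDerivAt (𝓡 3) 𝓘(ℝ, ℝ) (∑ i ∈ t, f i) p (∑ i ∈ t, f' i) := by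
  classical
  induction t using Finset.induction_on with
  | empty =>
    exact (hasMFDerivAt_const (0 : ℝ) p).congr_mfderiv (Finset.sum_empty (f := f')).symm
  | insert i t hi ih =>
    rw [Finset.sum_insert hi]
    exact ((h i).add ih).congr_mfderiv (Finset.sum_insert (f := f') hi).symm

/-- The flow preserves the sum of squares, if it rotates each of the pairs `(a i, b i)`. -/
lemma lieDerivative_squaresForm {X : SmoothVectorField M} (hα : IsContactForm α)
    (hXα : PreservesForm X α)
    (h1 : ∀ p, α p (R p) = 1) (h2 : ∀ p v, oneFormExtDeriv α p (R p) v = 0)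
    (ha : ∀ i, ContMDiff (𝓡 3) 𝓘(ℝ, ℝ) ∞ (a i)) (hb : ∀ i, ContMDiff (𝓡 3) 𝓘(ℝ, ℝ) ∞ (b i))
    {l : ι → ℝ} (hXa : ∀ i q, dForm (a i) q (X q) = -l i * b i q)
    (hXb : ∀ i q, dForm (b i) q (X q) = l i * a i q) {p : M}
    {Y Z : ∀ q : M, TangentSpace (𝓡 3) q} (hY : SmoothFieldAt Y p) (hZ : SmoothFieldAt Z p) :
    dForm (fun q ↦ squaresForm t R α a b q (Y q) (Z q)) p (X p)
      = squaresForm t R α a b p (mlieBracket (𝓡 3) (fun q ↦ X q) Y p) (Z p)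
        + squaresForm t R α a b p (Y p) (mlieBracket (𝓡 3) (fun q ↦ X q) Z p) := by
  have hαY : ∀ {Y : ∀ q : M, TangentSpace (𝓡 3) q}, SmoothFieldAt Y p →
      dForm (fun q ↦ α q (Y q)) p (X p) = α p (mlieBracket (𝓡 3) (fun q ↦ X q) Y p) :=
    fun hY ↦ hXα p _ hY
  have hprod : ∀ {β : ∀ q : M, TangentSpace (𝓡 3) q →L[ℝ] ℝ}, SmoothFormAt β p →
      HasMFDerivAt (𝓡 3) 𝓘(ℝ, ℝ) (fun q ↦ β q (Y q) * β q (Z q)) p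
        (β p (Y p) • dForm (fun q ↦ β q (Z q)) p + β p (Z p) • dForm (fun q ↦ β q (Y q)) p) :=
    fun {β} hβ ↦
      (((contMDiffAt_form_apply hβ hY).mdifferentiableAt (by simp)).hasMFDerivAt.mul
        ((contMDiffAt_form_apply hβ hZ).mdifferentiableAt (by simp)).hasMFDerivAt)
  let G : ι → M → ℝ := fun i ↦
    (fun q ↦ horizontalForm R α (a i) q (Y q) * horizontalForm R α (a i) q (Z q))
      + fun q ↦ horizontalForm R α (b i) q (Y q) * horizontalForm R α (b i) q (Z q)
  have hpair : ∀ i, HasMFDerivAt (𝓡 3) 𝓘(ℝ, ℝ) (G i) p (dForm (G i) p) ∧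
      dForm (G i) p (X p)
        = horizontalForm R α (a i) p (mlieBracket (𝓡 3) (fun q ↦ X q) Y p)
            * horizontalForm R α (a i) p (Z p)
          + horizontalForm R α (b i) p (mlieBracket (𝓡 3) (fun q ↦ X q) Y p)
            * horizontalForm R α (b i) p (Z p)
          + (horizontalForm R α (a i) p (Y p)
              * horizontalForm R α (a i) p (mlieBracket (𝓡 3) (fun q ↦ X q) Z p)
            + horizontalForm R α (b i) p (Y p)
              * horizontalForm R α (b i) p (mlieBracket (𝓡 3) (fun q ↦ X q) Z p)) := fun i ↦ by
    have h := (hprod (smoothFormAt_horizontalForm (R := R) (α := α) (ha i p))).add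
      (hprod (smoothFormAt_horizontalForm (R := R) (α := α) (hb i p)))
    refine ⟨h.mdifferentiableAt.hasMFDerivAt, (DFunLike.congr_fun h.mfderiv (X p)).trans ?_⟩
    change horizontalForm R α (a i) p (Y p)
          * dForm (fun q ↦ horizontalForm R α (a i) q (Z q)) p (X p)
        + horizontalForm R α (a i) p (Z p)
          * dForm (fun q ↦ horizontalForm R α (a i) q (Y q)) p (X p)
        + (horizontalForm R α (b i) p (Y p)
          * dForm (fun q ↦ horizontalForm R α (b i) q (Z q)) p (X p)
        + horizontalForm R α (b i) p (Z p)
          * dForm (fun q ↦ horizontalForm R α (b i) q (Y q)) p (X p)) = _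
    -- The Lie derivatives of the horizontal parts of $a_i$ and $b_i$ are $-l_i$ and $+l_i$ times
    -- those of $b_i$ and $a_i$. In the sum of the two squares these cross terms cancel.
    rw [lieDerivative_horizontalForm hα hXα h1 h2 (ha i) (hb i) (hXa i) hY,
      lieDerivative_horizontalForm hα hXα h1 h2 (ha i) (hb i) (hXa i) hZ,
      lieDerivative_horizontalForm hα hXα h1 h2 (hb i) (ha i) (hXb i) hY,
      lieDerivative_horizontalForm hα hXα h1 h2 (hb i) (ha i) (hXb i) hZ]
    ring
  have hsum : HasMFDerivAt (𝓡 3) 𝓘(ℝ, ℝ) (∑ i ∈ t, G i) p (∑ i ∈ t, dForm (G i) p) :=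
    hasMFDerivAt_finset_sum t fun i ↦ (hpair i).1
  have htot := (hprod (α.smoothFormAt p)).add hsum
  have hfun : (fun q ↦ squaresForm t R α a b q (Y q) (Z q))
      = (fun q ↦ α q (Y q) * α q (Z q)) + ∑ i ∈ t, G i :=
    funext fun q ↦ (squaresForm_apply t R α a b q _ _).trans (by simp [Finset.sum_apply, G])
  rw [hfun]
  refine (DFunLike.congr_fun htot.mfderiv (X p)).trans ?_
  change α p (Y p) * dForm (fun q ↦ α q (Z q)) p (X p)
    + α p (Z p) * dForm (fun q ↦ α q (Y q)) p (X p) + (∑ i ∈ t, dForm (G i) p) (X p) = _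
  simp only [squaresForm_apply, sum_apply, (hpair _).2,
    Finset.sum_add_distrib, hαY hY, hαY hZ]
  ring

theorem exists_adapted_metric [T2Space M] [CompactSpace M] (o : ManifoldOrientation M)
    {S : SeifertFibration M} {X : SmoothVectorField M} (hX0 : ∀ p, X p ≠ 0)
    (hXS : TangentToFibers S X) (hα : IsContactForm α) (hXα : PreservesForm X α) :
    ∃ g : SmoothMetric M, IsAdapted o g α ∧ IsKilling g X := by
  obtain ⟨R, h1, h2⟩ := hα.exists_reeb
  obtain ⟨t, l, a, b, ha, hb, hXa, hXb, hinj⟩ := exists_eigenfunctions hXS hX0 hα hXα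
  refine ⟨metricOfPos (squaresForm t R α a b) (fun q v w ↦ ?_) (squaresForm_pos hinj)
    (contMDiff_squaresForm ha hb), isAdapted_of_reeb o hα h1 h2 (squaresForm_reeb h1),
    fun p Y Z hY hZ ↦ lieDerivative_squaresForm hα hXα h1 h2 ha hb hXa hXb hY hZ⟩
  simp only [squaresForm_apply, mul_comm]

end ExistenceOfMetric

/-! ### Conformal rescaling to a unit Killing field -/

section UnitKilling

variable {M : Type*} [TopologicalSpace M] [ChartedSpace E3 M] [IsManifold (𝓡 3) ∞ M]

set_option synthInstance.maxHeartbeats 200000 in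
/-- A metric rescaled by a positive smooth function. -/
def rescaledMetric (g : SmoothMetric M) (f : M → ℝ) (hf : ContMDiff (𝓡 3) 𝓘(ℝ, ℝ) ∞ f)
    (hpos : ∀ p, 0 < f p) : SmoothMetric M :=
  metricOfPos (fun q ↦ f q • g.inner q) (fun q v w ↦ congrArg (f q * ·) (g.symm q v w))
    (fun q v hv ↦ mul_pos (hpos q) (g.pos q v hv))
    fun p ↦ (hf p).smul_section (g.contMDiff p)

lemma rescaledMetric_inner (g : SmoothMetric M) {f : M → ℝ}
    (hf : ContMDiff (𝓡 3) 𝓘(ℝ, ℝ) ∞ f) (hpos : ∀ p, 0 < f p) (p : M)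
    (u v : TangentSpace (𝓡 3) p) :
    (rescaledMetric g f hf hpos).inner p u v = f p * g.inner p u v := rfl

/-- If $e$ is orthonormal for $fg$, then $\sqrt f\,e$ is orthonormal for $g$ with the same
orientation. The 1-form scales by $\sqrt f$ and the 2-form by $f$, so $\mu$ becomes $\mu/\sqrt f$.
-/
lemma isAdapted_rescaledMetric {o : ManifoldOrientation M} {g : SmoothMetric M}
    {α : SmoothOneForm M} (h : IsAdapted o g α) {f : M → ℝ}
    (hf : ContMDiff (𝓡 3) 𝓘(ℝ, ℝ) ∞ f) (hpos : ∀ p, 0 < f p) :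
    IsAdapted o (rescaledMetric g f hf hpos) α := by
  obtain ⟨μ, hμ, hμ0, hstar⟩ := h
  have hs : ∀ p, 0 < √(f p) := fun p ↦ Real.sqrt_pos.2 (hpos p)
  refine ⟨fun p ↦ μ p / √(f p), fun p ↦ ?_, fun p ↦ div_ne_zero (hμ0 p) (hs p).ne',
    fun p e he heo ↦ ?_⟩
  · have h1 : ContMDiffAt 𝓘(ℝ, ℝ) 𝓘(ℝ, ℝ) ∞ Real.sqrt (f p) :=
      (Real.contDiffAt_sqrt (hpos p).ne').contMDiffAt
    exact (hμ p).div₀ (h1.comp p (hf p)) (hs p).ne'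
  · let w : Fin 3 → ℝˣ := fun _ ↦ Units.mk0 (√(f p)) (hs p).ne'
    have hsq : √(f p) * √(f p) = f p := Real.mul_self_sqrt (hpos p).le
    have hw : ∀ i, e.unitsSMul w i = √(f p) • e i := fun i ↦ e.unitsSMul_apply i
    have h1 := hstar p (e.unitsSMul w) (fun i j ↦ by
      rw [hw, hw, ← he i j, rescaledMetric_inner]
      simp only [map_smul, smul_apply, smul_eq_mul]
      rw [← mul_assoc, hsq]) (by
      rw [← heo, eq_comm, e.orientation_eq_iff_det_pos, e.det_unitsSMul_self]
      exact Finset.prod_pos fun _ _ ↦ hs p)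
    rw [hw, hw, hw] at h1
    have h2 : √(f p) * (μ p * α p (e 0))
        = √(f p) * (√(f p) * extDerivBilin α p (e 1) (e 2)) := by
      have h3 : (μ p • α p) (√(f p) • e 0)
        = extDerivBilin α p (√(f p) • e 1) (√(f p) • e 2) := h1
      simpa only [map_smul, smul_apply, LinearMap.smul_apply, smul_eq_mul] using h3
    change μ p / √(f p) * α p (e 0) = extDerivBilin α p (e 1) (e 2)
    have := (hs p).ne'
    field_simp
    exact mul_left_cancel₀ this (by linear_combination h2)

lemma isKilling_rescaledMetric {g : SmoothMetric M} {X : SmoothVectorField M}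
    (h : IsKilling g X) {f : M → ℝ} (hf : ContMDiff (𝓡 3) 𝓘(ℝ, ℝ) ∞ f) (hpos : ∀ p, 0 < f p)
    (hXf : ∀ p, dForm f p (X p) = 0) : IsKilling (rescaledMetric g f hf hpos) X := by
  intro p Y Z hY hZ
  have h1 : dForm (fun q ↦ g.inner q (Y q) (Z q)) p (X p)
      = g.inner p (mlieBracket (𝓡 3) (fun q ↦ X q) Y p) (Z p)
        + g.inner p (Y p) (mlieBracket (𝓡 3) (fun q ↦ X q) Z p) := h p Y Z hY hZ
  have h2 : dForm (fun q ↦ f q * g.inner q (Y q) (Z q)) p (X p)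
      = f p * dForm (fun q ↦ g.inner q (Y q) (Z q)) p (X p)
        + g.inner p (Y p) (Z p) * dForm f p (X p) :=
    DFunLike.congr_fun (((hf p).mdifferentiableAt (by simp)).hasMFDerivAt.mul
      ((contMDiffAt_metric g hY hZ).mdifferentiableAt (by simp)).hasMFDerivAt).mfderiv (X p)
  refine h2.trans ?_
  rw [h1, hXf, mul_zero, add_zero, mul_add]
  rfl

/-- The normalization forces $f=1/g(X,X)$. The Killing equation evaluated on the pair $(X,X)$ gives
$X(g(X,X))=2g([X,X],X)=0$, so this $f$ is invariant and rescaling by it keeps $X$ Killing. -/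
theorem exists_unit_killing_metric {o : ManifoldOrientation M} {X : SmoothVectorField M}
    (hX0 : ∀ p, X p ≠ 0) {α : SmoothOneForm M} {g : SmoothMetric M} (hg : IsAdapted o g α)
    (hK : IsKilling g X) :
    ∃ g' : SmoothMetric M, IsConformalTo g' g ∧ IsAdapted o g' α ∧ IsKilling g' X ∧
      ∀ p, g'.inner p (X p) (X p) = 1 := by
  have hpos : ∀ p, 0 < g.inner p (X p) (X p) := fun p ↦ g.pos p _ (hX0 p)
  have hsm : ContMDiff (𝓡 3) 𝓘(ℝ, ℝ) ∞ fun p ↦ g.inner p (X p) (X p) := fun p ↦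
    contMDiffAt_metric g (X.smoothFieldAt p) (X.smoothFieldAt p)
  let f : M → ℝ := fun p ↦ (g.inner p (X p) (X p))⁻¹
  have hf : ContMDiff (𝓡 3) 𝓘(ℝ, ℝ) ∞ f := fun p ↦ (hsm p).inv₀ (hpos p).ne'
  have hf0 : ∀ p, 0 < f p := fun p ↦ inv_pos.2 (hpos p)
  have hXf : ∀ p, dForm f p (X p) = 0 := by
    intro p
    have h1 : dForm (fun q ↦ g.inner q (X q) (X q)) p (X p)
        = g.inner p (mlieBracket (𝓡 3) (fun q ↦ X q) (fun q ↦ X q) p) (X p)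
          + g.inner p (X p) (mlieBracket (𝓡 3) (fun q ↦ X q) (fun q ↦ X q) p) :=
      hK p _ _ (X.smoothFieldAt p) (X.smoothFieldAt p)
    have h0 : dForm (fun q ↦ g.inner q (X q) (X q)) p (X p) = 0 := by
      rw [h1, mlieBracket_self]
      simp
    let L : ℝ →L[ℝ] ℝ :=
      ContinuousLinearMap.toSpanSingleton ℝ (-((g.inner p (X p) (X p)) ^ 2)⁻¹)
    have hi : HasMFDerivAt 𝓘(ℝ, ℝ) 𝓘(ℝ, ℝ) (fun y : ℝ ↦ y⁻¹) (g.inner p (X p) (X p)) L :=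
      hasMFDerivAt_iff_hasFDerivAt.2 (hasFDerivAt_inv (hpos p).ne')
    have h2 := DFunLike.congr_fun
      (hi.comp p ((hsm p).mdifferentiableAt (by simp)).hasMFDerivAt).mfderiv (X p)
    exact h2.trans ((congrArg L h0).trans (map_zero L))
  exact ⟨rescaledMetric g f hf hf0, ⟨f, hf, hf0, fun p u v ↦ rfl⟩,
    isAdapted_rescaledMetric hg hf hf0, isKilling_rescaledMetric hK hf hf0 hXf,
    fun p ↦ inv_mul_cancel₀ (hpos p).ne'⟩

end UnitKilling

end

/-- On a closed oriented Seifert fibered 3-manifold, a contact form invariant under a nonsingular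
vector field `X` tangent to the fibers has an adapted metric for which `X` is Killing; moreover
every such adapted metric is conformal to an adapted metric for which `X` is a unit Killing
field. -/
theorem mainTheorem7 {M : Type*} [TopologicalSpace M] [ChartedSpace E3 M]
    [IsManifold (𝓡 3) ∞ M] [T2Space M] [CompactSpace M]
    (o : ManifoldOrientation M) (S : SeifertFibration M)
    (X : SmoothVectorField M) (hX0 : ∀ p, X p ≠ 0) (hXS : TangentToFibers S X)
    (α : SmoothOneForm M) (hα : IsContactForm α) (hXα : PreservesForm X α) :
    (∃ g : SmoothMetric M, IsAdapted o g α ∧ IsKilling g X) ∧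
    ∀ g : SmoothMetric M, IsAdapted o g α → IsKilling g X →
      ∃ g' : SmoothMetric M, IsConformalTo g' g ∧ IsAdapted o g' α ∧ IsKilling g' X ∧
        ∀ p, g'.inner p (X p) (X p) = 1 :=
  ⟨exists_adapted_metric o hX0 hXS hα hXα, fun _ hg hK ↦ exists_unit_killing_metric hX0 hg hK⟩
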